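/- **Setting.** A context-free grammar $G=(N,\Sigma,P)$ has a finite set $N$ of nonterminals and a finite set $P$ of rules, each of the form $a\to b\,c$ or $a\to\sigma$ ($a,b,c\in N$, $\sigma\in\Sigma$); $L(G;a)\subseteq\Sigma^*$ is the set of strings derivable from $a$. A graph $\Gamma=(Q,\Sigma,\delta)$ has a finite set $Q$ of nodes and a finite set $\delta\subseteq Q\times\Sigma\times Q$ of labeled edges; $L(\Gamma;m,n)$ is the set of traces of paths from $m$ to $n$. The *annotated grammar* has the nonterminals $N_\Gamma=\{a[m,n] : L(G;a)\cap L(\Gamma;m,n)\ne\emptyset\}$ and the rules $P_\Gamma$: all $a[m,n]\to b[m,o]\,c[o,n]$ with $(a\to b\,c)\in P$ and $a[m,n],b[m,o],c[o,n]\in N_\Gamma$, and all $a[m,n]\to\sigma$ with $(a\to\sigma)\in P$ and $(m,\sigma,n)\in\delta$. A set $P'$ of rules of a grammar is *minimizing* if (1) no head $a$ of $P'$ derives, in one or more steps of $P'$, a string containing $a$; each head has exactly one rule in $P'$ and derives some string over $\Sigma$ by $P'$; and (2) from every nonterminal $a$ of the grammar with nonempty language, $P'$ derives exactly one string over $\Sigma$,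 and its length is the minimum length of a string the grammar derives from $a$. **Algorithm.** It maintains partial maps $P'$ and $\mathrm{cost}$ on annotated nonterminals, initially empty, and a min-priority queue $\mathrm{new}$. For all $(a\to\sigma)\in P$ and $(m,\sigma,n)\in\delta$: if $a[m,n]$ has no cost yet, set $\mathrm{cost}[a[m,n]]:=1$, $P'[a[m,n]]:=(a[m,n]\to\sigma)$, and add $a[m,n]$ to $\mathrm{new}$ with priority $1$. While $\mathrm{new}\neq\emptyset$: remove some $a[m,n]$ of minimum priority; for all $(c\to a\,b)\in P$ and $o$ with $b[n,o]$ having a cost, call $\mathrm{produce}(c[m,o]\to a[m,n]\,b[n,o])$; then for all $(c\to b\,a)\in P$ and $o$ with $b[o,m]$ having a cost, call $\mathrm{produce}(c[o,n]\to b[o,m]\,a[m,n])$. Return all $P'[x]$. Here $\mathrm{produce}(d\to e\,f)$ does the following, with $k=\mathrm{cost}[e]+\mathrm{cost}[f]$: if $d$ has no cost, or $\mathrm{cost}[d]>k$, it sets $\mathrm{cost}[d]:=k$ and $P'[d]:=(d\to e\,f)$, and adds $d$ to $\mathrm{new}$ with priority $k$, respectively lowers its priority to $k$. **Proposition.** For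 every context-free grammar $G$ and every graph $\Gamma$, the algorithm terminates and returns a minimizing set of production rules for the annotated grammar over $(G,\Gamma)$, with any correct min-priority queue. If the queue is a Fibonacci heap, its running time is $$O\bigl(|N_\Gamma|\,(|N_\Gamma|\log|N_\Gamma|+|P_\Gamma|)\bigr),$$ and hence $$O\bigl(|N||Q|^2\bigl(|N||Q|^2\log(|N||Q|^2)+|P||Q|^3+\min(|N|,|P|)\,|\delta|\bigr)\bigr),$$ which is bounded by a polynomial in $|N|,|Q|,|P|,|\delta|$. The constants (and the polynomial) are absolute, and $O(f)$ means at most a constant times $\max(1,f)$. Time counts elementary steps: an operation on pointers, lists, or table entries is one step, and an operation on costs takes one step plus the number of bits of the integers involved. The grammar and the graph are given in look-up tables (the symbols that occur both in a rule and on an edge; for each symbol, the nonterminals and the edges that carry it; for $a,b$, the list of all $c$ with $(c\to a\,b)\in P$), whose construction is not counted. -/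

import Mathlib

universe u v w

/-! ### Strings, grammars, graphs -/

/-- A production rule `a → b c` or `a → σ` (Chomsky normal form without empty bodies), with
nonterminals in `V` and alphabet symbols in `S`. -/
inductive Rule (V : Type u) (S : Type v) where
  | bin (a b c : V) : Rule V S
  | term (a : V) (s : S) : Rule V S
deriving DecidableEq

namespace Rule

variable {V : Type u} {S : Type v}

/-- The nonterminal on the left-hand side. -/
def head : Rule V S → V
  | bin a _ _ => a
  | term a _ => a

/-- The string on the right-hand side. -/
def body : Rule V S → List (Symbol S V)
  | bin _ b c => [Symbol.nonterminal b, Symbol.nonterminal c]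
  | term _ s => [Symbol.terminal s]

/-- The rule as a rewrite rule of Mathlib. -/
def toContextFreeRule (r : Rule V S) : ContextFreeRule S V := ⟨r.head, r.body⟩

end Rule

/-- A context-free grammar (without a start symbol): finitely many nonterminals and finitely many
production rules over them. -/
structure Grammar (V : Type u) (S : Type v) where
  nonterminals : Finset V
  rules : Finset (Rule V S)
  head_mem : ∀ r ∈ rules, r.head ∈ nonterminals
  body_mem : ∀ r ∈ rules, ∀ b, Symbol.nonterminal b ∈ r.body → b ∈ nonterminals

section Derivations

variable {V : Type u} {S : Type v}

/-- One rewrite step with a rule of `P`. -/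
def Rewrites (P : Set (Rule V S)) (x y : List (Symbol S V)) : Prop :=
  ∃ r ∈ P, r.toContextFreeRule.Rewrites x y

/-- Finitely many (possibly zero) rewrite steps. -/
def Derives (P : Set (Rule V S)) : List (Symbol S V) → List (Symbol S V) → Prop :=
  Relation.ReflTransGen (Rewrites P)

/-- Finitely many, and at least one, rewrite steps. -/
def DerivesPlus (P : Set (Rule V S)) : List (Symbol S V) → List (Symbol S V) → Prop :=
  Relation.TransGen (Rewrites P)

/-- The strings over the alphabet that can be derived from the nonterminal `a`. -/
def languageOf (P : Set (Rule V S)) (a : V) : Set (List S) :=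
  {x | Derives P [Symbol.nonterminal a] (x.map Symbol.terminal)}

/-- The minimum length of a string of the (nonempty) language `L`. -/
noncomputable def minLength (L : Set (List S)) : ℕ := sInf (List.length '' L)

/-- The nonterminals that have a rule in `P`. -/
def heads (P : Set (Rule V S)) : Set V := {a | ∃ r ∈ P, r.head = a}

/-- The nonterminals derivable from `a` in at least one step. -/
def derivableNonterminals (P : Set (Rule V S)) (a : V) : Set V :=
  {b | ∃ x y : List (Symbol S V),
    DerivesPlus P [Symbol.nonterminal a] (x ++ [Symbol.nonterminal b] ++ y)}

def NonRecursive (P : Set (Rule V S)) : Prop :=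
  ∀ a ∈ heads P, a ∉ derivableNonterminals P a

structure DeterministicNonRecursive (P : Set (Rule V S)) : Prop where
  nonRecursive : NonRecursive P
  unique_rule : ∀ a ∈ heads P, ∃! r, r ∈ P ∧ r.head = a
  derives_string : ∀ a ∈ heads P, (languageOf P a).Nonempty

/-- `P'` is a minimizing set of production rules for the grammar `G`: a deterministic non-recursive
subset of the rules such that every nonterminal `a` of `G` with a nonempty language is rewritten by
`P'` into exactly one string, and the length of this string is the least length of a string that
`G` derives from `a`. -/
structure IsMinimizing (G : Grammar V S) (P' : Set (Rule V S)) : Prop where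
  subset : P' ⊆ (G.rules : Set (Rule V S))
  deterministic : DeterministicNonRecursive P'
  minimal : ∀ a ∈ G.nonterminals, (languageOf (G.rules : Set (Rule V S)) a).Nonempty →
    ∃ x, languageOf P' a = {x} ∧
      x.length = minLength (languageOf (G.rules : Set (Rule V S)) a)

end Derivations

/-- A finite graph with edges labelled by symbols; `(m, s, n)` is the edge from `m` to `n` with
label `s`. -/
structure LabeledGraph (Q : Type w) (S : Type v) where
  nodes : Finset Q
  edges : Finset (Q × S × Q)
  source_mem : ∀ e ∈ edges, e.1 ∈ nodes
  target_mem : ∀ e ∈ edges, e.2.2 ∈ nodes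

namespace LabeledGraph

variable {Q : Type w} {S : Type v}

/-- The nodes reachable from `m` along a path with trace `x`. -/
def reach (Γ : LabeledGraph Q S) : Q → List S → Set Q
  | m, [] => {m}
  | m, s :: x => ⋃ n ∈ {n | (m, s, n) ∈ Γ.edges}, Γ.reach n x

/-- The traces of the paths from `m` to `n`. -/
def language (Γ : LabeledGraph Q S) (m n : Q) : Set (List S) := {x | n ∈ Γ.reach m x}

end LabeledGraph

/-! ### The annotated grammar -/

/-- Annotated nonterminals `a[m, n]` are triples `(a, m, n)`. -/
abbrev Anno (V : Type u) (Q : Type w) : Type (max u w) := V × Q × Q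

section Annotated

variable {V : Type u} {S : Type v} {Q : Type w}

open Classical in
/-- The annotated nonterminals: all `a[m, n]` such that `a` derives the trace of a path from `m`
to `n`. -/
noncomputable def annoNonterminals (G : Grammar V S) (Γ : LabeledGraph Q S) :
    Finset (Anno V Q) :=
  (G.nonterminals ×ˢ Γ.nodes ×ˢ Γ.nodes).filter fun x =>
    (languageOf (G.rules : Set (Rule V S)) x.1 ∩ Γ.language x.2.1 x.2.2).Nonempty

open Classical in
/-- The annotated rules: all `a[m, n] → b[m, o] c[o, n]` over annotated nonterminals such that
`a → b c` is a rule, and all `a[m, n] → s` such that `a → s` is a rule and `(m, s, n)` an edge. -/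
noncomputable def annoRules (G : Grammar V S) (Γ : LabeledGraph Q S) :
    Finset (Rule (Anno V Q) S) :=
  ((annoNonterminals G Γ ×ˢ annoNonterminals G Γ ×ˢ annoNonterminals G Γ).filter fun t =>
      t.1.2.1 = t.2.1.2.1 ∧ t.2.1.2.2 = t.2.2.2.1 ∧ t.2.2.2.2 = t.1.2.2 ∧
        Rule.bin t.1.1 t.2.1.1 t.2.2.1 ∈ G.rules).image (fun t => Rule.bin t.1 t.2.1 t.2.2) ∪
  ((annoNonterminals G Γ ×ˢ Γ.edges).filter fun t =>
      t.1.2.1 = t.2.1 ∧ t.1.2.2 = t.2.2.2 ∧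
        Rule.term t.1.1 t.2.2.1 ∈ G.rules).image (fun t => Rule.term t.1 t.2.2.1)

/-- The annotated grammar over `(G, Γ)`. -/
noncomputable def annotatedGrammar (G : Grammar V S) (Γ : LabeledGraph Q S) :
    Grammar (Anno V Q) S where
  nonterminals := annoNonterminals G Γ
  rules := annoRules G Γ
  head_mem := by
    classical
    intro r hr
    simp only [annoRules, Finset.mem_union, Finset.mem_image, Finset.mem_filter,
      Finset.mem_product] at hr
    rcases hr with ⟨t, ⟨⟨h, _⟩, _⟩, rfl⟩ | ⟨t, ⟨⟨h, _⟩, _⟩, rfl⟩ <;> exact h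
  body_mem := by
    classical
    intro r hr b hb
    simp only [annoRules, Finset.mem_union, Finset.mem_image, Finset.mem_filter,
      Finset.mem_product] at hr
    rcases hr with ⟨t, ⟨⟨_, h1, h2⟩, _⟩, rfl⟩ | ⟨t, ⟨⟨h, _⟩, _⟩, rfl⟩
    · simp only [Rule.body, List.mem_cons, Symbol.nonterminal.injEq, List.not_mem_nil,
        or_false] at hb
      rcases hb with rfl | rfl
      · exact h1
      · exact h2
    · simp [Rule.body] at hb

end Annotated

/-! ### Programs with a step count -/

/-- A program that returns a value together with the number of steps it has made; `none` stands for
a program that does not terminate or that crashes. -/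
def Timed (α : Type u) : Type u := Option (α × ℕ)

namespace Timed

def ret {α : Type u} (a : α) : Timed α := some (a, 0)

def andThen {α : Type u} {β : Type v} (x : Timed α) (f : α → Timed β) : Timed β :=
  Option.bind x fun p => Option.bind (f p.1) fun q => some (q.1, p.2 + q.2)

instance : Monad Timed where
  pure := ret
  bind := andThen

/-- Make `n` steps. -/
def tick (n : ℕ) : Timed PUnit.{u + 1} := some (PUnit.unit, n)

/-- Crash. -/
def crash {α : Type u} : Timed α := (none : Option (α × ℕ))

/-- Repeat `f` from the current state `s` until it delivers a result, but at most `n` times; `none`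
if there is no result by then. -/
def iterate {σ : Type u} {α : Type u} (f : σ → Timed (σ ⊕ α)) : ℕ → σ → Timed α
  | 0, _ => crash
  | n + 1, s => andThen (f s) fun r =>
    match r with
    | Sum.inl s' => iterate f n s'
    | Sum.inr a => ret a

open Classical in
/-- A loop: repeat `f` from the current state `s` until it delivers a result. -/
noncomputable def loop {σ : Type u} {α : Type u} (f : σ → Timed (σ ⊕ α)) (s : σ) : Timed α :=
  if h : ∃ n, iterate f n s ≠ crash then iterate f (Nat.find h) s else crash

/-- `for x in l do s := f s x`. -/
def forEach {σ : Type u} {α : Type v} (l : List α) (s : σ) (f : σ → α → Timed σ) : Timed σ :=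
  match l with
  | [] => ret s
  | x :: l => andThen (f s x) fun s' => forEach l s' f

/-- Comparison of two binary integers; its cost is linear in the numbers of their bits. -/
def less (p q : ℕ) : Timed (ULift.{u} Bool) := do
  tick (1 + Nat.size p + Nat.size q)
  pure ⟨decide (p < q)⟩

end Timed

/-! ### Min-priority queues -/

/-- An implementation of a priority queue on items in `K` with priorities in `ℕ`. -/
structure PriorityQueue (K : Type u) where
  Heap : Type u
  empty : Heap
  /-- Add an item with a priority. -/
  insert : K → ℕ → Heap → Timed Heap
  /-- Take and remove an item of minimum priority; `none` if the queue is empty. -/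
  extractMin : Heap → Timed (Option (K × Heap))
  /-- Lower the priority of an item. -/
  decreaseKey : K → ℕ → Heap → Timed Heap

/-- The implementation behaves as a min-priority queue: a relation `R` tells which contents
(a partial map from items to priorities) a heap stands for, and every operation terminates and does
to the contents what it has to do. Nothing is said about costs, or about which one of several items
of minimum priority is taken. -/
def PriorityQueue.IsCorrect {K : Type u} [DecidableEq K] (pq : PriorityQueue K) : Prop :=
  ∃ R : pq.Heap → (K → Option ℕ) → Prop,
    R pq.empty (fun _ => none) ∧
    (∀ h c x p, R h c → c x = none →
      ∃ h' t, pq.insert x p h = some (h', t) ∧ R h' (Function.update c x (some p))) ∧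
    (∀ h c, R h c → (∀ x, c x = none) → ∃ t, pq.extractMin h = some (none, t)) ∧
    (∀ h c, R h c → (∃ x, c x ≠ none) →
      ∃ x p h' t, pq.extractMin h = some (some (x, h'), t) ∧ c x = some p ∧
        (∀ y q, c y = some q → p ≤ q) ∧ R h' (Function.update c x none)) ∧
    (∀ h c x p q, R h c → c x = some q → p ≤ q →
      ∃ h' t, pq.decreaseKey x p h = some (h', t) ∧ R h' (Function.update c x (some p)))

/-! ### Fibonacci heaps

Every item is a record with its priority, a pointer to its parent, the list of its children and
a mark. Reading or writing a field is one step. The lists are doubly linked lists with stored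
lengths, so that each of the following is one step: adding an element, deleting an element that is
given by a pointer, appending a list to another, reading the length. -/

structure FibHeap (K : Type u) where
  roots : List K
  minPtr : Option K
  prio : K → ℕ
  parent : K → Option K
  children : K → List K
  mark : K → Bool

namespace FibHeap

open Timed

variable {K : Type u} [DecidableEq K]

def empty : FibHeap K := ⟨[], none, fun _ => 0, fun _ => none, fun _ => [], fun _ => false⟩

/-- Let `minPtr` point to the root `x` if it has a smaller priority than the present minimum. -/
def updateMin (x : K) (h : FibHeap K) : Timed (FibHeap K) := do
  tick 1
  match h.minPtr with
  | none => pure { h with minPtr := some x }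
  | some y =>
    let b ← less (h.prio x) (h.prio y)
    if b.down then pure { h with minPtr := some x } else pure h

/-- Insert: a new root. -/
def insert (x : K) (p : ℕ) (h : FibHeap K) : Timed (FibHeap K) := do
  tick (1 + Nat.size p)
  updateMin x
    { h with
      roots := x :: h.roots
      prio := Function.update h.prio x p
      parent := Function.update h.parent x none
      children := Function.update h.children x []
      mark := Function.update h.mark x false }

/-- Make `y`, a former root, a child of the root `x`. -/
def link (y x : K) (h : FibHeap K) : FibHeap K :=
  { h with
    parent := Function.update h.parent y (some x)
    children := Function.update h.children x (y :: h.children x)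
    mark := Function.update h.mark y false }

/-- Cut `x` from its parent `y` and make it a root. -/
def cut (x y : K) (h : FibHeap K) : FibHeap K :=
  { h with
    roots := x :: h.roots
    parent := Function.update h.parent x none
    children := Function.update h.children y ((h.children y).erase x)
    mark := Function.update h.mark x false }

/-- Called when `y` has lost a child: `y` is marked if it was unmarked; otherwise it is cut from
its parent, and we go on with that parent. Roots stay as they are. -/
noncomputable def cascadingCut (y : K) (h : FibHeap K) : Timed (FibHeap K) :=
  loop (σ := K × FibHeap K)
    (fun s => do
      tick 1
      match s.2.parent s.1 with
      | none => pure (Sum.inr s.2)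
      | some z =>
        if s.2.mark s.1 then pure (Sum.inl (z, cut s.1 z s.2))
        else pure (Sum.inr { s.2 with mark := Function.update s.2.mark s.1 true }))
    (y, h)

/-- Decrease the priority of `x` to `p`; if this violates the heap order, cut `x`. -/
noncomputable def decreaseKey (x : K) (p : ℕ) (h : FibHeap K) : Timed (FibHeap K) := do
  tick (1 + Nat.size p)
  let h := { h with prio := Function.update h.prio x p }
  match h.parent x with
  | none => updateMin x h
  | some y =>
    let b ← less p (h.prio y)
    if b.down then
      let h ← cascadingCut y (cut x y h)
      updateMin x h
    else updateMin x h

/-- The state while roots of equal degree are linked: `slot d` is the root of degree `d` that has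
been met so far, and `maxDeg` bounds the degrees of the occupied slots. -/
structure Slots (K : Type u) where
  heap : FibHeap K
  slot : ℕ → Option K
  maxDeg : ℕ

/-- Put the root `x` into the slot of its degree; as long as that slot is taken, link the two roots
and go on with the one that stays a root. -/
noncomputable def place (s : Slots K) (x : K) : Timed (Slots K) :=
  loop (σ := K × Slots K)
    (fun s => do
      tick 1
      let x := s.1
      let h := s.2.heap
      let d := (h.children x).length
      match s.2.slot d with
      | none =>
        pure (Sum.inr
          { heap := h, slot := Function.update s.2.slot d (some x), maxDeg := max s.2.maxDeg d })
      | some y =>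
        let b ← less (h.prio y) (h.prio x)
        let slot := Function.update s.2.slot d none
        if b.down then
          pure (Sum.inl (y, { heap := link x y h, slot := slot, maxDeg := s.2.maxDeg }))
        else
          pure (Sum.inl (x, { heap := link y x h, slot := slot, maxDeg := s.2.maxDeg })))
    (x, s)

/-- Link roots until all of them have different degrees; then rebuild the list of roots and find
the minimum. -/
noncomputable def consolidate (h : FibHeap K) : Timed (FibHeap K) := do
  let s ← forEach h.roots ⟨h, fun _ => none, 0⟩ place
  tick 1
  forEach (List.range (s.maxDeg + 1)) { s.heap with roots := [], minPtr := none } fun h d => do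
    tick 1
    match s.slot d with
    | none => pure h
    | some x => updateMin x { h with roots := x :: h.roots }

/-- Take out the root `z` of minimum priority: its children become roots, and the heap is
consolidated. -/
noncomputable def extractMin (h : FibHeap K) : Timed (Option (K × FibHeap K)) := do
  tick 1
  match h.minPtr with
  | none => pure none
  | some z =>
    let h ← forEach (h.children z) h fun h x => do
      tick 1
      pure { h with
        parent := Function.update h.parent x none
        mark := Function.update h.mark x false }
    let h ← consolidate
      { h with
        roots := h.children z ++ h.roots.erase z
        children := Function.update h.children z [] }
    pure (some (z, h))

end FibHeap

/-- Fibonacci heaps as priority queues. -/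
noncomputable def fibonacciHeap (K : Type u) [DecidableEq K] : PriorityQueue K where
  Heap := FibHeap K
  empty := FibHeap.empty
  insert := FibHeap.insert
  extractMin := FibHeap.extractMin
  decreaseKey := FibHeap.decreaseKey

/-! ### The algorithm -/

/-- The input of the algorithm: a grammar and a graph, stored in look-up tables, with the entries of
each table in any order. -/
structure LookupTables {V : Type u} {S : Type v} {Q : Type w}
    (G : Grammar V S) (Γ : LabeledGraph Q S) where
  /-- The symbols that occur both in a rule and on an edge. -/
  symbols : List S
  symbols_nodup : symbols.Nodup
  mem_symbols : ∀ s, s ∈ symbols ↔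
    (∃ a, Rule.term a s ∈ G.rules) ∧ (∃ m n, (m, s, n) ∈ Γ.edges)
  /-- The nonterminals `a` with a rule `a → s`. -/
  termHeads : S → List V
  termHeads_nodup : ∀ s, (termHeads s).Nodup
  mem_termHeads : ∀ s a, a ∈ termHeads s ↔ Rule.term a s ∈ G.rules
  /-- The pairs of nodes that are connected by an edge with label `s`. -/
  edgesOf : S → List (Q × Q)
  edgesOf_nodup : ∀ s, (edgesOf s).Nodup
  mem_edgesOf : ∀ s m n, (m, n) ∈ edgesOf s ↔ (m, s, n) ∈ Γ.edges
  /-- The nonterminals `c` with a rule `c → a b`. -/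
  binHeads : V → V → List V
  binHeads_nodup : ∀ a b, (binHeads a b).Nodup
  mem_binHeads : ∀ a b c, c ∈ binHeads a b ↔ Rule.bin c a b ∈ G.rules

namespace MinimizingRules

open Timed

variable {V : Type u} {S : Type v} {Q : Type w} [DecidableEq V] [DecidableEq Q]

/-- The variables of the algorithm. The partial maps `rule` and `cost` have the same domain, which
is also stored as a list (`keys`) and, split by the first and by the second node of the annotated
nonterminals, as lists `starting` and `ending`. -/
structure Vars (S : Type v) (pq : PriorityQueue (Anno V Q)) where
  rule : Anno V Q → Option (Rule (Anno V Q) S)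
  cost : Anno V Q → Option ℕ
  new : pq.Heap
  keys : List (Anno V Q)
  starting : Q → List (Anno V Q)
  ending : Q → List (Anno V Q)

variable {pq : PriorityQueue (Anno V Q)}

def Vars.init (S : Type v) (pq : PriorityQueue (Anno V Q)) : Vars S pq :=
  ⟨fun _ => none, fun _ => none, pq.empty, [], fun _ => [], fun _ => []⟩

/-- `cost[x], rule[x] := p, r`, where `x` had no cost before, and add `x` to `new` with priority
`p`. -/
def addNew (r : Rule (Anno V Q) S) (p : ℕ) (st : Vars S pq) : Timed (Vars S pq) := do
  tick (1 + Nat.size p)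
  let x := r.head
  let h : ULift.{max u v w} pq.Heap ← andThen (pq.insert x p st.new) fun h => ret ⟨h⟩
  pure
    { rule := Function.update st.rule x (some r)
      cost := Function.update st.cost x (some p)
      new := h.down
      keys := x :: st.keys
      starting := Function.update st.starting x.2.1 (x :: st.starting x.2.1)
      ending := Function.update st.ending x.2.2 (x :: st.ending x.2.2) }

/-- `cost[x], rule[x] := p, r`, and lower the priority of `x` in `new` to `p`. -/
def lower (r : Rule (Anno V Q) S) (p : ℕ) (st : Vars S pq) : Timed (Vars S pq) := do
  tick (1 + Nat.size p)
  let x := r.head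
  let h : ULift.{max u v w} pq.Heap ← andThen (pq.decreaseKey x p st.new) fun h => ret ⟨h⟩
  pure
    { st with
      rule := Function.update st.rule x (some r)
      cost := Function.update st.cost x (some p)
      new := h.down }

/-- The procedure `produce(d → e f)`. -/
def produce (d e f : Anno V Q) (st : Vars S pq) : Timed (Vars S pq) := do
  tick 1
  match st.cost e, st.cost f with
  | some p, some q =>
    tick (1 + Nat.size p + Nat.size q)
    match st.cost d with
    | none => addNew (Rule.bin d e f) (p + q) st
    | some k =>
      let b ← less (p + q) k
      if b.down then lower (Rule.bin d e f) (p + q) st else pure st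
  | _, _ => crash

variable {G : Grammar V S} {Γ : LabeledGraph Q S}

/-- The initialization: for all `a → s` and all edges `(m, s, n)`. -/
def initialization (T : LookupTables G Γ) : Timed (Vars S pq) :=
  forEach T.symbols (Vars.init S pq) fun st s => do
    tick 1
    forEach (T.termHeads s) st fun st a => do
      tick 1
      forEach (T.edgesOf s) st fun st e => do
        tick 1
        match st.cost (a, e.1, e.2) with
        | none => addNew (Rule.term (a, e.1, e.2) s) 1 st
        | some _ => pure st

/-- The body of the main loop, for the annotated nonterminal `x = a[m, n]` taken from `new`: first
all rules `c → a b` with `b[n, o]` in `cost`, then all rules `c → b a` with `b[o, m]` in `cost`. -/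
def process (T : LookupTables G Γ) (x : Anno V Q) (st : Vars S pq) : Timed (Vars S pq) := do
  tick 1
  let st ← forEach (st.starting x.2.2) st fun st y => do
    tick 1
    forEach (T.binHeads x.1 y.1) st fun st c => produce (c, x.2.1, y.2.2) x y st
  forEach (st.ending x.2.1) st fun st y => do
    tick 1
    forEach (T.binHeads y.1 x.1) st fun st c => produce (c, y.2.1, x.2.2) y x st

/-- The main loop: while `new` is not empty, take an item of minimum priority and process it. -/
noncomputable def mainLoop (T : LookupTables G Γ) (st : Vars S pq) : Timed (Vars S pq) :=
  loop
    (fun st => do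
      tick 1
      let r : ULift.{max u v w} (Option (Anno V Q × pq.Heap)) ←
        andThen (pq.extractMin st.new) fun r => ret ⟨r⟩
      match r.down with
      | none => pure (Sum.inr st)
      | some (x, h) =>
        let st ← process T x { st with new := h }
        pure (Sum.inl st))
    st

/-- The whole algorithm, with the priority queue `pq`; it returns the list of all `rule[x]`. -/
noncomputable def run (pq : PriorityQueue (Anno V Q)) (T : LookupTables G Γ) :
    Timed (List (Rule (Anno V Q) S)) := do
  tick 1
  let st : Vars S pq ← initialization T
  let st ← mainLoop T st
  tick (1 + st.keys.length)
  pure (st.keys.filterMap st.rule)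

end MinimizingRules

/-! The algorithm is Knuth's generalization of Dijkstra's shortest-path algorithm, run on the
annotated grammar. Costs are positive and a binary rule adds them, so a proposed cost exceeds the
cost of each part of the body. Let `x` be an extracted item, of least priority `p₀`. Every cost
proposed from then on is at least `p₀` plus something positive, so the items already extracted keep
their costs for good. When the queue is empty, every item with a cost has been extracted, and every
annotated rule whose body has costs has been offered to `produce`. The final costs therefore satisfy
`cost d ≤ cost e + cost f` on all such rules, with equality on the stored ones.

The criterion `isMinimizing_of_cost` turns this into minimality. Induction on the cost builds, from
the stored rules, a string whose length is the cost; induction on parse trees of the whole grammar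
shows that no string is shorter. Costs drop strictly from head to body, so the stored rules are not
recursive, and one rule per head makes the string unique.

For the time, a new item gets the sum of two existing costs, so with `k` costed items all costs are
below `2 ^ k`. Costs thus have at most `|N_Γ|` bits, which is where the outer factor `|N_Γ|` comes
from. Each item is extracted once, and its calls of `produce` are charged to its occurrences in
annotated rules, at most `2 |P_Γ|` altogether. Fibonacci heaps are analysed with the potential
"roots plus twice the marked items"; degrees are logarithmic by a weight argument with Fibonacci
numbers (`FibHeap.Forest.fib_degree_le`).

A single analysis yields both halves of the proposition. `PriorityQueue.Amortized` guards all its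
time bounds by a proposition `timed`, which is `False` for an arbitrary correct queue and `True` for
Fibonacci heaps. -/

/-! ### Total correctness and running time of programs -/

namespace Timed

/-- Started at time `T`, the program `x` terminates, with a value and at a time that satisfy `Q`. -/
def Runs {α : Type u} (x : Timed α) (T : ℕ) (Q : α → ℕ → Prop) : Prop :=
  ∃ a t, x = some (a, t) ∧ Q a (T + t)

variable {α : Type u} {β : Type v} {σ : Type w}

theorem Runs.mono {x : Timed α} {T : ℕ} {Q Q' : α → ℕ → Prop} (h : Runs x T Q)
    (hQ : ∀ a T', Q a T' → Q' a T') : Runs x T Q' := by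
  obtain ⟨a, t, h1, h2⟩ := h
  exact ⟨a, t, h1, hQ _ _ h2⟩

theorem runs_ret {a : α} {T : ℕ} {Q : α → ℕ → Prop} : Runs (ret a) T Q ↔ Q a T := by
  constructor
  · rintro ⟨b, t, h, hQ⟩
    cases h
    exact hQ
  · intro h
    exact ⟨a, 0, rfl, h⟩

theorem runs_pure {a : α} {T : ℕ} {Q : α → ℕ → Prop} :
    Runs (pure a : Timed α) T Q ↔ Q a T := runs_ret

theorem runs_andThen {x : Timed α} {f : α → Timed β} {T : ℕ} {Q : β → ℕ → Prop} :
    Runs (andThen x f) T Q ↔ Runs x T fun a T' => Runs (f a) T' Q := by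
  constructor
  · rintro ⟨b, t, h, hQ⟩
    rcases x with _ | ⟨a, t1⟩
    · cases h
    · refine ⟨a, t1, rfl, ?_⟩
      simp only [andThen, Option.bind] at h
      rcases hf : f a with _ | ⟨b', t2⟩
      · rw [hf] at h; cases h
      · rw [hf] at h
        cases h
        exact ⟨b', t2, hf, by rwa [add_assoc]⟩
  · rintro ⟨a, t1, rfl, b, t2, h, hQ⟩
    refine ⟨b, t1 + t2, ?_, by rwa [← add_assoc]⟩
    simp only [andThen, Option.bind, h]
    rfl

theorem runs_bind {α β : Type u} {x : Timed α} {f : α → Timed β} {T : ℕ} {Q : β → ℕ → Prop} :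
    Runs (x >>= f) T Q ↔ Runs x T fun a T' => Runs (f a) T' Q := runs_andThen

theorem runs_tick {n T : ℕ} {Q : PUnit.{u + 1} → ℕ → Prop} :
    Runs (tick n) T Q ↔ Q PUnit.unit (T + n) := by
  constructor
  · rintro ⟨b, t, h, hQ⟩
    cases h
    exact hQ
  · intro h
    exact ⟨_, n, rfl, h⟩

theorem runs_less {p q T : ℕ} {Q : ULift.{u} Bool → ℕ → Prop} :
    Runs (less p q) T Q ↔ Q ⟨decide (p < q)⟩ (T + (1 + Nat.size p + Nat.size q)) := by
  unfold less
  rw [runs_bind, runs_tick, runs_pure]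

/-- The invariant is indexed by the part of the list still to be traversed, so it can carry both the
time already spent and the budget left for the rest. -/
theorem runs_forEach {I : List α → σ → ℕ → Prop} {f : σ → α → Timed σ}
    (step : ∀ x l s T, I (x :: l) s T → Runs (f s x) T (I l)) (l : List α) (s : σ) (T : ℕ)
    (h : I l s T) : Runs (forEach l s f) T (I []) := by
  induction l generalizing s T with
  | nil => exact runs_ret.2 h
  | cons x l ih =>
    exact runs_andThen.2 ((step x l s T h).mono fun s' T' h' => ih s' T' h')

/-- A run that has delivered its result never reaches the end of its fuel. Success has to be
assumed: `crash` also stands for exhausted fuel, which more fuel may cure. -/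
theorem iterate_succ_of_ne_crash {σ α : Type u} {f : σ → Timed (σ ⊕ α)} (n : ℕ) (s : σ)
    (h : iterate f n s ≠ crash) : iterate f (n + 1) s = iterate f n s := by
  induction n generalizing s with
  | zero => exact absurd rfl h
  | succ n ih =>
    unfold iterate at h ⊢
    rcases hf : f s with _ | ⟨r, t⟩
    · rfl
    · rw [hf] at h
      rcases r with s' | a
      · have : iterate f n s' ≠ crash := by
          intro hc
          apply h
          simp only [andThen, Option.bind, hc]
          rfl
        simp only [andThen, Option.bind, ih s' this]
        rfl
      · rfl

theorem iterate_eq_of_le {σ α : Type u} {f : σ → Timed (σ ⊕ α)} {m n : ℕ} (hmn : m ≤ n) {s : σ}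
    (h : iterate f m s ≠ crash) : iterate f n s = iterate f m s := by
  induction n, hmn using Nat.le_induction with
  | base => rfl
  | succ n _ ih => rw [iterate_succ_of_ne_crash n s (ih ▸ h), ih]

theorem loop_eq_iterate {σ α : Type u} {f : σ → Timed (σ ⊕ α)} {n : ℕ} {s : σ} (h : iterate f n s ≠ crash) :
    loop f s = iterate f n s := by
  classical
  have hex : ∃ n, iterate f n s ≠ crash := ⟨n, h⟩
  unfold loop
  rw [dif_pos hex]
  exact (iterate_eq_of_le (Nat.find_le h) (Nat.find_spec hex)).symm

/-- Total correctness of loops; the number in the invariant `I` bounds the number of iterations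
to come. -/
theorem runs_loop {σ α : Type u} {I : ℕ → σ → ℕ → Prop} {Q : α → ℕ → Prop} {f : σ → Timed (σ ⊕ α)}
    (step : ∀ n s T, I n s T → Runs (f s) T fun r T' =>
      Sum.elim (fun s' => ∃ n' < n, I n' s' T') (fun a => Q a T') r)
    (n : ℕ) (s : σ) (T : ℕ) (h : I n s T) : Runs (loop f s) T Q := by
  suffices H : ∃ N, Runs (iterate f N s) T Q by
    obtain ⟨N, hN⟩ := H
    have : iterate f N s ≠ crash := by
      obtain ⟨a, t, h1, -⟩ := hN
      rw [h1]
      exact Option.some_ne_none _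
    rwa [loop_eq_iterate this]
  induction n using Nat.strong_induction_on generalizing s T with
  | _ n ih =>
    obtain ⟨r, t, hr, hr'⟩ := step n s T h
    rcases r with s' | a
    · obtain ⟨n', hn', hI⟩ := hr'
      obtain ⟨N, hN⟩ := ih n' hn' s' _ hI
      exact ⟨N + 1, runs_andThen.2 ⟨_, t, hr, hN⟩⟩
    · exact ⟨1, runs_andThen.2 ⟨_, t, hr, runs_ret.2 hr'⟩⟩

end Timed

/-! ### Parse trees and the dynamic-programming criterion -/

section Languages

variable {V : Type u} {S : Type v}

/-- The nonterminal `a` has a parse tree with yield `x`. -/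
inductive Generates (P : Set (Rule V S)) : V → List S → Prop
  | term {a : V} {s : S} : Rule.term a s ∈ P → Generates P a [s]
  | bin {a b c : V} {x y : List S} : Rule.bin a b c ∈ P → Generates P b x → Generates P c y →
      Generates P a (x ++ y)

/-- The sentential form `w` has a parse forest with yield `x`. -/
inductive GeneratesForm (P : Set (Rule V S)) : List (Symbol S V) → List S → Prop
  | nil : GeneratesForm P [] []
  | terminal {s : S} {w x} : GeneratesForm P w x →
      GeneratesForm P (Symbol.terminal s :: w) (s :: x)
  | nonterminal {a : V} {w x y} : Generates P a x → GeneratesForm P w y →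
      GeneratesForm P (Symbol.nonterminal a :: w) (x ++ y)

variable {P : Set (Rule V S)}

theorem rewrites_iff {x y : List (Symbol S V)} : Rewrites P x y ↔
    ∃ r ∈ P, ∃ p q, x = p ++ [Symbol.nonterminal r.head] ++ q ∧ y = p ++ r.body ++ q := by
  simp only [Rewrites, ContextFreeRule.rewrites_iff, Rule.toContextFreeRule]

theorem Derives.append_left {x y : List (Symbol S V)} (z : List (Symbol S V))
    (h : Derives P x y) : Derives P (z ++ x) (z ++ y) := by
  refine Relation.ReflTransGen.lift (p := Rewrites P) (z ++ ·) ?_ _ _ h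
  rintro x y ⟨r, hr, h⟩
  exact ⟨r, hr, h.append_left z⟩

theorem Derives.append_right {x y : List (Symbol S V)} (z : List (Symbol S V))
    (h : Derives P x y) : Derives P (x ++ z) (y ++ z) := by
  refine Relation.ReflTransGen.lift (p := Rewrites P) (· ++ z) ?_ _ _ h
  rintro x y ⟨r, hr, h⟩
  exact ⟨r, hr, h.append_right z⟩

theorem rewrites_of_mem {r : Rule V S} (hr : r ∈ P) :
    Rewrites P [Symbol.nonterminal r.head] r.body :=
  rewrites_iff.2 ⟨r, hr, [], [], by simp⟩

theorem Generates.derives {a : V} {x : List S} (h : Generates P a x) :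
    Derives P [Symbol.nonterminal a] (x.map Symbol.terminal) := by
  induction h with
  | term h => exact Relation.ReflTransGen.single (rewrites_of_mem h)
  | @bin a b c x y h _ _ ih1 ih2 =>
    refine Relation.ReflTransGen.head (rewrites_of_mem h) ?_
    rw [List.map_append]
    exact (ih1.append_right [Symbol.nonterminal c]).trans (ih2.append_left _)

theorem GeneratesForm.append {w w' : List (Symbol S V)} {x y : List S}
    (h : GeneratesForm P w x) (h' : GeneratesForm P w' y) : GeneratesForm P (w ++ w') (x ++ y) := by
  induction h with
  | nil => exact h'
  | terminal _ ih => exact .terminal ih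
  | nonterminal ha _ ih =>
    rw [List.append_assoc]
    exact .nonterminal ha ih

theorem GeneratesForm.exists_of_append {w w' : List (Symbol S V)} {x : List S}
    (h : GeneratesForm P (w ++ w') x) :
    ∃ y z, x = y ++ z ∧ GeneratesForm P w y ∧ GeneratesForm P w' z := by
  induction w generalizing x with
  | nil => exact ⟨[], x, rfl, .nil, h⟩
  | cons s w ih =>
    cases h with
    | terminal h =>
      obtain ⟨y, z, rfl, h1, h2⟩ := ih h
      exact ⟨_, z, rfl, .terminal h1, h2⟩
    | nonterminal ha h =>
      obtain ⟨y, z, rfl, h1, h2⟩ := ih h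
      exact ⟨_, z, (List.append_assoc _ _ _).symm, .nonterminal ha h1, h2⟩

theorem generatesForm_singleton {a : V} {x : List S} :
    GeneratesForm P [Symbol.nonterminal a] x ↔ Generates P a x := by
  constructor
  · intro h
    cases h with
    | nonterminal ha h =>
      cases h
      simpa using ha
  · intro h
    simpa using GeneratesForm.nonterminal h .nil

theorem generates_of_body {r : Rule V S} (hr : r ∈ P) {x : List S}
    (h : GeneratesForm P r.body x) : Generates P r.head x := by
  cases r with
  | term a s =>
    cases h with
    | terminal h => cases h; exact .term hr
  | bin a b c =>
    cases h with
    | nonterminal hb h => exact .bin hr hb (generatesForm_singleton.1 h)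

theorem generatesForm_map_terminal (x : List S) :
    GeneratesForm P (x.map Symbol.terminal) x := by
  induction x with
  | nil => exact .nil
  | cons s x ih => exact .terminal ih

/-- Induction from the front of the derivation: the parse forest of the form after a step contains
one for the inserted body, and putting the applied rule on top of it gives a tree for the rewritten
nonterminal. -/
theorem Derives.generatesForm {w : List (Symbol S V)} {x : List S}
    (h : Derives P w (x.map Symbol.terminal)) : GeneratesForm P w x := by
  refine Relation.ReflTransGen.head_induction_on (motive := fun w _ => GeneratesForm P w x) h
    (generatesForm_map_terminal x) ?_
  intro w w' hw _ ih
  obtain ⟨r, hr, p, q, rfl, rfl⟩ := rewrites_iff.1 hw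
  obtain ⟨y, z, rfl, h1, h2⟩ := ih.exists_of_append
  obtain ⟨y, y', rfl, h1, h3⟩ := h1.exists_of_append
  exact (h1.append (generatesForm_singleton.2 (generates_of_body hr h3))).append h2

theorem mem_languageOf_iff {a : V} {x : List S} : x ∈ languageOf P a ↔ Generates P a x :=
  ⟨fun h => generatesForm_singleton.1 (Derives.generatesForm h), Generates.derives⟩

/-- The rule at each node of a parse tree is forced by its label, so the whole tree is. Trees are
finite, hence recursion need not be excluded here. -/
theorem Generates.eq_of_unique (hP : ∀ r ∈ P, ∀ r' ∈ P, r.head = r'.head → r = r') {a : V}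
    {x y : List S} (hx : Generates P a x) (hy : Generates P a y) : x = y := by
  induction hx generalizing y with
  | term h =>
    cases hy with
    | term h' => cases hP _ h _ h' rfl; rfl
    | bin h' _ _ => cases hP _ h _ h' rfl
  | bin h _ _ ih1 ih2 =>
    cases hy with
    | term h' => cases hP _ h _ h' rfl
    | bin h' h1 h2 => cases hP _ h _ h' rfl; rw [ih1 h1, ih2 h2]

/-- If a rank decreases from the head of every rule to the nonterminals of its body, then it
decreases along derivations. -/
theorem lt_of_mem_derivableNonterminals {f : V → ℕ}
    (hf : ∀ a b c, Rule.bin a b c ∈ P → f b < f a ∧ f c < f a) {a b : V}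
    (h : b ∈ derivableNonterminals P a) : f b < f a := by
  obtain ⟨x, y, h⟩ := h
  have step : ∀ r ∈ P, ∀ b, Symbol.nonterminal b ∈ r.body → f b < f r.head := by
    intro r hr b hb
    cases r with
    | term a s => simp [Rule.body] at hb
    | bin a c d =>
      simp only [Rule.body, List.mem_cons, Symbol.nonterminal.injEq, List.not_mem_nil,
        or_false] at hb
      rcases hb with rfl | rfl
      · exact (hf _ _ _ hr).1
      · exact (hf _ _ _ hr).2
  suffices H : ∀ w, DerivesPlus P [Symbol.nonterminal a] w →
      ∀ b, Symbol.nonterminal b ∈ w → f b < f a from H _ h b (by simp)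
  intro w hw
  induction hw with
  | single h =>
    intro b hb
    obtain ⟨r, hr, p, q, h1, rfl⟩ := rewrites_iff.1 h
    have h2 : p = [] ∧ q = [] ∧ a = r.head := by
      rcases p with _ | ⟨_, _⟩
      · simp at h1; simp [h1]
      · simp at h1
    obtain ⟨rfl, rfl, rfl⟩ := h2
    exact step r hr b (by simpa using hb)
  | tail _ h ih =>
    intro b hb
    obtain ⟨r, hr, p, q, rfl, rfl⟩ := rewrites_iff.1 h
    simp only [List.mem_append] at hb
    rcases hb with (hb | hb) | hb
    · exact ih b (by simp [hb])
    · exact (step r hr b hb).trans (ih _ (by simp))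
    · exact ih b (by simp [hb])

/-- Dynamic-programming criterion for minimizing sets of rules: a cost function that is bounded
on every rule of the grammar, and attained at the chosen rules. -/
theorem isMinimizing_of_cost {G : Grammar V S} {P' : Set (Rule V S)} (cost : V → ℕ)
    (subset : P' ⊆ (G.rules : Set (Rule V S)))
    (unique : ∀ r ∈ P', ∀ r' ∈ P', r.head = r'.head → r = r')
    (term_le : ∀ a s, Rule.term a s ∈ G.rules → a ∈ heads P' ∧ cost a ≤ 1)
    (bin_le : ∀ a b c, Rule.bin a b c ∈ G.rules → b ∈ heads P' → c ∈ heads P' →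
      a ∈ heads P' ∧ cost a ≤ cost b + cost c)
    (term_eq : ∀ a s, Rule.term a s ∈ P' → cost a = 1)
    (bin_eq : ∀ a b c, Rule.bin a b c ∈ P' →
      b ∈ heads P' ∧ c ∈ heads P' ∧ cost a = cost b + cost c)
    (pos : ∀ a ∈ heads P', 0 < cost a) : IsMinimizing G P' := by
  have lt : ∀ a b c, Rule.bin a b c ∈ P' → cost b < cost a ∧ cost c < cost a := by
    intro a b c h
    obtain ⟨hb, hc, h⟩ := bin_eq a b c h
    have := pos b hb
    have := pos c hc
    omega
  -- Existence of a string of length `cost a`: strong induction on the cost, which is strictly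
  -- smaller on the body of a chosen rule.
  have ex : ∀ a ∈ heads P', ∃ x, Generates P' a x ∧ x.length = cost a := by
    intro a
    induction h : cost a using Nat.strong_induction_on generalizing a with
    | _ n ih =>
      rintro ⟨r, hr, hra⟩
      cases r with
      | term b s =>
        cases hra
        exact ⟨[s], .term hr, by rw [← h]; exact (term_eq _ _ hr).symm⟩
      | bin b c d =>
        cases hra
        obtain ⟨hc, hd, he⟩ := bin_eq _ _ _ hr
        obtain ⟨h1, h2⟩ := lt _ _ _ hr
        simp only [Rule.head] at h
        obtain ⟨x, hx, hx'⟩ := ih (cost c) (by omega) c rfl hc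
        obtain ⟨y, hy, hy'⟩ := ih (cost d) (by omega) d rfl hd
        exact ⟨x ++ y, .bin hr hx hy, by rw [List.length_append]; omega⟩
  -- Optimality: induction on an arbitrary parse tree of `G`. That every generating nonterminal is a
  -- head of `P'` has to be proved along with the bound, because `bin_le` asks for it.
  have lower : ∀ a x, Generates (G.rules : Set (Rule V S)) a x →
      a ∈ heads P' ∧ cost a ≤ x.length := by
    intro a x h
    induction h with
    | term h => exact term_le _ _ h
    | bin h _ _ ih1 ih2 =>
      obtain ⟨h1, h2⟩ := bin_le _ _ _ h ih1.1 ih2.1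
      refine ⟨h1, ?_⟩
      rw [List.length_append]
      omega
  have mono : ∀ a x, Generates P' a x → Generates (G.rules : Set (Rule V S)) a x := by
    intro a x h
    induction h with
    | term h => exact .term (subset h)
    | bin h _ _ ih1 ih2 => exact .bin (subset h) ih1 ih2
  refine ⟨subset, ⟨?_, ?_, ?_⟩, ?_⟩
  · intro a _ h
    exact lt_irrefl _ (lt_of_mem_derivableNonterminals lt h)
  · rintro a ⟨r, hr, rfl⟩
    exact ⟨r, ⟨hr, rfl⟩, fun r' h => unique _ h.1 _ hr h.2⟩
  · intro a ha
    obtain ⟨x, hx, -⟩ := ex a ha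
    exact ⟨x, mem_languageOf_iff.2 hx⟩
  · rintro a - ⟨y, hy⟩
    obtain ⟨ha, -⟩ := lower a y (mem_languageOf_iff.1 hy)
    obtain ⟨x, hx, hxl⟩ := ex a ha
    refine ⟨x, ?_, ?_⟩
    · ext z
      rw [mem_languageOf_iff]
      exact ⟨fun h => h.eq_of_unique unique hx, by rintro rfl; exact hx⟩
    · refine le_antisymm (le_csInf ⟨_, y, hy, rfl⟩ ?_) (Nat.sInf_le ⟨x, ?_, rfl⟩)
      · rintro _ ⟨z, hz, rfl⟩
        rw [hxl]
        exact (lower a z (mem_languageOf_iff.1 hz)).2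
      · exact mem_languageOf_iff.2 (mono a x hx)

end Languages

/-! ### The annotated grammar -/

section Annotated

variable {V : Type u} {S : Type v} {Q : Type w} {G : Grammar V S} {Γ : LabeledGraph Q S}

theorem LabeledGraph.reach_append {m o n : Q} {x y : List S} (hx : o ∈ Γ.reach m x)
    (hy : n ∈ Γ.reach o y) : n ∈ Γ.reach m (x ++ y) := by
  induction x generalizing m with
  | nil =>
    obtain rfl : o = m := hx
    exact hy
  | cons s x ih =>
    simp only [List.cons_append, LabeledGraph.reach, Set.mem_iUnion] at hx ⊢
    obtain ⟨k, hk, hx⟩ := hx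
    exact ⟨k, hk, ih hx⟩

theorem mem_annoNonterminals {x : Anno V Q} : x ∈ annoNonterminals G Γ ↔
    x.1 ∈ G.nonterminals ∧ x.2.1 ∈ Γ.nodes ∧ x.2.2 ∈ Γ.nodes ∧
      ∃ y, Generates (G.rules : Set (Rule V S)) x.1 y ∧ x.2.2 ∈ Γ.reach x.2.1 y := by
  classical
  rw [annoNonterminals, Finset.mem_filter, Finset.mem_product, Finset.mem_product, and_assoc,
    and_assoc]
  simp only [Set.Nonempty, Set.mem_inter_iff, mem_languageOf_iff]
  rfl

theorem bin_mem_annoRules {x y z : Anno V Q} : Rule.bin x y z ∈ annoRules G Γ ↔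
    x ∈ annoNonterminals G Γ ∧ y ∈ annoNonterminals G Γ ∧ z ∈ annoNonterminals G Γ ∧
      x.2.1 = y.2.1 ∧ y.2.2 = z.2.1 ∧ z.2.2 = x.2.2 ∧ Rule.bin x.1 y.1 z.1 ∈ G.rules := by
  simp only [annoRules, Finset.mem_union, Finset.mem_image, Finset.mem_filter,
    Finset.mem_product, Prod.exists, Rule.bin.injEq, reduceCtorEq, and_false, exists_false,
    or_false]
  constructor
  · rintro ⟨a, m, n, b, o, p, c, q, r, h, rfl, rfl, rfl⟩
    tauto
  · intro h
    exact ⟨_, _, _, _, _, _, _, _, _, by tauto, rfl, rfl, rfl⟩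

theorem term_mem_annoRules {x : Anno V Q} {s : S} : Rule.term x s ∈ annoRules G Γ ↔
    Rule.term x.1 s ∈ G.rules ∧ (x.2.1, s, x.2.2) ∈ Γ.edges := by
  simp only [annoRules, Finset.mem_union, Finset.mem_image, Finset.mem_filter,
    Finset.mem_product, Prod.exists, Rule.term.injEq, reduceCtorEq, and_false, exists_false,
    false_or]
  constructor
  · rintro ⟨a, m, n, o, s, p, ⟨⟨h1, h2⟩, h3, h4, h5⟩, rfl, rfl⟩
    subst h3 h4
    exact ⟨h5, h2⟩
  · rintro ⟨h1, h2⟩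
    -- The head is automatically an annotated nonterminal: the one-letter string `[s]` is generated
    -- by the rule and traced by the edge.
    refine ⟨_, _, _, _, _, _, ⟨⟨mem_annoNonterminals.2 ?_, h2⟩, rfl, rfl, h1⟩, rfl, rfl⟩
    refine ⟨G.head_mem _ h1, Γ.source_mem _ h2, Γ.target_mem _ h2, [s], .term h1, ?_⟩
    simpa [LabeledGraph.reach] using h2

/-- The head need not be assumed annotated: concatenating the two strings that witness the body
gives a witness for it. Hence `produce` never leaves the annotated grammar. -/
theorem bin_mem_annoRules_of_mem {c : V} {x y : Anno V Q} (hx : x ∈ annoNonterminals G Γ)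
    (hy : y ∈ annoNonterminals G Γ) (hxy : x.2.2 = y.2.1) (hc : Rule.bin c x.1 y.1 ∈ G.rules) :
    Rule.bin (c, x.2.1, y.2.2) x y ∈ annoRules G Γ := by
  refine bin_mem_annoRules.2 ⟨?_, hx, hy, rfl, hxy, rfl, hc⟩
  obtain ⟨-, h1, -, x', hx1, hx2⟩ := mem_annoNonterminals.1 hx
  obtain ⟨-, -, h2, y', hy1, hy2⟩ := mem_annoNonterminals.1 hy
  exact mem_annoNonterminals.2
    ⟨G.head_mem _ hc, h1, h2, x' ++ y', .bin hc hx1 hy1, Γ.reach_append hx2 (hxy ▸ hy2)⟩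

end Annotated

namespace FibHeap

open Timed

variable {K : Type u} [DecidableEq K]

/-! ### The forest structure of Fibonacci heaps -/

/-- Every element of the list has an `f`-value of at least the number of the elements after it. -/
def Ranked (f : K → ℕ) : List K → Prop
  | [] => True
  | x :: l => l.length ≤ f x ∧ Ranked f l

omit [DecidableEq K] in
theorem Ranked.mono {f g : K → ℕ} {l l' : List K} (h : Ranked f l) (hl : l'.Sublist l)
    (hfg : ∀ x ∈ l', f x ≤ g x) : Ranked g l' := by
  induction hl with
  | slnil => trivial
  | cons _ _ ih => exact ih h.2 hfg
  | cons_cons x hl ih =>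
    refine ⟨(hl.length_le.trans h.1).trans (hfg x (by simp)), ih h.2 fun y hy => hfg y ?_⟩
    exact List.mem_cons_of_mem _ hy

omit [DecidableEq K] in
-- The list of children is ordered with the newest first. A child with `k` older siblings has
-- `f`-value at least `k`, hence degree at least `k - 1`, one child being possibly lost. So it
-- contributes at least `Nat.fib (k + 1)`, which is exactly the increment in the Fibonacci
-- recursion.
theorem Ranked.fib_le {f d : K → ℕ} {l : List K} (h : Ranked f l) (hfd : ∀ x, f x ≤ d x + 1) :
    Nat.fib (l.length + 2) ≤ 1 + (l.map fun x => Nat.fib (d x + 2)).sum := by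
  induction l with
  | nil => simp
  | cons x l ih =>
    have h1 := ih h.2
    have h2 : Nat.fib (l.length + 1) ≤ Nat.fib (d x + 2) :=
      Nat.fib_mono (by have := h.1; have := hfd x; omega)
    have h3 : Nat.fib (l.length + 1 + 2) = Nat.fib (l.length + 1) + Nat.fib (l.length + 2) :=
      Nat.fib_add_two
    simp only [List.length_cons, List.map_cons, List.sum_cons]
    omega

/-- The heap is a heap-ordered forest on the items in `A` with the degree conditions of Fibonacci
heaps, where the item `x` is allowed to have lost `e x` more children than its mark tells. -/
structure Forest (A : Finset K) (e : K → ℕ) (h : FibHeap K) : Prop where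
  parent_mem : ∀ x ∈ A, ∀ y, h.parent x = some y → y ∈ A
  prio_le : ∀ x ∈ A, ∀ y, h.parent x = some y → h.prio y ≤ h.prio x
  mem_children : ∀ x y, x ∈ h.children y ↔ x ∈ A ∧ h.parent x = some y
  nodup_children : ∀ y, (h.children y).Nodup
  acyclic : ∃ r : K → ℕ, ∀ x ∈ A, ∀ y, h.parent x = some y → r x < r y
  unmarked : ∀ x ∈ A, h.parent x = none → h.mark x = false
  ranked : ∀ y, Ranked (fun x => (h.children x).length + (h.mark x).toNat + e x) (h.children y)

variable {A : Finset K} {e : K → ℕ} {h : FibHeap K}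

omit [DecidableEq K] in
theorem Forest.congr {h' : FibHeap K} (hF : Forest A e h) (h1 : h'.prio = h.prio)
    (h2 : h'.parent = h.parent) (h3 : h'.children = h.children) (h4 : h'.mark = h.mark) :
    Forest A e h' := by
  obtain ⟨a1, a2, a3, a4⟩ := h
  obtain ⟨b1, b2, b3, b4⟩ := h'
  simp only at h1 h2 h3 h4
  subst h1 h2 h3 h4
  exact ⟨hF.1, hF.2, hF.3, hF.4, hF.5, hF.6, hF.7⟩

omit [DecidableEq K] in
theorem Forest.parent_ne {x y : K} (hF : Forest A e h) (hx : x ∈ A)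
    (hy : h.parent x = some y) : x ≠ y := by
  obtain ⟨r, hr⟩ := hF.acyclic
  rintro rfl
  exact lt_irrefl _ (hr x hx x hy)

omit [DecidableEq K] in
/-- Among the items of least priority there is a root. -/
theorem Forest.exists_root_le (hF : Forest A e h) {x : K} (hx : x ∈ A) :
    ∃ y ∈ A, h.parent y = none ∧ h.prio y ≤ h.prio x := by
  obtain ⟨r, hr⟩ := hF.acyclic
  -- Among the items of priority at most that of `x`, take one of greatest rank: a parent would
  -- belong to the same set and have a greater rank.
  obtain ⟨y, hy, hmax⟩ := Finset.exists_max_image (A.filter fun y => h.prio y ≤ h.prio x) r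
    ⟨x, by simp [hx]⟩
  rw [Finset.mem_filter] at hy
  refine ⟨y, hy.1, ?_, hy.2⟩
  rcases hp : h.parent y with _ | z
  · rfl
  · have h1 := hr y hy.1 z hp
    have h2 := hmax z (by
      rw [Finset.mem_filter]
      exact ⟨hF.parent_mem y hy.1 z hp, (hF.prio_le y hy.1 z hp).trans hy.2⟩)
    omega

/-- Sizes of subtrees are avoided. Give each item the weight `Nat.fib (degree + 2)`; it is at most
one plus the weights of the children. Summed over `A`, the weight of each item occurs on the right
at most once, at its parent, and that of the root `x` not at all. Cancelling leaves the weight of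
`x` bounded by `A.card`. -/
theorem Forest.fib_degree_le (hF : Forest A 0 h) {x : K} (hx : x ∈ A) (hr : h.parent x = none) :
    Nat.fib ((h.children x).length + 2) ≤ A.card := by
  set w : K → ℕ := fun x => Nat.fib ((h.children x).length + 2) with hw
  have h1 : ∀ y ∈ A, w y ≤ 1 + ∑ c ∈ A, if h.parent c = some y then w c else 0 := by
    intro y _
    have h2 := (hF.ranked y).fib_le (d := fun x => (h.children x).length) (by
      intro x
      have := Bool.toNat_le (h.mark x)
      simp only [Pi.zero_apply]
      omega)
    rw [← Finset.sum_filter]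
    have h3 : A.filter (fun c => h.parent c = some y) = (h.children y).toFinset := by
      ext c
      simp [hF.mem_children]
    rw [h3, List.sum_toFinset _ (hF.nodup_children y)]
    exact h2
  have h2 := Finset.sum_le_sum h1
  rw [Finset.sum_add_distrib, Finset.sum_comm] at h2
  have h3 : ∀ c ∈ A, (∑ y ∈ A, if h.parent c = some y then w c else 0) +
      (if c = x then w c else 0) ≤ w c := by
    intro c hc
    rcases hp : h.parent c with _ | y
    · simp only [reduceCtorEq, if_false, Finset.sum_const_zero, zero_add]
      split <;> simp
    · have : c ≠ x := by rintro rfl; rw [hr] at hp; cases hp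
      simp only [Option.some.injEq, if_neg this, add_zero, Finset.sum_ite_eq]
      split <;> simp
  have h4 := Finset.sum_le_sum h3
  rw [Finset.sum_add_distrib, Finset.sum_ite_eq' A x w, if_pos hx] at h4
  simp only [Finset.sum_const, smul_eq_mul, mul_one] at h2
  change w x ≤ _
  omega

/-- Fibonacci numbers at least double every two indices. This crude growth already makes the degrees
logarithmic. -/
theorem two_pow_le_fib (n : ℕ) : 2 ^ (n / 2) ≤ Nat.fib (n + 2) := by
  induction n using Nat.twoStepInduction with
  | zero => simp
  | one => simp [Nat.fib_add_two]
  | more n ih _ =>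
    have h1 : (n + 2) / 2 = n / 2 + 1 := by omega
    have h2 : Nat.fib (n + 2 + 2) = Nat.fib (n + 2) + Nat.fib (n + 2 + 1) := Nat.fib_add_two
    have h3 : Nat.fib (n + 2) ≤ Nat.fib (n + 2 + 1) := Nat.fib_le_fib_succ
    rw [h1, pow_succ]
    omega

theorem Forest.degree_le (hF : Forest A 0 h) {x : K} (hx : x ∈ A) (hr : h.parent x = none)
    {N : ℕ} (hN : A.card ≤ N) : (h.children x).length ≤ 2 * Nat.log 2 N + 1 := by
  have h1 := ((two_pow_le_fib _).trans (hF.fib_degree_le hx hr)).trans hN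
  have h2 : N ≠ 0 := by
    have := Finset.card_pos.2 ⟨x, hx⟩
    omega
  have := (Nat.le_log_iff_pow_le one_lt_two h2).2 h1
  omega

omit [DecidableEq K] in
theorem forest_empty : Forest (∅ : Finset K) 0 (empty : FibHeap K) := by
  constructor <;> simp [empty, Ranked]

theorem Forest.insert_root {x : K} (hF : Forest A 0 h) (hx : x ∉ A) (p : ℕ) (l : List K) :
    Forest (Insert.insert x A) 0
      { h with
        roots := l
        prio := Function.update h.prio x p
        parent := Function.update h.parent x none
        children := Function.update h.children x []
        mark := Function.update h.mark x false } := by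
  have hne : ∀ z ∈ A, z ≠ x := fun z hz => by rintro rfl; exact hx hz
  have hold : ∀ z ∈ Insert.insert x A, ∀ y, Function.update h.parent x none z = some y →
      z ∈ A ∧ z ≠ x ∧ y ≠ x ∧ y ∈ A ∧ h.parent z = some y := by
    intro z hz y hy
    rcases Finset.mem_insert.1 hz with rfl | hz
    · simp at hy
    · rw [Function.update_of_ne (hne z hz)] at hy
      have := hF.parent_mem z hz y hy
      exact ⟨hz, hne z hz, hne y this, this, hy⟩
  refine ⟨?_, ?_, ?_, ?_, ?_, ?_, ?_⟩
  · intro z hz y hy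
    exact Finset.mem_insert_of_mem (hold z hz y hy).2.2.2.1
  · intro z hz y hy
    obtain ⟨h1, h2, h3, -, h4⟩ := hold z hz y hy
    simp only [Function.update_of_ne h2, Function.update_of_ne h3]
    exact hF.prio_le z h1 y h4
  · intro z y
    constructor
    · intro hz
      rcases eq_or_ne y x with rfl | hy
      · simp at hz
      · simp only [Function.update_of_ne hy] at hz
        obtain ⟨h1, h2⟩ := (hF.mem_children z y).1 hz
        exact ⟨Finset.mem_insert_of_mem h1, by simpa only [Function.update_of_ne (hne z h1)]⟩
    · rintro ⟨hz, hy⟩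
      obtain ⟨h1, h2, h3, -, h4⟩ := hold z hz y hy
      simp only [Function.update_of_ne h3]
      exact (hF.mem_children z y).2 ⟨h1, h4⟩
  · intro y
    rcases eq_or_ne y x with rfl | hy
    · simp
    · simp only [Function.update_of_ne hy]
      exact hF.nodup_children y
  · obtain ⟨r, hr⟩ := hF.acyclic
    exact ⟨r, fun z hz y hy => hr z (hold z hz y hy).1 y (hold z hz y hy).2.2.2.2⟩
  · intro z hz hy
    rcases eq_or_ne z x with rfl | hzx
    · simp
    · simp only [Function.update_of_ne hzx] at hy ⊢
      exact hF.unmarked z (Finset.mem_of_mem_insert_of_ne hz hzx) hy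
  · intro y
    rcases eq_or_ne y x with rfl | hy
    · simp [Ranked]
    · simp only [Function.update_of_ne hy]
      refine (hF.ranked y).mono (List.Sublist.refl _) fun z hz => ?_
      have := hne z ((hF.mem_children z y).1 hz).1
      simp only [Function.update_of_ne this, le_refl]

theorem Forest.decrease {x : K} {p : ℕ} (hF : Forest A e h) (hp : p ≤ h.prio x)
    (hx : ∀ y, h.parent x = some y → h.prio y ≤ p) :
    Forest A e { h with prio := Function.update h.prio x p } := by
  refine ⟨hF.1, ?_, hF.3, hF.4, hF.5, hF.6, hF.7⟩
  intro z hz y hy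
  have hzy := hF.parent_ne hz hy
  have h1 := hF.prio_le z hz y hy
  simp only
  rcases eq_or_ne z x with rfl | hzx
  · rw [Function.update_self, Function.update_of_ne hzy.symm]
    exact hx y hy
  · rw [Function.update_of_ne hzx]
    rcases eq_or_ne y x with rfl | hyx
    · rw [Function.update_self]
      exact hp.trans h1
    · rwa [Function.update_of_ne hyx]

/-- The slack `e` moves up one level: the excess at `x` becomes irrelevant, as `x` is in no list of
children any more, while `y` has lost a child that its mark does not yet record. In this form the
lemma can be iterated along a cascading cut. -/
theorem Forest.cut {x y : K} (hF : Forest A e h) (he : ∀ z, z ≠ x → e z = 0) (hx : x ∈ A)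
    (hy : h.parent x = some y) : Forest A (Pi.single y 1) (cut x y h) := by
  have hold : ∀ z ∈ A, ∀ v, (FibHeap.cut x y h).parent z = some v → z ≠ x ∧ h.parent z = some v := by
    intro z hz v hv
    rcases eq_or_ne z x with rfl | hzx
    · simp [FibHeap.cut] at hv
    · exact ⟨hzx, by simpa only [FibHeap.cut, Function.update_of_ne hzx] using hv⟩
  have hsub : ∀ v, ((FibHeap.cut x y h).children v).Sublist (h.children v) := by
    intro v
    rcases eq_or_ne v y with rfl | hv
    · simp only [FibHeap.cut, Function.update_self]
      exact List.erase_sublist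
    · simp only [FibHeap.cut, Function.update_of_ne hv]
      exact List.Sublist.refl _
  have hmem : ∀ z v, z ∈ (FibHeap.cut x y h).children v ↔ z ≠ x ∧ z ∈ h.children v := by
    intro z v
    rcases eq_or_ne v y with rfl | hv
    · simp only [FibHeap.cut, Function.update_self]
      exact (hF.nodup_children v).mem_erase_iff
    · simp only [FibHeap.cut, Function.update_of_ne hv, iff_and_self]
      rintro hz rfl
      rw [((hF.mem_children z v).1 hz).2, Option.some_inj] at hy
      exact hv hy
  refine ⟨?_, ?_, ?_, ?_, ?_, ?_, ?_⟩
  · exact fun z hz v hv => hF.parent_mem z hz v (hold z hz v hv).2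
  · exact fun z hz v hv => hF.prio_le z hz v (hold z hz v hv).2
  · intro z v
    rw [hmem, hF.mem_children]
    constructor
    · rintro ⟨h1, h2, h3⟩
      exact ⟨h2, by simpa only [FibHeap.cut, Function.update_of_ne h1] using h3⟩
    · rintro ⟨h1, h2⟩
      exact ⟨(hold z h1 v h2).1, h1, (hold z h1 v h2).2⟩
  · exact fun v => (hF.nodup_children v).sublist (hsub v)
  · obtain ⟨r, hr⟩ := hF.acyclic
    exact ⟨r, fun z hz v hv => hr z hz v (hold z hz v hv).2⟩
  · intro z hz hv
    rcases eq_or_ne z x with rfl | hzx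
    · simp [FibHeap.cut]
    · simp only [FibHeap.cut, Function.update_of_ne hzx] at hv ⊢
      exact hF.unmarked z hz hv
  · intro v
    refine (hF.ranked v).mono (hsub v) fun z hz => ?_
    have hzx := ((hmem z v).1 hz).1
    rw [he z hzx]
    simp only [FibHeap.cut, Function.update_of_ne hzx]
    rcases eq_or_ne z y with rfl | hzy
    · rw [Function.update_self, Pi.single_eq_same, List.length_erase]
      split <;> omega
    · rw [Function.update_of_ne hzy]
      omega

/-- Equality of degrees keeps the lists ranked: `y` is put in front of as many siblings as it has
children. -/
theorem Forest.link {x y : K} (hF : Forest A 0 h) (hx : x ∈ A) (hy : y ∈ A) (hxy : x ≠ y)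
    (hpx : h.parent x = none) (hpy : h.parent y = none) (hp : h.prio x ≤ h.prio y)
    (hd : (h.children y).length = (h.children x).length) : Forest A 0 (link y x h) := by
  have hold : ∀ z ∈ A, ∀ v, (FibHeap.link y x h).parent z = some v →
      z = y ∧ v = x ∨ z ≠ y ∧ h.parent z = some v := by
    intro z hz v hv
    rcases eq_or_ne z y with rfl | hzy
    · simp only [FibHeap.link, Function.update_self, Option.some_inj] at hv
      exact .inl ⟨rfl, hv.symm⟩
    · exact .inr ⟨hzy, by simpa only [FibHeap.link, Function.update_of_ne hzy] using hv⟩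
  have hne : ∀ z v, z ∈ h.children v → z ≠ y := by
    rintro z v hz rfl
    rw [((hF.mem_children z v).1 hz).2] at hpy
    cases hpy
  have hyx : y ∉ h.children x := fun hc => hne y x hc rfl
  have hlen : ∀ z, (h.children z).length ≤ ((FibHeap.link y x h).children z).length := by
    intro z
    rcases eq_or_ne z x with rfl | hz
    · simp [FibHeap.link]
    · simp only [FibHeap.link, Function.update_of_ne hz, le_refl]
  refine ⟨?_, ?_, ?_, ?_, ?_, ?_, ?_⟩
  · intro z hz v hv
    rcases hold z hz v hv with ⟨rfl, rfl⟩ | ⟨-, h2⟩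
    · exact hx
    · exact hF.parent_mem z hz v h2
  · intro z hz v hv
    rcases hold z hz v hv with ⟨rfl, rfl⟩ | ⟨-, h2⟩
    · exact hp
    · exact hF.prio_le z hz v h2
  · intro z v
    constructor
    · intro hz
      have h1 : (z = y ∧ v = x) ∨ z ∈ h.children v := by
        rcases eq_or_ne v x with rfl | hv
        · simp only [FibHeap.link, Function.update_self, List.mem_cons] at hz
          exact hz.imp_left fun h => ⟨h, rfl⟩
        · simp only [FibHeap.link, Function.update_of_ne hv] at hz
          exact .inr hz
      rcases h1 with ⟨rfl, rfl⟩ | h1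
      · exact ⟨hy, by simp [FibHeap.link]⟩
      · obtain ⟨h2, h3⟩ := (hF.mem_children z v).1 h1
        exact ⟨h2, by simpa only [FibHeap.link, Function.update_of_ne (hne z v h1)] using h3⟩
    · rintro ⟨hz, hv⟩
      rcases hold z hz v hv with ⟨rfl, rfl⟩ | ⟨-, h2⟩
      · simp [FibHeap.link]
      · have h3 := (hF.mem_children z v).2 ⟨hz, h2⟩
        rcases eq_or_ne v x with rfl | hv
        · simp [FibHeap.link, h3]
        · simpa only [FibHeap.link, Function.update_of_ne hv] using h3
  · intro v
    rcases eq_or_ne v x with rfl | hv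
    · simp only [FibHeap.link, Function.update_self]
      exact List.nodup_cons.2 ⟨hyx, hF.nodup_children v⟩
    · simp only [FibHeap.link, Function.update_of_ne hv]
      exact hF.nodup_children v
  · obtain ⟨r, hr⟩ := hF.acyclic
    -- Raising the rank of `x` is harmless, since `x` is a root and only its children, old and new,
    -- have to stay below it.
    refine ⟨Function.update r x (r x + r y + 1), fun z hz v hv => ?_⟩
    rcases hold z hz v hv with ⟨rfl, rfl⟩ | ⟨-, h2⟩
    · rw [Function.update_self, Function.update_of_ne hxy.symm]
      omega
    · have h3 := hr z hz v h2
      have hzx : z ≠ x := by rintro rfl; rw [hpx] at h2; cases h2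
      rw [Function.update_of_ne hzx]
      rcases eq_or_ne v x with rfl | hv
      · rw [Function.update_self]; omega
      · rwa [Function.update_of_ne hv]
  · intro z hz hv
    rcases eq_or_ne z y with rfl | hzy
    · simp [FibHeap.link]
    · simp only [FibHeap.link, Function.update_of_ne hzy] at hv ⊢
      exact hF.unmarked z hz hv
  · intro v
    have h1 : Ranked (fun z => ((FibHeap.link y x h).children z).length +
        ((FibHeap.link y x h).mark z).toNat + (0 : K → ℕ) z) (h.children v) := by
      refine (hF.ranked v).mono (List.Sublist.refl _) fun z hz => ?_
      have h2 := hlen z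
      have h3 : (FibHeap.link y x h).mark z = h.mark z := by
        simp only [FibHeap.link, Function.update_of_ne (hne z v hz)]
      rw [h3]
      omega
    rcases eq_or_ne v x with rfl | hv
    · have h2 : (FibHeap.link y v h).children v = y :: h.children v := by simp [FibHeap.link]
      rw [h2]
      refine ⟨?_, h1⟩
      have := hlen y
      simp only
      omega
    · have h2 : (FibHeap.link y x h).children v = h.children v := by
        simp only [FibHeap.link, Function.update_of_ne hv]
      rwa [h2]

/-- The two conditionals describe the state after the loop of `extractMin` over the children of `z`.
Clearing the marks is needed because roots must be unmarked. -/
theorem Forest.remove_root {z : K} (hF : Forest A 0 h) (hz : h.parent z = none) (l : List K)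
    (m : Option K) :
    Forest (A.erase z) 0
      { roots := l
        minPtr := m
        prio := h.prio
        parent := fun x => if x ∈ h.children z then none else h.parent x
        children := Function.update h.children z []
        mark := fun x => if x ∈ h.children z then false else h.mark x } := by
  have hold : ∀ x ∈ A.erase z, ∀ y, (if x ∈ h.children z then none else h.parent x) = some y →
      x ∈ A ∧ x ∉ h.children z ∧ y ≠ z ∧ h.parent x = some y := by
    intro x hx y hy
    have hx' := Finset.mem_of_mem_erase hx
    split at hy
    · cases hy
    · rename_i h1
      refine ⟨hx', h1, ?_, hy⟩
      rintro rfl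
      exact h1 ((hF.mem_children x y).2 ⟨hx', hy⟩)
  refine ⟨?_, ?_, ?_, ?_, ?_, ?_, ?_⟩
  · intro x hx y hy
    obtain ⟨h1, h2, h3, h4⟩ := hold x hx y hy
    exact Finset.mem_erase.2 ⟨h3, hF.parent_mem x h1 y h4⟩
  · intro x hx y hy
    obtain ⟨h1, h2, h3, h4⟩ := hold x hx y hy
    exact hF.prio_le x h1 y h4
  · intro x y
    constructor
    · intro hx
      rcases eq_or_ne y z with rfl | hy
      · simp at hx
      · simp only [Function.update_of_ne hy] at hx
        obtain ⟨h1, h2⟩ := (hF.mem_children x y).1 hx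
        refine ⟨Finset.mem_erase.2 ⟨?_, h1⟩, ?_⟩
        · rintro rfl
          rw [hz] at h2
          cases h2
        · simp only [if_neg fun h3 => hy (Option.some_inj.1
            (h2.symm.trans ((hF.mem_children x z).1 h3).2)), h2]
    · rintro ⟨hx, hy⟩
      obtain ⟨h1, h2, h3, h4⟩ := hold x hx y hy
      simp only [Function.update_of_ne h3]
      exact (hF.mem_children x y).2 ⟨h1, h4⟩
  · intro y
    rcases eq_or_ne y z with rfl | hy
    · simp
    · simp only [Function.update_of_ne hy]
      exact hF.nodup_children y
  · obtain ⟨r, hr⟩ := hF.acyclic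
    refine ⟨r, fun x hx y hy => ?_⟩
    obtain ⟨h1, h2, h3, h4⟩ := hold x hx y hy
    exact hr x h1 y h4
  · intro x hx hy
    simp only at hy ⊢
    split_ifs with h1
    · rfl
    · rw [if_neg h1] at hy
      exact hF.unmarked x (Finset.mem_of_mem_erase hx) hy
  · intro y
    rcases eq_or_ne y z with rfl | hy
    · simp [Ranked]
    · simp only [Function.update_of_ne hy]
      refine (hF.ranked y).mono (List.Sublist.refl _) fun x hx => ?_
      have h2 := ((hF.mem_children x y).1 hx).2
      have h1 : x ∉ h.children z := fun h3 => hy (Option.some_inj.1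
            (h2.symm.trans ((hF.mem_children x z).1 h3).2))
      have h3 : x ≠ z := by
        rintro rfl
        rw [hz] at h2
        cases h2
      simp only [if_neg h1, Function.update_of_ne h3, le_refl]

end FibHeap

namespace FibHeap

open Timed

variable {K : Type u} [DecidableEq K]

/-! ### The operations of Fibonacci heaps -/

variable {A : Finset K} {W : ℕ} {h : FibHeap K}

/-- `minPtr` points to an element of `s` of least priority, if there is one. -/
def PointsToMin (h : FibHeap K) (s : Set K) : Prop :=
  (h.minPtr = none → s = ∅) ∧ ∀ y, h.minPtr = some y → y ∈ s ∧ ∀ z ∈ s, h.prio y ≤ h.prio z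

omit [DecidableEq K] in
-- The old pointer is only required to be right away from `x`, the one element whose presence or
-- priority has changed. This covers new roots, lowered roots and the rebuilding of the root list.
-- The time is one step plus a comparison of two numbers of at most `W` bits.
theorem updateMin_runs {x : K} {s : Set K} {T : ℕ} {Q : FibHeap K → ℕ → Prop} (hx : x ∈ s)
    (hnone : h.minPtr = none → s ⊆ {x})
    (hsome : ∀ y, h.minPtr = some y → y ∈ s ∧ ∀ z ∈ s, z ≠ x → h.prio y ≤ h.prio z)
    (hW : ∀ z ∈ s, Nat.size (h.prio z) ≤ W)
    (hQ : ∀ m T', PointsToMin { h with minPtr := m } s → T' ≤ T + 2 * W + 2 →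
      Q { h with minPtr := m } T') : Runs (updateMin x h) T Q := by
  unfold updateMin
  rw [runs_bind, runs_tick]
  rcases hm : h.minPtr with _ | y
  · simp only [runs_pure]
    refine hQ _ _ ⟨by simp, ?_⟩ (by omega)
    intro y hy
    simp only [Option.some_inj] at hy
    subst hy
    refine ⟨hx, fun z hz => ?_⟩
    obtain rfl : z = x := hnone hm hz
    exact le_rfl
  · obtain ⟨hy, hmin⟩ := hsome y hm
    have h1 := hW x hx
    have h2 := hW y hy
    simp only [runs_bind, runs_less, decide_eq_true_eq]
    by_cases hlt : h.prio x < h.prio y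
    · simp only [if_pos hlt, runs_pure]
      refine hQ _ _ ⟨by simp, ?_⟩ (by omega)
      intro v hv
      simp only [Option.some_inj] at hv
      subst hv
      refine ⟨hx, fun z hz => ?_⟩
      rcases eq_or_ne z x with rfl | hzx
      · exact le_rfl
      · exact hlt.le.trans (hmin z hz hzx)
    · simp only [if_neg hlt, runs_pure]
      have h3 : ({ h with minPtr := some y } : FibHeap K) = h := by rw [← hm]
      have h4 := hQ (some y)
      rw [h3] at h4
      refine h4 _ ⟨by simp [hm], ?_⟩ (by omega)
      intro v hv
      rw [hm, Option.some_inj] at hv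
      subst hv
      refine ⟨hy, fun z hz => ?_⟩
      rcases eq_or_ne z x with rfl | hzx
      · exact not_lt.1 hlt
      · exact hmin z hz hzx

/-- The heap represents its priorities on the set `A` of items, which have at most `W` bits. -/
structure Valid (A : Finset K) (W : ℕ) (h : FibHeap K) : Prop where
  forest : Forest A 0 h
  nodup_roots : h.roots.Nodup
  mem_roots : ∀ x, x ∈ h.roots ↔ x ∈ A ∧ h.parent x = none
  min : PointsToMin h {x | x ∈ h.roots}
  size_le : ∀ x ∈ A, Nat.size (h.prio x) ≤ W

/-- The number of marked items. -/
def marks (A : Finset K) (h : FibHeap K) : ℕ := (A.filter fun x => h.mark x = true).card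

/-- The potential of the amortized analysis. -/
def potential (A : Finset K) (h : FibHeap K) : ℕ := h.roots.length + 2 * marks A h

theorem insert_runs (hV : Valid A W h) {x : K} {p T : ℕ} (hx : x ∉ A) (hp : Nat.size p ≤ W) :
    Runs (insert x p h) T fun h' T' => Valid (Insert.insert x A) W h' ∧
      h'.prio = Function.update h.prio x p ∧
      potential (Insert.insert x A) h' = potential A h + 1 ∧ T' ≤ T + 3 * W + 3 := by
  unfold insert
  rw [runs_bind, runs_tick]
  have hne : ∀ z ∈ A, z ≠ x := fun z hz => by rintro rfl; exact hx hz
  have hxr : x ∉ h.roots := fun hc => hx ((hV.mem_roots x).1 hc).1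
  have hsize : ∀ z ∈ Insert.insert x A, Nat.size (Function.update h.prio x p z) ≤ W := by
    intro z hz
    rcases eq_or_ne z x with rfl | hzx
    · rwa [Function.update_self]
    · rw [Function.update_of_ne hzx]
      exact hV.size_le z (Finset.mem_of_mem_insert_of_ne hz hzx)
  have hroots : ∀ z, z ∈ x :: h.roots ↔
      z ∈ Insert.insert x A ∧ Function.update h.parent x none z = none := by
    intro z
    rcases eq_or_ne z x with rfl | hzx
    · simp
    · rw [Function.update_of_ne hzx, List.mem_cons, Finset.mem_insert, hV.mem_roots]
      tauto
  refine updateMin_runs (s := {z | z ∈ x :: h.roots}) (W := W) (by simp) ?_ ?_ ?_ ?_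
  · intro hm z hz
    have h1 := hV.min.1 hm
    rcases List.mem_cons.1 hz with rfl | hz
    · rfl
    · exact absurd (show z ∈ {x | x ∈ h.roots} from hz) (by simp [h1])
  · intro y hy
    obtain ⟨h1, h2⟩ := hV.min.2 y hy
    refine ⟨List.mem_cons_of_mem _ h1, fun z hz hzx => ?_⟩
    have h3 : y ≠ x := by rintro rfl; exact hxr h1
    simp only [Function.update_of_ne h3, Function.update_of_ne hzx]
    exact h2 z ((List.mem_cons.1 hz).resolve_left hzx)
  · exact fun z hz => hsize z ((hroots z).1 hz).1
  · intro m T' hm hT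
    refine ⟨⟨(hV.forest.insert_root hx p (x :: h.roots)).congr rfl rfl rfl rfl,
      List.nodup_cons.2 ⟨hxr, hV.nodup_roots⟩, hroots, hm, hsize⟩, rfl, ?_, by omega⟩
    have : (Insert.insert x A).filter (fun z => Function.update h.mark x false z = true) =
        A.filter fun z => h.mark z = true := by
      ext z
      rw [Finset.mem_filter, Finset.mem_filter]
      rcases eq_or_ne z x with rfl | hzx
      · simp [hx]
      · simp [hzx]
    simp only [potential, marks, List.length_cons, this]
    omega

theorem marks_cut {x y : K} : marks A (cut x y h) ≤ marks A h := by
  refine Finset.card_le_card fun z hz => ?_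
  rw [Finset.mem_filter] at hz ⊢
  refine ⟨hz.1, ?_⟩
  rcases eq_or_ne z x with rfl | hzx
  · simp [cut] at hz
  · simpa [cut, hzx] using hz.2

theorem marks_cut_of_mark {x y : K} (hx : x ∈ A) (hm : h.mark x = true) :
    marks A (cut x y h) + 1 = marks A h := by
  have h1 : A.filter (fun z => (cut x y h).mark z = true) =
      (A.filter fun z => h.mark z = true).erase x := by
    ext z
    rw [Finset.mem_filter, Finset.mem_erase, Finset.mem_filter]
    rcases eq_or_ne z x with rfl | hzx
    · simp [cut]
    · simp [cut, hzx]
  have h2 : x ∈ A.filter fun z => h.mark z = true := by simp [hx, hm]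
  have := Finset.card_erase_add_one h2
  simpa only [marks, h1] using this

theorem mem_roots_cut {x y : K} (hx : x ∈ A) (hy : h.parent x = some y)
    (hnd : h.roots.Nodup) (hr : ∀ z, z ∈ h.roots ↔ z ∈ A ∧ h.parent z = none) :
    (cut x y h).roots.Nodup ∧
      ∀ z, z ∈ (cut x y h).roots ↔ z ∈ A ∧ (cut x y h).parent z = none := by
  constructor
  · refine List.nodup_cons.2 ⟨fun hc => ?_, hnd⟩
    rw [((hr x).1 hc).2] at hy
    cases hy
  · intro z
    simp only [cut, List.mem_cons]
    rcases eq_or_ne z x with rfl | hzx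
    · simp [hx]
    · rw [Function.update_of_ne hzx, hr]
      tauto

/-- A round that continues turns a marked item into an unmarked root. The potential rises by one and
falls by two, and this pays for the round; the marks, decreasing in number, also bound the
iterations. The last round may set a mark, which costs two units. It also removes the slack at `y`:
a root is in no list of children, and an unmarked item has the slack absorbed by its new mark. -/
theorem cascadingCut_runs {y : K} {T u : ℕ} (hu : 1 ≤ u) (hF : Forest A (Pi.single y 1) h)
    (hy : y ∈ A) (hnd : h.roots.Nodup) (hr : ∀ z, z ∈ h.roots ↔ z ∈ A ∧ h.parent z = none) :
    Runs (cascadingCut y h) T fun h' T' => Forest A 0 h' ∧ h'.roots.Nodup ∧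
      (∀ z, z ∈ h'.roots ↔ z ∈ A ∧ h'.parent z = none) ∧ h'.prio = h.prio ∧
      h'.minPtr = h.minPtr ∧ (∀ z, h.parent z = none → h'.parent z = none) ∧
      T' + u * potential A h' ≤ T + u * potential A h + 1 + 2 * u := by
  unfold cascadingCut
  refine runs_loop (I := fun n s T' => s.1 ∈ A ∧ Forest A (Pi.single s.1 1) s.2 ∧ s.2.roots.Nodup ∧
    (∀ z, z ∈ s.2.roots ↔ z ∈ A ∧ s.2.parent z = none) ∧ s.2.prio = h.prio ∧
    s.2.minPtr = h.minPtr ∧ (∀ z, h.parent z = none → s.2.parent z = none) ∧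
    T' + u * potential A s.2 ≤ T + u * potential A h ∧ n = marks A s.2) ?_ (marks A h) (y, h) T
    ⟨hy, hF, hnd, hr, rfl, rfl, fun _ h => h, le_rfl, rfl⟩
  rintro n ⟨y, g⟩ T' ⟨hy, hF, hnd, hr, hprio, hmin, hpar, hT, rfl⟩
  simp only at hy hF hnd hr hprio hmin hpar hT
  rw [runs_bind, runs_tick]
  rcases hp : g.parent y with _ | z
  · simp only [runs_pure, Sum.elim_inr]
    refine ⟨?_, hnd, hr, hprio, hmin, hpar, by omega⟩
    refine ⟨hF.1, hF.2, hF.3, hF.4, hF.5, hF.6, fun v => ?_⟩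
    refine (hF.ranked v).mono (List.Sublist.refl _) fun x hx => ?_
    have : x ≠ y := by
      rintro rfl
      rw [((hF.mem_children x v).1 hx).2] at hp
      cases hp
    simp [this]
  · simp only
    by_cases hm : g.mark y = true
    · simp only [if_pos hm, runs_pure, Sum.elim_inl]
      have h1 := marks_cut_of_mark (y := z) hy hm
      obtain ⟨h2, h3⟩ := mem_roots_cut hy hp hnd hr
      refine ⟨_, ?_, hF.parent_mem y hy z hp, ?_, h2, h3, hprio, hmin, ?_, ?_, rfl⟩
      · omega
      · exact hF.cut (fun v hv => Pi.single_eq_of_ne hv 1) hy hp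
      · intro v hv
        rcases eq_or_ne v y with rfl | hvy
        · simp [cut]
        · simpa only [cut, Function.update_of_ne hvy] using hpar v hv
      -- One root more and one mark less: the potential drops by one, and `u ≥ 1` pays the step.
      · have h4 : potential A (cut y z g) + 1 = potential A g := by
          have : (cut y z g).roots.length = g.roots.length + 1 := rfl
          simp only [potential]
          omega
        rw [← h4, mul_add] at hT
        omega
    · simp only [if_neg hm, runs_pure, Sum.elim_inr]
      refine ⟨⟨hF.1, hF.2, hF.3, hF.4, hF.5, ?_, fun v => ?_⟩, hnd, hr, hprio, hmin, hpar, ?_⟩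
      · intro x hx hxp
        have : x ≠ y := by
          rintro rfl
          simp only [hp] at hxp
          cases hxp
        simp only [Function.update_of_ne this]
        exact hF.unmarked x hx hxp
      · refine (hF.ranked v).mono (List.Sublist.refl _) fun x hx => ?_
        rcases eq_or_ne x y with rfl | hxy
        · simp [hm]
        · simp [hxy]
      · have h1 : marks A { g with mark := Function.update g.mark y true } ≤ marks A g + 1 := by
          refine (Finset.card_le_card (t := Insert.insert y
            (A.filter fun z => g.mark z = true)) fun v hv => ?_).trans (Finset.card_insert_le _ _)
          rw [Finset.mem_filter] at hv
          rw [Finset.mem_insert, Finset.mem_filter]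
          rcases eq_or_ne v y with rfl | hvy
          · exact .inl rfl
          · exact .inr ⟨hv.1, by simpa only [Function.update_of_ne hvy] using hv.2⟩
        have h2 : potential A { g with mark := Function.update g.mark y true } ≤
            potential A g + 2 := by
          simp only [potential]
          omega
        have := Nat.mul_le_mul_left u h2
        rw [mul_add] at this
        omega

theorem decreaseKey_runs (hV : Valid A W h) {x : K} {p T u : ℕ} (hx : x ∈ A) (hp : p ≤ h.prio x)
    (hu : 2 * W + 2 ≤ u) :
    Runs (decreaseKey x p h) T fun h' T' => Valid A W h' ∧
      h'.prio = Function.update h.prio x p ∧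
      T' + 2 * u * potential A h' ≤ T + 2 * u * potential A h + 12 * u := by
  have hpW : Nat.size p ≤ W := (Nat.size_le_size hp).trans (hV.size_le x hx)
  have hsize : ∀ z ∈ A, Nat.size (Function.update h.prio x p z) ≤ W := by
    intro z hz
    rcases eq_or_ne z x with rfl | hzx
    · rwa [Function.update_self]
    · rw [Function.update_of_ne hzx]
      exact hV.size_le z hz
  have hmin : ∀ y, h.minPtr = some y → y ∈ h.roots ∧ ∀ z ∈ A, h.prio y ≤ h.prio z := by
    intro y hy
    obtain ⟨h1, h2⟩ := hV.min.2 y hy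
    refine ⟨h1, fun z hz => ?_⟩
    obtain ⟨v, hv, hvp, hvz⟩ := hV.forest.exists_root_le hz
    exact (h2 v ((hV.mem_roots v).2 ⟨hv, hvp⟩)).trans hvz
  have hminPtr : ∀ y, h.minPtr = some y → y ∈ h.roots ∧ ∀ z ∈ A, z ≠ x →
      Function.update h.prio x p y ≤ Function.update h.prio x p z := by
    intro y hy
    obtain ⟨h1, h2⟩ := hmin y hy
    refine ⟨h1, fun z hz hzx => ?_⟩
    rw [Function.update_of_ne hzx]
    rcases eq_or_ne y x with rfl | hyx
    · rw [Function.update_self]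
      exact hp.trans (h2 z hz)
    · rw [Function.update_of_ne hyx]
      exact h2 z hz
  have hnone : h.minPtr ≠ none := by
    intro hm
    have h1 := hV.min.1 hm
    obtain ⟨v, hv, hvp, -⟩ := hV.forest.exists_root_le hx
    exact absurd (show v ∈ {x | x ∈ h.roots} from (hV.mem_roots v).2 ⟨hv, hvp⟩) (by simp [h1])
  have hF : (∀ y, h.parent x = some y → h.prio y ≤ p) →
      Forest A 0 { h with prio := Function.update h.prio x p } := hV.forest.decrease hp
  unfold decreaseKey
  rw [runs_bind, runs_tick]
  dsimp only
  rcases hpar : h.parent x with _ | y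
  · simp only
    have hF := hF (by simp [hpar])
    have hxr : x ∈ h.roots := (hV.mem_roots x).2 ⟨hx, hpar⟩
    refine updateMin_runs (s := {z | z ∈ h.roots}) (W := W) hxr (fun hc => absurd hc hnone) ?_
      (fun z hz => hsize z ((hV.mem_roots z).1 hz).1) ?_
    · intro y hy
      obtain ⟨h1, h2⟩ := hminPtr y hy
      exact ⟨h1, fun z hz => h2 z ((hV.mem_roots z).1 hz).1⟩
    · intro m T' hm hT
      refine ⟨⟨hF.congr rfl rfl rfl rfl, hV.nodup_roots, hV.mem_roots, hm, hsize⟩, rfl, ?_⟩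
      have : potential A ⟨h.roots, m, Function.update h.prio x p, h.parent, h.children, h.mark⟩ =
        potential A h := rfl
      rw [this]
      omega
  · have hyA := hV.forest.parent_mem x hx y hpar
    have hyx := (hV.forest.parent_ne hx hpar).symm
    have hyW := hV.size_le y hyA
    simp only [runs_bind, runs_less, decide_eq_true_eq, Function.update_of_ne hyx]
    by_cases hlt : p < h.prio y
    · simp only [if_pos hlt, runs_bind]
      have hcut : Forest A (Pi.single y 1) (cut x y h) := hV.forest.cut (fun _ _ => rfl) hx hpar
      obtain ⟨hnd, hr⟩ := mem_roots_cut hx hpar hV.nodup_roots hV.mem_roots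
      -- The priority is lowered after the cut, when `x` is a root, so the heap order cannot be
      -- violated; the two updates commute.
      have hcut' : Forest A (Pi.single y 1)
          (cut x y { h with prio := Function.update h.prio x p }) :=
        (hcut.decrease (x := x) (p := p) hp (by simp [cut])).congr rfl rfl rfl rfl
      refine (cascadingCut_runs (u := 2 * u) (by omega) hcut' hyA hnd hr).mono ?_
      rintro g T' ⟨hgF, hgnd, hgr, hgprio, hgmin, hgpar, hgT⟩
      have hgprio : g.prio = Function.update h.prio x p := hgprio
      have hgmin : g.minPtr = h.minPtr := hgmin
      have hxr : x ∈ g.roots := (hgr x).2 ⟨hx, hgpar x (by simp [cut])⟩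
      refine updateMin_runs (s := {z | z ∈ g.roots}) (W := W) hxr
        (fun hc => absurd (hgmin.symm.trans hc) hnone) ?_
        (fun z hz => by rw [hgprio]; exact hsize z ((hgr z).1 hz).1) ?_
      · intro z hz
        obtain ⟨h1, h2⟩ := hminPtr z (hgmin.symm.trans hz)
        obtain ⟨h3, h4⟩ := (hV.mem_roots z).1 h1
        rw [hgprio]
        refine ⟨(hgr z).2 ⟨h3, hgpar z ?_⟩, fun v hv => h2 v ((hgr v).1 hv).1⟩
        simp only [cut]
        rcases eq_or_ne z x with rfl | hzx
        · simp
        · rwa [Function.update_of_ne hzx]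
      · intro m T'' hm hT
        refine ⟨⟨hgF.congr rfl rfl rfl rfl, hgnd, hgr, hm, ?_⟩, hgprio, ?_⟩
        · intro z hz
          simp only [hgprio]
          exact hsize z hz
        · have h1 : potential A ⟨g.roots, m, g.prio, g.parent, g.children, g.mark⟩ =
            potential A g := rfl
          have h2 : potential A (cut x y { h with prio := Function.update h.prio x p }) ≤
              potential A h + 1 := by
            have h3 : marks A (cut x y { h with prio := Function.update h.prio x p }) ≤ marks A h :=
              marks_cut (h := { h with prio := Function.update h.prio x p })
            have h4 : (cut x y { h with prio := Function.update h.prio x p }).roots.length =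
              h.roots.length + 1 := rfl
            simp only [potential]
            omega
          rw [h1]
          have h3 := Nat.mul_le_mul_left (2 * u) h2
          rw [mul_add] at h3
          omega
    · simp only [if_neg hlt]
      have hF := hF (fun z hz => by
        rw [hpar, Option.some_inj] at hz
        subst hz
        exact not_lt.1 hlt)
      rcases hm : h.minPtr with _ | z
      · exact absurd hm hnone
      · obtain ⟨h1, h2⟩ := hmin z hm
        have hzA := ((hV.mem_roots z).1 h1).1
        have hzx : z ≠ x := by
          rintro rfl
          rw [((hV.mem_roots z).1 h1).2] at hpar
          cases hpar
        -- Here `updateMin` is called on `x` although `x` is not a root, so `updateMin_runs` does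
        -- not apply. The call changes nothing: the minimum is at most the priority of the parent
        -- `y`, which is at most `p`.
        have h3 : ¬ p < h.prio z := not_lt.2 ((h2 y hyA).trans (not_lt.1 hlt))
        have h4 := hV.size_le z hzA
        unfold updateMin
        simp only [runs_bind, runs_tick, runs_less, Function.update_self,
          Function.update_of_ne hzx, decide_eq_true_eq, if_neg h3, runs_pure]
        refine ⟨⟨hF.congr rfl rfl rfl rfl, hV.nodup_roots, hV.mem_roots, ⟨by simp, ?_⟩, hsize⟩,
          trivial, ?_⟩
        · intro v hv
          obtain ⟨h5, h6⟩ := hminPtr v (hm.trans hv)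
          refine ⟨h5, fun w hw => ?_⟩
          have hw' := (hV.mem_roots w).1 hw
          refine h6 w hw'.1 ?_
          rintro rfl
          rw [hw'.2] at hpar
          cases hpar
        · have : potential A ⟨h.roots, some z, Function.update h.prio x p, h.parent, h.children,
            h.mark⟩ = potential A h := rfl
          rw [this]
          omega

end FibHeap

/-! ### Consolidation and extraction of the minimum -/

namespace FibHeap

open Timed

variable {K : Type u} [DecidableEq K]

variable {A : Finset K} {W : ℕ} {h : FibHeap K}

/-- The state of `consolidate` when the roots in `l` are still to be placed. -/
structure Consolidating (A : Finset K) (prio : K → ℕ) (M D : ℕ) (l : List K) (s : Slots K) :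
    Prop where
  forest : Forest A 0 s.heap
  prio_eq : s.heap.prio = prio
  slot_eq : ∀ d x, s.slot d = some x → x ∈ A ∧ s.heap.parent x = none ∧
    (s.heap.children x).length = d ∧ d ≤ s.maxDeg ∧ x ∉ l
  mem_or_slot : ∀ x ∈ A, s.heap.parent x = none → x ∈ l ∨ ∃ d, s.slot d = some x
  nodup : l.Nodup
  root : ∀ x ∈ l, x ∈ A ∧ s.heap.parent x = none
  marks_le : marks A s.heap ≤ M
  maxDeg_le : s.maxDeg ≤ D

/-- The number of roots. -/
def rootCount (A : Finset K) (h : FibHeap K) : ℕ := (A.filter fun x => h.parent x = none).card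

theorem rootCount_link {x y : K} (hy : y ∈ A) (hpy : h.parent y = none) :
    rootCount A (link y x h) + 1 = rootCount A h := by
  have h1 : A.filter (fun z => (link y x h).parent z = none) =
      (A.filter fun z => h.parent z = none).erase y := by
    ext z
    rw [Finset.mem_filter, Finset.mem_erase, Finset.mem_filter]
    rcases eq_or_ne z y with rfl | hzx
    · simp [link]
    · simp [link, hzx]
  have h2 : y ∈ A.filter fun z => h.parent z = none := by simp [hy, hpy]
  have := Finset.card_erase_add_one h2
  simpa only [rootCount, h1] using this

theorem marks_link {x y : K} : marks A (link y x h) ≤ marks A h := by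
  refine Finset.card_le_card fun z hz => ?_
  rw [Finset.mem_filter] at hz ⊢
  refine ⟨hz.1, ?_⟩
  rcases eq_or_ne z y with rfl | hzx
  · simp [link] at hz
  · simpa [link, hzx] using hz.2

/-- Here `a` is the root that survives and `b` the one that becomes its child. The survivor returns
to the list of roots to be placed, since its degree has grown, and the slot is freed. Both outcomes
of the comparison are covered at once. -/
theorem Consolidating.link {prio : K → ℕ} {M D : ℕ} {l : List K} {s : Slots K} {x y a b : K}
    (hs : Consolidating A prio M D (x :: l) s)
    (hy : s.slot (s.heap.children x).length = some y) (hab : a = x ∧ b = y ∨ a = y ∧ b = x)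
    (hp : s.heap.prio a ≤ s.heap.prio b) :
    Consolidating A prio M D (a :: l)
        { heap := link b a s.heap
          slot := Function.update s.slot (s.heap.children x).length none
          maxDeg := s.maxDeg } ∧
      rootCount A (FibHeap.link b a s.heap) + 1 = rootCount A s.heap := by
  obtain ⟨hxA, hxp⟩ := hs.root x (by simp)
  obtain ⟨hyA, hyp, hyd, hym, hyl⟩ := hs.slot_eq _ _ hy
  have hyx : y ≠ x := fun hc => hyl (by simp [hc])
  have hyl' : y ∉ l := fun hc => hyl (List.mem_cons_of_mem _ hc)
  have hxl := (List.nodup_cons.1 hs.nodup).1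
  have ha : a ∈ A ∧ s.heap.parent a = none ∧ a ∉ l := by
    rcases hab with ⟨rfl, rfl⟩ | ⟨rfl, rfl⟩
    · exact ⟨hxA, hxp, hxl⟩
    · exact ⟨hyA, hyp, hyl'⟩
  have hb : b ∈ A ∧ s.heap.parent b = none ∧ b ∉ l := by
    rcases hab with ⟨rfl, rfl⟩ | ⟨rfl, rfl⟩
    · exact ⟨hyA, hyp, hyl'⟩
    · exact ⟨hxA, hxp, hxl⟩
  have hne : a ≠ b := by
    rcases hab with ⟨rfl, rfl⟩ | ⟨rfl, rfl⟩
    · exact hyx.symm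
    · exact hyx
  have hdeg : (s.heap.children b).length = (s.heap.children a).length := by
    rcases hab with ⟨rfl, rfl⟩ | ⟨rfl, rfl⟩
    · exact hyd
    · exact hyd.symm
  have hor : ∀ z, z = x ∨ z = y ↔ z = a ∨ z = b := by
    intro z
    rcases hab with ⟨rfl, rfl⟩ | ⟨rfl, rfl⟩
    · rfl
    · exact or_comm
  have hpar : ∀ z, z ≠ b → (FibHeap.link b a s.heap).parent z = s.heap.parent z := by
    intro z hz
    simp only [FibHeap.link, Function.update_of_ne hz]
  refine ⟨⟨?_, ?_, ?_, ?_, ?_, ?_, ?_, ?_⟩, rootCount_link hb.1 hb.2.1⟩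
  · exact hs.forest.link ha.1 hb.1 hne ha.2.1 hb.2.1 hp hdeg
  · exact hs.prio_eq
  · intro d z hz
    have hd : d ≠ (s.heap.children x).length := by
      rintro rfl
      simp at hz
    simp only [Function.update_of_ne hd] at hz
    obtain ⟨h1, h2, h3, h4, h5⟩ := hs.slot_eq d z hz
    have hzy : z ≠ y := by
      rintro rfl
      exact hd (h3.symm.trans hyd)
    have hzx : z ≠ x := fun hc => h5 (by simp [hc])
    have hzab : ¬(z = a ∨ z = b) := by
      rw [← hor]
      tauto
    rw [not_or] at hzab
    refine ⟨h1, ?_, ?_, h4, ?_⟩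
    · exact (hpar z hzab.2).trans h2
    · simpa only [FibHeap.link, Function.update_of_ne hzab.1] using h3
    · simp only [List.mem_cons, not_or]
      exact ⟨hzab.1, fun hc => h5 (List.mem_cons_of_mem _ hc)⟩
  · intro z hz hzp
    have hzb : z ≠ b := by
      rintro rfl
      simp [FibHeap.link] at hzp
    rcases hs.mem_or_slot z hz ((hpar z hzb).symm.trans hzp) with h1 | ⟨d, h1⟩
    · rcases List.mem_cons.1 h1 with h1 | h1
      · exact .inl (by simp [((hor z).1 (.inl h1)).resolve_right hzb])
      · exact .inl (List.mem_cons_of_mem _ h1)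
    · by_cases hd : d = (s.heap.children x).length
      · rw [hd, hy, Option.some_inj] at h1
        exact .inl (by simp [((hor z).1 (.inr h1.symm)).resolve_right hzb])
      · exact .inr ⟨d, by simpa only [Function.update_of_ne hd] using h1⟩
  · exact List.nodup_cons.2 ⟨ha.2.2, (List.nodup_cons.1 hs.nodup).2⟩
  · intro z hz
    rcases List.mem_cons.1 hz with rfl | hz
    · exact ⟨ha.1, (hpar _ hne).trans ha.2.1⟩
    · have hzb : z ≠ b := by
        rintro rfl
        exact hb.2.2 hz
      obtain ⟨h1, h2⟩ := hs.root z (List.mem_cons_of_mem _ hz)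
      exact ⟨h1, (hpar z hzb).trans h2⟩
  · exact marks_link.trans hs.marks_le
  · exact hs.maxDeg_le

/-- Every link removes a root, so `rootCount` bounds the iterations and, weighted by `u`, pays for
them: a round costs at most `2 * W + 2`. Only the final round, which fills a free slot, is charged
separately. -/
theorem place_runs {M D T B u : ℕ} {prio : K → ℕ} {l : List K} {s : Slots K} {x : K}
    (hs : Consolidating A prio M D (x :: l) s) (hW : ∀ x ∈ A, Nat.size (prio x) ≤ W)
    (hD : ∀ g : FibHeap K, Forest A 0 g → ∀ x ∈ A, g.parent x = none → (g.children x).length ≤ D)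
    (hu : 2 * W + 2 ≤ u) (hT : T + u * rootCount A s.heap ≤ B) :
    Runs (place s x) T fun s' T' => Consolidating A prio M D l s' ∧
      T' + u * rootCount A s'.heap ≤ B + u := by
  unfold place
  refine runs_loop (I := fun n p T' => Consolidating A prio M D (p.1 :: l) p.2 ∧
    n = rootCount A p.2.heap ∧ T' + u * rootCount A p.2.heap ≤ B) ?_ _ (x, s) T ⟨hs, rfl, hT⟩
  rintro n ⟨x, s⟩ T' ⟨hs, rfl, hT⟩
  simp only at hs hT
  rw [runs_bind, runs_tick]
  dsimp only
  obtain ⟨hxA, hxp⟩ := hs.root x (by simp)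
  rcases hy : s.slot (s.heap.children x).length with _ | y
  · simp only [runs_pure, Sum.elim_inr]
    refine ⟨⟨hs.forest, hs.prio_eq, ?_, ?_, (List.nodup_cons.1 hs.nodup).2,
      fun z hz => hs.root z (List.mem_cons_of_mem _ hz), hs.marks_le,
      max_le hs.maxDeg_le (hD _ hs.forest x hxA hxp)⟩, by omega⟩
    · intro d z hz
      by_cases hd : d = (s.heap.children x).length
      · simp only [hd, Function.update_self, Option.some_inj] at hz
        subst hz
        exact ⟨hxA, hxp, hd.symm, by rw [hd]; exact le_max_right _ _,
          (List.nodup_cons.1 hs.nodup).1⟩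
      · simp only [Function.update_of_ne hd] at hz
        obtain ⟨h1, h2, h3, h4, h5⟩ := hs.slot_eq d z hz
        exact ⟨h1, h2, h3, h4.trans (le_max_left _ _), fun hc => h5 (List.mem_cons_of_mem _ hc)⟩
    · intro z hz hzp
      rcases hs.mem_or_slot z hz hzp with h1 | ⟨d, h1⟩
      · rcases List.mem_cons.1 h1 with rfl | h1
        · exact .inr ⟨_, Function.update_self _ _ _⟩
        · exact .inl h1
      · by_cases hd : d = (s.heap.children x).length
        · rw [hd, hy] at h1
          cases h1
        · exact .inr ⟨d, by simpa only [Function.update_of_ne hd] using h1⟩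
  · have hyA := (hs.slot_eq _ _ hy).1
    have hxW := hW x hxA
    have hyW := hW y hyA
    rw [← hs.prio_eq] at hxW hyW
    simp only [runs_bind, runs_less, decide_eq_true_eq]
    by_cases hlt : s.heap.prio y < s.heap.prio x
    · simp only [if_pos hlt, runs_pure, Sum.elim_inl]
      obtain ⟨h1, h2⟩ := hs.link hy (.inr ⟨rfl, rfl⟩) hlt.le
      refine ⟨_, ?_, h1, rfl, ?_⟩
      · omega
      · rw [← h2, mul_add] at hT
        omega
    · simp only [if_neg hlt, runs_pure, Sum.elim_inl]
      obtain ⟨h1, h2⟩ := hs.link hy (.inl ⟨rfl, rfl⟩) (not_lt.1 hlt)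
      refine ⟨_, ?_, h1, rfl, ?_⟩
      · omega
      · rw [← h2, mul_add] at hT
        omega

/-- Each initial root accounts for `u` for being placed and another `u` for at most one link, whence
`2 * u`. The remaining roots have distinct degrees at most `D`, which bounds both their number and
the final pass over the slots. -/
theorem consolidate_runs {D T u : ℕ} (hF : Forest A 0 h) (hnd : h.roots.Nodup)
    (hr : ∀ x, x ∈ h.roots ↔ x ∈ A ∧ h.parent x = none)
    (hW : ∀ x ∈ A, Nat.size (h.prio x) ≤ W)
    (hD : ∀ g : FibHeap K, Forest A 0 g → ∀ x ∈ A, g.parent x = none → (g.children x).length ≤ D)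
    (hu : 2 * W + 2 ≤ u) :
    Runs (consolidate h) T fun h' T' => Valid A W h' ∧ h'.prio = h.prio ∧
      h'.roots.length ≤ D + 1 ∧ marks A h' ≤ marks A h ∧
      T' ≤ T + 2 * u * h.roots.length + 1 + (D + 1) * (u + 1) := by
  have hcount : rootCount A h ≤ h.roots.length := by
    rw [← List.toFinset_card_of_nodup hnd]
    refine Finset.card_le_card fun x hx => ?_
    rw [List.mem_toFinset, hr]
    exact Finset.mem_filter.1 hx
  unfold consolidate
  rw [runs_bind]
  have h0 := runs_forEach (f := place)
    (I := fun l s T' => Consolidating A h.prio (marks A h) D l s ∧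
      T' + u * rootCount A s.heap + u * l.length ≤ T + 2 * u * h.roots.length)
    (fun x l s T' hI => by
      -- The budget `B` is what is left after reserving `u` for each root not yet placed, the
      -- present one included; by the invariant the truncated subtraction is harmless.
      refine (place_runs hI.1 hW hD hu (B := T + 2 * u * h.roots.length - u * (l.length + 1))
        ?_).mono ?_
      · have := hI.2
        rw [List.length_cons] at this
        omega
      · rintro s' T'' ⟨h1, h2⟩
        refine ⟨h1, ?_⟩
        have h3 := hI.2
        rw [List.length_cons, mul_add] at h3
        rw [mul_add] at h2
        omega) h.roots ⟨h, fun _ => none, 0⟩ T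
    ⟨⟨hF, rfl, by simp, fun x hx hp => .inl ((hr x).2 ⟨hx, hp⟩), hnd, fun x hx => (hr x).1 hx,
      le_rfl, Nat.zero_le _⟩, by
      have := Nat.mul_le_mul_left u hcount
      simp only
      rw [mul_assoc, two_mul (u * _)]
      omega⟩
  refine h0.mono ?_
  rintro s T1 ⟨hs, hT1⟩
  rw [runs_bind, runs_tick]
  -- The index of a slot is the degree of its root, so no root is collected twice.
  have hinj : ∀ d d' x, s.slot d = some x → s.slot d' = some x → d = d' := by
    intro d d' x h1 h2
    exact (hs.slot_eq d x h1).2.2.1.symm.trans (hs.slot_eq d' x h2).2.2.1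
  have hWs : ∀ x ∈ A, Nat.size (s.heap.prio x) ≤ W := by
    rw [hs.prio_eq]
    exact hW
  refine (runs_forEach (I := fun l g T' => ∃ pre r m, List.range (s.maxDeg + 1) = pre ++ l ∧
      g = { s.heap with roots := r, minPtr := m } ∧ r.Nodup ∧
      (∀ x, x ∈ r ↔ ∃ d ∈ pre, s.slot d = some x) ∧ PointsToMin g {x | x ∈ r} ∧
      r.length ≤ pre.length ∧ T' ≤ T1 + 1 + pre.length * (u + 1)) ?_ _ _ _ ?_).mono ?_
  · rintro d l g T' ⟨pre, r, m, hpre, rfl, hrnd, hrm, hmin, hrl, hT'⟩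
    have hd : d ∉ pre := by
      have h1 := List.nodup_range (n := s.maxDeg + 1)
      rw [hpre] at h1
      exact fun hc => (List.nodup_append.1 h1).2.2 d hc d (by simp) rfl
    rw [runs_bind, runs_tick]
    rcases hx : s.slot d with _ | x
    · simp only [runs_pure]
      refine ⟨pre ++ [d], r, m, by simp [hpre], rfl, hrnd, ?_, hmin, ?_, ?_⟩
      · intro z
        rw [hrm]
        constructor
        · rintro ⟨d', h1, h2⟩
          exact ⟨d', by simp [h1], h2⟩
        · rintro ⟨d', h1, h2⟩
          rcases List.mem_append.1 h1 with h1 | h1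
          · exact ⟨d', h1, h2⟩
          · obtain rfl : d' = d := by simpa using h1
            rw [hx] at h2
            cases h2
      · simp
        omega
      · rw [List.length_append, List.length_singleton, add_mul]
        omega
    · have hxr : x ∉ r := by
        intro hc
        obtain ⟨d', h1, h2⟩ := (hrm x).1 hc
        rw [hinj d' d x h2 hx] at h1
        exact hd h1
      have hsub : ∀ z ∈ r, z ∈ A := by
        intro z hz
        obtain ⟨d', h1, h2⟩ := (hrm z).1 hz
        exact (hs.slot_eq d' z h2).1
      refine updateMin_runs (s := {z | z ∈ x :: r}) (W := W) (by simp) ?_ ?_ ?_ ?_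
      · intro hm z hz
        have h1 := hmin.1 hm
        rcases List.mem_cons.1 hz with rfl | hz
        · rfl
        · exact absurd (show z ∈ {x | x ∈ r} from hz) (by simp [h1])
      · intro y hy
        obtain ⟨h1, h2⟩ := hmin.2 y hy
        refine ⟨List.mem_cons_of_mem _ h1, fun z hz hzx => ?_⟩
        exact h2 z ((List.mem_cons.1 hz).resolve_left hzx)
      · intro z hz
        rcases List.mem_cons.1 hz with rfl | hz
        · exact hWs _ (hs.slot_eq _ _ hx).1
        · exact hWs z (hsub z hz)
      · intro m' T'' hm' hT''
        refine ⟨pre ++ [d], x :: r, m', by simp [hpre], rfl, List.nodup_cons.2 ⟨hxr, hrnd⟩, ?_,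
          hm', ?_, ?_⟩
        · intro z
          rw [List.mem_cons, hrm]
          constructor
          · rintro (rfl | ⟨d', h1, h2⟩)
            · exact ⟨d, by simp, hx⟩
            · exact ⟨d', by simp [h1], h2⟩
          · rintro ⟨d', h1, h2⟩
            rcases List.mem_append.1 h1 with h1 | h1
            · exact .inr ⟨d', h1, h2⟩
            · obtain rfl : d' = d := by simpa using h1
              rw [hx, Option.some_inj] at h2
              exact .inl h2.symm
        · simp
          omega
        · rw [List.length_append, List.length_singleton, add_mul]
          omega
  · exact ⟨[], [], none, rfl, rfl, List.nodup_nil, by simp, ⟨by simp, by simp⟩, le_rfl, by simp⟩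
  · rintro g T2 ⟨pre, r, m, hpre, rfl, hrnd, hrm, hmin, hrl, hT2⟩
    rw [List.append_nil] at hpre
    subst hpre
    rw [List.length_range] at hrl hT2
    have hmD := hs.maxDeg_le
    refine ⟨⟨hs.forest.congr rfl rfl rfl rfl, hrnd, ?_, hmin, hWs⟩, hs.prio_eq, ?_, hs.marks_le, ?_⟩
    · intro x
      dsimp only
      rw [hrm]
      constructor
      · rintro ⟨d, -, h1⟩
        exact ⟨(hs.slot_eq d x h1).1, (hs.slot_eq d x h1).2.1⟩
      · rintro ⟨h1, h2⟩
        obtain ⟨d, h3⟩ := (hs.mem_or_slot x h1 h2).resolve_left (by simp)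
        exact ⟨d, List.mem_range.2 (Nat.lt_succ_of_le (hs.slot_eq d x h3).2.2.2.1), h3⟩
    · exact hrl.trans (by omega)
    · have h1 := Nat.mul_le_mul_right (u + 1) (Nat.add_le_add_right hmD 1)
      simp only [List.length_nil, mul_zero, add_zero] at hT1
      omega

theorem extractMin_runs_of_empty (hV : Valid ∅ W h) {T : ℕ} :
    Runs (extractMin h) T fun r T' => r = none ∧ T' = T + 1 := by
  unfold extractMin
  rw [runs_bind, runs_tick]
  rcases hm : h.minPtr with _ | z
  · simp [runs_pure]
  · have := ((hV.mem_roots z).1 (hV.min.2 z hm).1).1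
    simp at this

/-- Consolidation spends `2 * u` per root, which is why a unit of potential is worth `2 * u`: the
old roots pay for themselves. There remain the at most `D` children of `z`, which bring no
potential, the at most `D + 1` roots of the new heap and the pass over the slots, all of order `u *
(D + 1)`. -/
theorem extractMin_runs (hV : Valid A W h) (hA : A.Nonempty) {D T u : ℕ} (hu : 2 * W + 2 ≤ u)
    (hD : 2 * Nat.log 2 A.card + 1 ≤ D) :
    Runs (extractMin h) T fun r T' => ∃ z h', r = some (z, h') ∧ z ∈ A ∧
      (∀ x ∈ A, h.prio z ≤ h.prio x) ∧ Valid (A.erase z) W h' ∧ h'.prio = h.prio ∧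
      T' + 2 * u * potential (A.erase z) h' ≤ T + 2 * u * potential A h + 10 * u * (D + 1) := by
  obtain ⟨x0, hx0⟩ := hA
  unfold extractMin
  rw [runs_bind, runs_tick]
  rcases hm : h.minPtr with _ | z
  · exfalso
    obtain ⟨v, hv, hvp, -⟩ := hV.forest.exists_root_le hx0
    exact absurd (show v ∈ {x | x ∈ h.roots} from (hV.mem_roots v).2 ⟨hv, hvp⟩)
      (by simp [hV.min.1 hm])
  obtain ⟨hzr, hzmin⟩ := hV.min.2 z hm
  obtain ⟨hzA, hzp⟩ := (hV.mem_roots z).1 hzr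
  simp only [runs_bind]
  have hdeg : ∀ (A' : Finset K), A' ⊆ A → ∀ g : FibHeap K, Forest A' 0 g → ∀ x ∈ A',
      g.parent x = none → (g.children x).length ≤ D := fun A' hA' g hg x hx hxp =>
    (hg.degree_le hx hxp (Finset.card_le_card hA')).trans hD
  have hzD := hdeg A subset_rfl h hV.forest z hzA hzp
  refine (runs_forEach (I := fun l g T' => ∃ pre, h.children z = pre ++ l ∧
    g = { h with
      parent := fun x => if x ∈ pre then none else h.parent x
      mark := fun x => if x ∈ pre then false else h.mark x } ∧
    T' = T + 1 + pre.length) ?_ _ _ _ ⟨[], rfl, by simp, by simp⟩).mono ?_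
  · rintro x l g T' ⟨pre, hpre, rfl, rfl⟩
    rw [runs_bind, runs_tick, runs_pure]
    refine ⟨pre ++ [x], by simp [hpre], ?_, by simp; omega⟩
    congr 1
    · funext y
      rcases eq_or_ne y x with rfl | hyx
      · simp
      · simp [hyx]
    · funext y
      rcases eq_or_ne y x with rfl | hyx
      · simp
      · simp [hyx]
  · rintro g T' ⟨pre, hpre, rfl, rfl⟩
    rw [List.append_nil] at hpre
    subst hpre
    have hF := hV.forest.remove_root hzp (h.children z ++ h.roots.erase z) h.minPtr
    have hnd : (h.children z ++ h.roots.erase z).Nodup := by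
      refine List.nodup_append.2 ⟨hV.forest.nodup_children z, hV.nodup_roots.erase z, ?_⟩
      rintro x hx y hy rfl
      have h1 := ((hV.forest.mem_children x z).1 hx).2
      have h2 := ((hV.mem_roots x).1 (List.mem_of_mem_erase hy)).2
      rw [h1] at h2
      cases h2
    have hr : ∀ x, x ∈ h.children z ++ h.roots.erase z ↔
        x ∈ A.erase z ∧ (if x ∈ h.children z then none else h.parent x) = none := by
      intro x
      rw [List.mem_append, hV.nodup_roots.mem_erase_iff, hV.mem_roots, Finset.mem_erase]
      by_cases hx : x ∈ h.children z
      · have h1 := (hV.forest.mem_children x z).1 hx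
        have h2 := hV.forest.parent_ne h1.1 h1.2
        simp [hx, h1.1, h2]
      · simp only [hx, false_or, if_false]
        tauto
    refine (consolidate_runs (W := W) hF hnd hr
      (fun x hx => hV.size_le x (Finset.mem_of_mem_erase hx))
      (hdeg (A.erase z) (Finset.erase_subset _ _)) hu).mono ?_
    rintro g T' ⟨hg, hgp, hgl, hgm, hgT⟩
    rw [runs_pure]
    refine ⟨z, g, rfl, hzA, ?_, hg, hgp, ?_⟩
    · intro x hx
      obtain ⟨v, hv, hvp, hvx⟩ := hV.forest.exists_root_le hx
      exact (hzmin v ((hV.mem_roots v).2 ⟨hv, hvp⟩)).trans hvx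
    · have h1 : marks (A.erase z) g ≤ marks A h := by
        refine hgm.trans (Finset.card_le_card fun x hx => ?_)
        rw [Finset.mem_filter] at hx ⊢
        refine ⟨Finset.mem_of_mem_erase hx.1, ?_⟩
        have h2 := hx.2
        simp only at h2
        split_ifs at h2
        exact h2
      have h2 : (h.children z ++ h.roots.erase z).length ≤ D + h.roots.length := by
        rw [List.length_append]
        exact add_le_add hzD List.length_erase_le
      have h3 : potential (A.erase z) g ≤ D + 1 + 2 * marks A h := by
        simp only [potential]
        omega
      have h4 := Nat.mul_le_mul_left (2 * u) h2
      have h5 := Nat.mul_le_mul_left (2 * u) h3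
      have h6 : D ≤ u * D := Nat.le_mul_of_pos_left D (by omega)
      simp only at hgT
      have h7 : potential A h = h.roots.length + 2 * marks A h := rfl
      rw [h7]
      -- The products are expanded so that the final estimate is linear in the monomials.
      have e1 : (D + 1) * (u + 1) = u * D + D + u + 1 := by ring
      have e2 : 10 * u * (D + 1) = 10 * (u * D) + 10 * u := by ring
      have e3 : 2 * u * (D + h.roots.length) = 2 * (u * D) + 2 * u * h.roots.length := by ring
      have e4 : 2 * u * (D + 1 + 2 * marks A h) =
        2 * (u * D) + 2 * u + 2 * u * (2 * marks A h) := by ring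
      rw [mul_add (2 * u) h.roots.length]
      omega

end FibHeap

/-! ### An amortized interface for priority queues -/

open Timed

/-- Amortized specification of a priority queue on items in `U` with priorities of at most `W` bits:
`R h c φ` tells that the heap `h` has the contents `c` and the potential `φ`; the amortized times
are at most `b` for `extractMin` and `a` for the other operations, provided that `timed` holds. -/
structure PriorityQueue.Amortized {K : Type u} [DecidableEq K] (pq : PriorityQueue K)
    (U : Finset K) (W a b : ℕ) (timed : Prop) (R : pq.Heap → (K → Option ℕ) → ℕ → Prop) : Prop where
  empty : R pq.empty (fun _ => none) 0
  insert : ∀ h c φ x p T, R h c φ → c x = none → x ∈ U → Nat.size p ≤ W →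
    Runs (pq.insert x p h) T fun h' T' => ∃ φ', R h' (Function.update c x (some p)) φ' ∧
      (timed → T' + φ' ≤ T + φ + a)
  extractMin_none : ∀ h c φ T, R h c φ → (∀ x, c x = none) →
    Runs (pq.extractMin h) T fun r T' => r = none ∧ (timed → T' ≤ T + b)
  extractMin_some : ∀ h c φ T, R h c φ → (∃ x, c x ≠ none) →
    Runs (pq.extractMin h) T fun r T' => ∃ x p h' φ', r = some (x, h') ∧ c x = some p ∧
      (∀ y q, c y = some q → p ≤ q) ∧ R h' (Function.update c x none) φ' ∧
      (timed → T' + φ' ≤ T + φ + b)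
  decreaseKey : ∀ h c φ x p q T, R h c φ → c x = some q → p ≤ q →
    Runs (pq.decreaseKey x p h) T fun h' T' => ∃ φ', R h' (Function.update c x (some p)) φ' ∧
      (timed → T' + φ' ≤ T + φ + a)

/-- With `timed` equal to `False` the time bounds are vacuous and the potential can be ignored, so
correctness for every queue follows from the analysis made for the timed one. -/
theorem PriorityQueue.IsCorrect.amortized {K : Type u} [DecidableEq K] {pq : PriorityQueue K}
    (h : pq.IsCorrect) (U : Finset K) (W a b : ℕ) : ∃ R, pq.Amortized U W a b False R := by
  obtain ⟨R, h1, h2, h3, h4, h5⟩ := h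
  refine ⟨fun h c _ => R h c, h1, ?_, ?_, ?_, ?_⟩
  · intro h c φ x p T hR hx _ _
    obtain ⟨h', t, e, hR'⟩ := h2 h c x p hR hx
    exact ⟨h', t, e, 0, hR', False.elim⟩
  · intro h c φ T hR hc
    obtain ⟨t, e⟩ := h3 h c hR hc
    exact ⟨none, t, e, rfl, False.elim⟩
  · intro h c φ T hR hc
    obtain ⟨x, p, h', t, e, hx, hmin, hR'⟩ := h4 h c hR hc
    exact ⟨_, t, e, x, p, h', 0, rfl, hx, hmin, hR', False.elim⟩
  · intro h c φ x p q T hR hx hpq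
    obtain ⟨h', t, e, hR'⟩ := h5 h c x p q hR hx hpq
    exact ⟨h', t, e, 0, hR', False.elim⟩

/-- The heap bounds are used with `u = 2 * W + 2`. Then `12 * u` is `24 * (W + 1)`, and `10 * u * (D
+ 1)` with `D = 2 * Nat.log 2 U.card + 1` is the bound for `extractMin`. The potential counts `2 *
u` per unit. -/
theorem fibonacciHeap_amortized {K : Type u} [DecidableEq K] (U : Finset K) (W : ℕ) :
    ∃ R, (fibonacciHeap K).Amortized U W (24 * (W + 1)) (40 * (W + 1) * (Nat.log 2 U.card + 1))
      True R := by
  refine ⟨fun h c φ => ∃ A ⊆ U, c = (fun x => if x ∈ A then some (h.prio x) else none) ∧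
    FibHeap.Valid A W h ∧ φ = 2 * (2 * W + 2) * FibHeap.potential A h, ?_, ?_, ?_, ?_, ?_⟩
  · refine ⟨∅, by simp, by simp, ⟨FibHeap.forest_empty, ?_, ?_, ⟨?_, ?_⟩, ?_⟩, ?_⟩ <;>
      simp [fibonacciHeap, FibHeap.empty, FibHeap.potential, FibHeap.marks]
  · rintro h c φ x p T ⟨A, hA, rfl, hV, rfl⟩ hx hxU hp
    have hxA : x ∉ A := by
      intro hc
      simp [hc] at hx
    refine (FibHeap.insert_runs hV hxA hp).mono ?_
    rintro h' T' ⟨h1, h2, h3, h4⟩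
    refine ⟨_, ⟨insert x A, Finset.insert_subset hxU hA, ?_, h1, rfl⟩, fun _ => ?_⟩
    · funext y
      rw [h2]
      rcases eq_or_ne y x with rfl | hyx
      · simp
      · simp [hyx]
    · rw [h3, mul_add]
      omega
  · rintro h c φ T ⟨A, hA, rfl, hV, rfl⟩ hc
    have : A = ∅ := by
      refine Finset.eq_empty_of_forall_notMem fun x hx => ?_
      have := hc x
      simp [hx] at this
    subst this
    refine (FibHeap.extractMin_runs_of_empty hV).mono ?_
    rintro r T' ⟨rfl, rfl⟩
    refine ⟨rfl, fun _ => ?_⟩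
    have : 0 < 40 * (W + 1) * (Nat.log 2 U.card + 1) := by positivity
    omega
  · rintro h c φ T ⟨A, hA, rfl, hV, rfl⟩ ⟨x, hx⟩
    have hxA : x ∈ A := by
      by_contra hc
      simp [hc] at hx
    refine (FibHeap.extractMin_runs hV ⟨x, hxA⟩ le_rfl
      (D := 2 * Nat.log 2 U.card + 1) (by
        have := Nat.log_mono_right (b := 2) (Finset.card_le_card hA)
        omega)).mono ?_
    rintro r T' ⟨z, h', rfl, hz, hmin, hV', hprio, hT⟩
    refine ⟨z, h.prio z, h', _, rfl, by simp [hz], ?_,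
      ⟨A.erase z, (Finset.erase_subset _ _).trans hA, ?_, hV', rfl⟩, fun _ => ?_⟩
    · intro y q hy
      by_cases hyA : y ∈ A
      · simp only [hyA, if_true, Option.some_inj] at hy
        rw [← hy]
        exact hmin y hyA
      · simp [hyA] at hy
    · funext y
      rw [hprio]
      rcases eq_or_ne y z with rfl | hyx
      · simp
      · simp [hyx]
    · refine hT.trans (le_of_eq ?_)
      ring
  · rintro h c φ x p q T ⟨A, hA, rfl, hV, rfl⟩ hx hpq
    have hxA : x ∈ A := by
      by_contra hc
      simp [hc] at hx
    simp only [hxA, if_true, Option.some_inj] at hx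
    subst hx
    refine (FibHeap.decreaseKey_runs hV hxA hpq le_rfl).mono ?_
    rintro h' T' ⟨h1, h2, h3⟩
    refine ⟨_, ⟨A, hA, ?_, h1, rfl⟩, fun _ => ?_⟩
    · funext y
      rw [h2]
      rcases eq_or_ne y x with rfl | hyx
      · simp [hxA]
      · simp [hyx]
    · refine h3.trans (le_of_eq ?_)
      ring

namespace MinimizingRules

open Timed

/-! ### Correctness and running time of the algorithm -/

section Costs

variable {K : Type u} {S : Type v}

/-- The partial map `c'` extends `c`, up to lowering of values. -/
def Lowers (c c' : K → Option ℕ) : Prop := ∀ x p, c x = some p → ∃ p' ≤ p, c' x = some p'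

theorem Lowers.refl (c : K → Option ℕ) : Lowers c c := fun _ p h => ⟨p, le_rfl, h⟩

theorem Lowers.trans {c c' c'' : K → Option ℕ} (h : Lowers c c') (h' : Lowers c' c'') :
    Lowers c c'' := by
  intro x p hp
  obtain ⟨p', h1, h2⟩ := h x p hp
  obtain ⟨p'', h3, h4⟩ := h' x p' h2
  exact ⟨p'', h3.trans h1, h4⟩

theorem lowers_update [DecidableEq K] {c : K → Option ℕ} {x : K} {p : ℕ}
    (h : ∀ q, c x = some q → p ≤ q) : Lowers c (Function.update c x (some p)) := by
  intro y q hy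
  rcases eq_or_ne y x with rfl | hyx
  · exact ⟨p, h q hy, Function.update_self _ _ _⟩
  · exact ⟨q, le_rfl, by rwa [Function.update_of_ne hyx]⟩

/-- `x` has a cost, and it is at most `k`. -/
def CostLE (c : K → Option ℕ) (x : K) (k : ℕ) : Prop := ∃ p ≤ k, c x = some p

theorem CostLE.mono {c c' : K → Option ℕ} {x : K} {k : ℕ} (h : CostLE c x k) (hc : Lowers c c') :
    CostLE c' x k := by
  obtain ⟨p, h1, h2⟩ := h
  obtain ⟨p', h3, h4⟩ := hc x p h2
  exact ⟨p', h3.trans h1, h4⟩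

/-- The cost `p` is justified by the rule `r`. -/
def Justifies (c : K → Option ℕ) (p : ℕ) : Rule K S → Prop
  | .term _ _ => p = 1
  | .bin _ e f => ∃ p₁ p₂, c e = some p₁ ∧ c f = some p₂ ∧ p₁ + p₂ ≤ p

/-- This is why a justification is an inequality: the cost of a partner still in the queue may be
lowered after the rule has been stored. Equality is recovered at the end of the run. -/
theorem Justifies.mono {c c' : K → Option ℕ} {p : ℕ} {r : Rule K S} (h : Justifies c p r)
    (hc : Lowers c c') : Justifies c' p r := by
  cases r with
  | term a s => exact h
  | bin a e f =>
    obtain ⟨p₁, p₂, h1, h2, h3⟩ := h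
    obtain ⟨q₁, h4, h5⟩ := hc e p₁ h1
    obtain ⟨q₂, h6, h7⟩ := hc f p₂ h2
    exact ⟨q₁, q₂, h5, h7, by omega⟩

end Costs

variable {V : Type u} {S : Type v} {Q : Type w} [DecidableEq V] [DecidableEq Q]
  {pq : PriorityQueue (Anno V Q)} {G : Grammar V S} {Γ : LabeledGraph Q S}

/-- The invariant of the algorithm. The items in `D` have been taken from the queue with the costs
`κ`, which are at most `p₀`; the queue contains the other items that have a cost, with priorities at
least `p₀`, and has potential `φ`. -/
structure Inv (G : Grammar V S) (Γ : LabeledGraph Q S)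
    (R : pq.Heap → (Anno V Q → Option ℕ) → ℕ → Prop) (D : Finset (Anno V Q)) (κ : Anno V Q → ℕ)
    (p₀ : ℕ) (st : Vars S pq) (φ : ℕ) : Prop where
  heap : R st.new (fun x => if x ∈ D then none else st.cost x) φ
  mem_keys : ∀ x, x ∈ st.keys ↔ ∃ p, st.cost x = some p
  nodup_keys : st.keys.Nodup
  keys_mem : ∀ x ∈ st.keys, x ∈ annoNonterminals G Γ
  nodup_starting : ∀ m, (st.starting m).Nodup
  mem_starting : ∀ m x, x ∈ st.starting m ↔ x ∈ st.keys ∧ x.2.1 = m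
  nodup_ending : ∀ m, (st.ending m).Nodup
  mem_ending : ∀ m x, x ∈ st.ending m ↔ x ∈ st.keys ∧ x.2.2 = m
  cost_lt : ∀ x p, st.cost x = some p → 0 < p ∧ p < 2 ^ st.keys.length
  cost_done : ∀ x ∈ D, st.cost x = some (κ x) ∧ κ x ≤ p₀
  le_cost : ∀ x ∉ D, ∀ p, st.cost x = some p → p₀ ≤ p
  rule : ∀ x p, st.cost x = some p →
    ∃ r ∈ annoRules G Γ, st.rule x = some r ∧ r.head = x ∧ Justifies st.cost p r

variable {R : pq.Heap → (Anno V Q → Option ℕ) → ℕ → Prop} {D : Finset (Anno V Q)}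
  {κ : Anno V Q → ℕ} {p₀ φ a b T : ℕ} {st : Vars S pq} {timed : Prop}

omit [DecidableEq V] [DecidableEq Q] in
theorem head_mem_annoNonterminals {r : Rule (Anno V Q) S} (hr : r ∈ annoRules G Γ) :
    r.head ∈ annoNonterminals G Γ := (annotatedGrammar G Γ).head_mem r hr

theorem Inv.length_keys_le (h : Inv G Γ R D κ p₀ st φ) :
    st.keys.length ≤ (annoNonterminals G Γ).card := by
  rw [← List.toFinset_card_of_nodup h.nodup_keys]
  exact Finset.card_le_card fun x hx => h.keys_mem x (List.mem_toFinset.1 hx)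

/-- The bound `2 ^ st.keys.length` survives each step: a new key at most doubles the bound on the
costs, and lowering decreases them. Hence all arithmetic is on numbers of at most `|N_Γ|` bits. -/
theorem Inv.size_cost_le (h : Inv G Γ R D κ p₀ st φ) {x : Anno V Q} {p : ℕ}
    (hx : st.cost x = some p) : Nat.size p ≤ (annoNonterminals G Γ).card :=
  (Nat.size_le.2 (h.cost_lt x p hx).2).trans h.length_keys_le

theorem queue_update {D : Finset (Anno V Q)} {c : Anno V Q → Option ℕ} {x : Anno V Q} (hx : x ∉ D)
    (p : ℕ) : Function.update (fun y => if y ∈ D then none else c y) x (some p) =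
      fun y => if y ∈ D then none else Function.update c x (some p) y := by
  funext y
  rcases eq_or_ne y x with rfl | hyx
  · simp [hx]
  · simp [hyx]

/-- Started at time `T` in the state `st` with potential `φ`, the program preserves `P`, only lowers
costs, achieves `post`, and takes amortized time at most `w`. -/
def Advances (P : Vars S pq → ℕ → Prop) (timed : Prop) (prog : Timed (Vars S pq)) (st : Vars S pq)
    (φ T w : ℕ) (post : Vars S pq → Prop) : Prop :=
  Runs prog T fun st' T' => ∃ φ', P st' φ' ∧ Lowers st.cost st'.cost ∧ post st' ∧
    (timed → T' + φ' ≤ T + φ + w)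

omit [DecidableEq V] [DecidableEq Q] in
theorem Advances.tick {P : Vars S pq → ℕ → Prop} {n w : ℕ} {prog : Timed (Vars S pq)}
    {post : Vars S pq → Prop} (h : ∀ T, Advances P timed prog st φ T w post) :
    Advances P timed (do tick n; prog) st φ T (n + w) post := by
  unfold Advances
  rw [runs_bind, runs_tick]
  refine (h (T + n)).mono ?_
  rintro st' T' ⟨φ', h1, h2, h3, h4⟩
  refine ⟨φ', h1, h2, h3, fun ht => ?_⟩
  have := h4 ht
  omega

omit [DecidableEq V] [DecidableEq Q] in
theorem Advances.mono {P : Vars S pq → ℕ → Prop} {w w' : ℕ} {prog : Timed (Vars S pq)}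
    {post post' : Vars S pq → Prop} (h : Advances P timed prog st φ T w post) (hw : w ≤ w')
    (hpost : ∀ st', post st' → post' st') : Advances P timed prog st φ T w' post' := by
  refine Runs.mono h ?_
  rintro st' T' ⟨φ', h1, h2, h3, h4⟩
  refine ⟨φ', h1, h2, hpost _ h3, fun ht => ?_⟩
  have := h4 ht
  omega

omit [DecidableEq V] [DecidableEq Q] in
-- What one iteration achieves must be stable under lowering of costs, because later iterations go
-- on changing the state.
theorem forEach_advances {α : Type*} {P : Vars S pq → ℕ → Prop} {w : α → ℕ}
    {f : Vars S pq → α → Timed (Vars S pq)} {post : α → Vars S pq → Prop} {l : List α}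
    (step : ∀ x ∈ l, ∀ st' φ' T', P st' φ' → Lowers st.cost st'.cost →
      Advances P timed (f st' x) st' φ' T' (w x) (post x))
    (mono : ∀ x st' st'', post x st' → Lowers st'.cost st''.cost → post x st'') (h : P st φ) :
    Advances P timed (forEach l st f) st φ T (l.map w).sum fun st' => ∀ x ∈ l, post x st' := by
  have := runs_forEach (f := f) (l := l) (s := st) (T := T)
    (I := fun k st' T' => (∀ x ∈ k, x ∈ l) ∧ ∃ φ', P st' φ' ∧ Lowers st.cost st'.cost ∧
      (∀ x ∈ l, x ∈ k ∨ post x st') ∧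
      (timed → T' + φ' + (k.map w).sum ≤ T + φ + (l.map w).sum)) ?_
    ⟨fun _ h => h, φ, h, Lowers.refl _, fun x hx => .inl hx, fun _ => le_rfl⟩
  · refine this.mono ?_
    rintro st' T' ⟨-, φ', h1, h2, h3, h4⟩
    exact ⟨φ', h1, h2, fun x hx => (h3 x hx).resolve_left (by simp), by simpa using h4⟩
  · rintro x k st' T' ⟨hk, φ', h1, h2, h3, h4⟩
    refine Runs.mono (step x (hk x (by simp)) st' φ' T' h1 h2) ?_
    rintro st'' T'' ⟨φ'', h5, h6, h7, h8⟩
    refine ⟨fun y hy => hk y (List.mem_cons_of_mem _ hy), φ'', h5, h2.trans h6, ?_, fun ht => ?_⟩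
    · intro y hy
      rcases h3 y hy with h9 | h9
      · rcases List.mem_cons.1 h9 with rfl | h9
        · exact .inr h7
        · exact .inl h9
      · exact .inr (mono y _ _ h9 h6)
    · have h9 := h4 ht
      have h10 := h8 ht
      simp only [List.map_cons, List.sum_cons] at h9
      omega

theorem addNew_advances
    (hpq : pq.Amortized (annoNonterminals G Γ) (annoNonterminals G Γ).card a b timed R)
    (h : Inv G Γ R D κ p₀ st φ) {r : Rule (Anno V Q) S} {p : ℕ} (hr : r ∈ annoRules G Γ)
    (hcost : st.cost r.head = none) (hj : Justifies st.cost p r) (hp₀ : p₀ ≤ p) (hp : 0 < p)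
    (hp2 : p < 2 ^ (st.keys.length + 1)) :
    Advances (Inv G Γ R D κ p₀) timed (addNew r p st) st φ T
      (1 + (annoNonterminals G Γ).card + a)
      fun st' => st'.cost = Function.update st.cost r.head (some p) := by
  have hkey : r.head ∉ st.keys := by
    rw [h.mem_keys, hcost]
    simp
  have hD : r.head ∉ D := fun hc => by
    rw [(h.cost_done _ hc).1] at hcost
    cases hcost
  have hnd : (r.head :: st.keys).Nodup := List.nodup_cons.2 ⟨hkey, h.nodup_keys⟩
  have hsub : ∀ x ∈ r.head :: st.keys, x ∈ annoNonterminals G Γ := by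
    intro x hx
    rcases List.mem_cons.1 hx with rfl | hx
    · exact head_mem_annoNonterminals hr
    · exact h.keys_mem x hx
  -- The new head is a further annotated nonterminal, so even the enlarged exponent `st.keys.length
  -- + 1` stays within the bound on the number of bits.
  have hlen : st.keys.length + 1 ≤ (annoNonterminals G Γ).card := by
    rw [← List.length_cons (a := r.head), ← List.toFinset_card_of_nodup hnd]
    exact Finset.card_le_card fun x hx => hsub x (List.mem_toFinset.1 hx)
  have hsize : Nat.size p ≤ (annoNonterminals G Γ).card := (Nat.size_le.2 hp2).trans hlen
  have hlow : Lowers st.cost (Function.update st.cost r.head (some p)) :=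
    lowers_update (by simp [hcost])
  unfold Advances addNew
  rw [runs_bind, runs_tick]
  dsimp only
  rw [runs_bind, runs_andThen]
  refine (hpq.insert _ _ _ r.head p _ h.heap (by simp [hD, hcost])
    (head_mem_annoNonterminals hr) hsize).mono ?_
  rintro g T' ⟨φ', hR, hT⟩
  rw [runs_ret, runs_pure]
  refine ⟨φ', ⟨?_, ?_, hnd, hsub, ?_, ?_, ?_, ?_, ?_, ?_, ?_, ?_⟩, hlow,
    rfl, fun ht => ?_⟩
  · rwa [queue_update hD] at hR
  · intro x
    dsimp only
    rw [List.mem_cons, h.mem_keys]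
    rcases eq_or_ne x r.head with rfl | hx
    · simp
    · simp [hx]
  · intro m
    rcases eq_or_ne m r.head.2.1 with rfl | hm
    · simp only [Function.update_self]
      refine List.nodup_cons.2 ⟨fun hc => hkey ((h.mem_starting _ _).1 hc).1, h.nodup_starting _⟩
    · simp only [Function.update_of_ne hm]
      exact h.nodup_starting m
  · intro m x
    rcases eq_or_ne m r.head.2.1 with rfl | hm
    · simp only [Function.update_self, List.mem_cons, h.mem_starting]
      constructor
      · rintro (rfl | h1)
        · exact ⟨.inl rfl, rfl⟩
        · exact ⟨.inr h1.1, h1.2⟩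
      · tauto
    · simp only [Function.update_of_ne hm, List.mem_cons, h.mem_starting]
      constructor
      · tauto
      · rintro ⟨rfl | h1, h2⟩
        · exact absurd h2.symm hm
        · exact ⟨h1, h2⟩
  · intro m
    rcases eq_or_ne m r.head.2.2 with rfl | hm
    · simp only [Function.update_self]
      refine List.nodup_cons.2 ⟨fun hc => hkey ((h.mem_ending _ _).1 hc).1, h.nodup_ending _⟩
    · simp only [Function.update_of_ne hm]
      exact h.nodup_ending m
  · intro m x
    rcases eq_or_ne m r.head.2.2 with rfl | hm
    · simp only [Function.update_self, List.mem_cons, h.mem_ending]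
      constructor
      · rintro (rfl | h1)
        · exact ⟨.inl rfl, rfl⟩
        · exact ⟨.inr h1.1, h1.2⟩
      · tauto
    · simp only [Function.update_of_ne hm, List.mem_cons, h.mem_ending]
      constructor
      · tauto
      · rintro ⟨rfl | h1, h2⟩
        · exact absurd h2.symm hm
        · exact ⟨h1, h2⟩
  · intro x q hx
    rcases eq_or_ne x r.head with rfl | hxr
    · simp only [Function.update_self, Option.some_inj] at hx
      subst hx
      exact ⟨hp, hp2⟩
    · simp only [Function.update_of_ne hxr] at hx
      obtain ⟨h1, h2⟩ := h.cost_lt x q hx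
      exact ⟨h1, h2.trans_le (Nat.pow_le_pow_right (by norm_num) (by simp))⟩
  · intro x hx
    have : x ≠ r.head := by
      rintro rfl
      exact hD hx
    simp only [Function.update_of_ne this]
    exact h.cost_done x hx
  · intro x hx q hq
    rcases eq_or_ne x r.head with rfl | hxr
    · simp only [Function.update_self, Option.some_inj] at hq
      subst hq
      exact hp₀
    · simp only [Function.update_of_ne hxr] at hq
      exact h.le_cost x hx q hq
  · intro x q hq
    rcases eq_or_ne x r.head with rfl | hxr
    · simp only [Function.update_self, Option.some_inj] at hq
      subst hq
      exact ⟨r, hr, Function.update_self _ _ _, rfl, hj.mono hlow⟩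
    · simp only [Function.update_of_ne hxr] at hq ⊢
      obtain ⟨r', h1, h2, h3, h4⟩ := h.rule x q hq
      exact ⟨r', h1, h2, h3, h4.mono hlow⟩
  · have := hT ht
    omega

theorem lower_advances
    (hpq : pq.Amortized (annoNonterminals G Γ) (annoNonterminals G Γ).card a b timed R)
    (h : Inv G Γ R D κ p₀ st φ) {r : Rule (Anno V Q) S} {p k : ℕ} (hr : r ∈ annoRules G Γ)
    (hcost : st.cost r.head = some k) (hpk : p < k) (hj : Justifies st.cost p r) (hp₀ : p₀ < p) :
    Advances (Inv G Γ R D κ p₀) timed (lower r p st) st φ T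
      (1 + (annoNonterminals G Γ).card + a) fun st' => CostLE st'.cost r.head p := by
  -- Extracted items have cost at most `p₀`, whereas a cost about to be lowered exceeds `p > p₀`:
  -- the central point of the Dijkstra argument.
  have hD : r.head ∉ D := fun hc => by
    obtain ⟨h1, h2⟩ := h.cost_done _ hc
    rw [hcost, Option.some_inj] at h1
    omega
  have hsize : Nat.size p ≤ (annoNonterminals G Γ).card :=
    (Nat.size_le_size hpk.le).trans (h.size_cost_le hcost)
  have hlow : Lowers st.cost (Function.update st.cost r.head (some p)) :=
    lowers_update (by
      rw [hcost]
      rintro q hq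
      cases hq
      exact hpk.le)
  unfold Advances lower
  rw [runs_bind, runs_tick]
  dsimp only
  rw [runs_bind, runs_andThen]
  refine (hpq.decreaseKey _ _ _ r.head p k _ h.heap (by simp [hD, hcost]) hpk.le).mono ?_
  rintro g T' ⟨φ', hR, hT⟩
  rw [runs_ret, runs_pure]
  refine ⟨φ', ⟨?_, ?_, h.nodup_keys, h.keys_mem, h.nodup_starting, h.mem_starting, h.nodup_ending,
    h.mem_ending, ?_, ?_, ?_, ?_⟩, hlow, ⟨p, le_rfl, Function.update_self _ _ _⟩, fun ht => ?_⟩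
  · rwa [queue_update hD] at hR
  · intro x
    dsimp only
    rw [h.mem_keys]
    rcases eq_or_ne x r.head with rfl | hx
    · simp [hcost]
    · simp [hx]
  · intro x q hx
    rcases eq_or_ne x r.head with rfl | hxr
    · simp only [Function.update_self, Option.some_inj] at hx
      subst hx
      exact ⟨by omega, hpk.trans (h.cost_lt _ _ hcost).2⟩
    · simp only [Function.update_of_ne hxr] at hx
      exact h.cost_lt x q hx
  · intro x hx
    have : x ≠ r.head := by
      rintro rfl
      exact hD hx
    simp only [Function.update_of_ne this]
    exact h.cost_done x hx
  · intro x hx q hq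
    rcases eq_or_ne x r.head with rfl | hxr
    · simp only [Function.update_self, Option.some_inj] at hq
      subst hq
      exact hp₀.le
    · simp only [Function.update_of_ne hxr] at hq
      exact h.le_cost x hx q hq
  · intro x q hq
    rcases eq_or_ne x r.head with rfl | hxr
    · simp only [Function.update_self, Option.some_inj] at hq
      subst hq
      exact ⟨r, hr, Function.update_self _ _ _, rfl, hj.mono hlow⟩
    · simp only [Function.update_of_ne hxr] at hq ⊢
      obtain ⟨r', h1, h2, h3, h4⟩ := h.rule x q hq
      exact ⟨r', h1, h2, h3, h4.mono hlow⟩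
  · have := hT ht
    omega

theorem produce_advances
    (hpq : pq.Amortized (annoNonterminals G Γ) (annoNonterminals G Γ).card a b timed R)
    (h : Inv G Γ R D κ p₀ st φ) {d e f : Anno V Q} {p q : ℕ}
    (hr : Rule.bin d e f ∈ annoRules G Γ) (hp : st.cost e = some p) (hq : st.cost f = some q)
    (hpq₀ : p₀ < p + q) :
    Advances (Inv G Γ R D κ p₀) timed (produce d e f st) st φ T
      (a + 5 * (annoNonterminals G Γ).card + 5) fun st' => CostLE st'.cost d (p + q) := by
  have hj : Justifies st.cost (p + q) (Rule.bin d e f : Rule (Anno V Q) S) :=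
    ⟨p, q, hp, hq, le_rfl⟩
  have hp1 := h.cost_lt e p hp
  have hq1 := h.cost_lt f q hq
  have hp2 := h.size_cost_le hp
  have hq2 := h.size_cost_le hq
  -- Two costs below `2 ^ st.keys.length` are added; the extra factor two is what a new key allows.
  have h2 : p + q < 2 ^ (st.keys.length + 1) := by
    rw [pow_succ]
    omega
  have h3 : Nat.size (p + q) ≤ (annoNonterminals G Γ).card + 1 :=
    (Nat.size_le.2 h2).trans (Nat.add_le_add_right h.length_keys_le 1)
  unfold produce
  refine (Advances.tick (w := a + 5 * (annoNonterminals G Γ).card + 4) fun T' => ?_).mono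
    (by omega) fun _ h => h
  simp only [hp, hq]
  refine (Advances.tick (w := a + 3 * (annoNonterminals G Γ).card + 3) fun T' => ?_).mono
    (by omega) fun _ h => h
  rcases hd : st.cost d with _ | k
  · exact (addNew_advances hpq h hr hd hj hpq₀.le (by omega) h2).mono (by omega)
      fun st' h => ⟨p + q, le_rfl, by rw [h]; exact Function.update_self _ _ _⟩
  · have hk := h.size_cost_le hd
    by_cases hlt : p + q < k
    · have h4 := lower_advances (T := T' + (1 + Nat.size (p + q) + Nat.size k)) hpq h hr hd hlt hj
        hpq₀
      unfold Advances
      simp only [runs_bind, runs_less, decide_eq_true_eq, if_pos hlt]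
      refine Runs.mono h4 ?_
      rintro st' T'' ⟨φ', h5, h6, h7, h8⟩
      refine ⟨φ', h5, h6, h7, fun ht => ?_⟩
      have := h8 ht
      omega
    · unfold Advances
      simp only [runs_bind, runs_less, decide_eq_true_eq, if_neg hlt, runs_pure]
      exact ⟨φ, h, Lowers.refl _, ⟨k, not_lt.1 hlt, hd⟩, fun _ => by omega⟩

/-- The loops of `process`. -/
theorem scan_advances
    (hpq : pq.Amortized (annoNonterminals G Γ) (annoNonterminals G Γ).card a b timed R)
    (h : Inv G Γ R D κ p₀ st φ) {x : Anno V Q} (hx : x ∈ D) (hκ : κ x = p₀)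
    {l : List (Anno V Q)} (hl : ∀ y ∈ l, y ∈ st.keys) {hs : Anno V Q → List V}
    {d : V → Anno V Q → Anno V Q} {e f : Anno V Q → Anno V Q}
    (hef : ∀ y, e y = x ∧ f y = y ∨ e y = y ∧ f y = x)
    (hr : ∀ y ∈ l, ∀ c ∈ hs y, Rule.bin (d c y) (e y) (f y) ∈ annoRules G Γ) :
    Advances (Inv G Γ R D κ p₀) timed
      (forEach l st fun st y => do
        tick 1
        forEach (hs y) st fun st c => produce (d c y) (e y) (f y) st) st φ T
      (l.map fun y =>
        1 + ((hs y).map fun _ => a + 5 * (annoNonterminals G Γ).card + 5).sum).sum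
      fun st' => ∀ y ∈ l, y ∈ D → ∀ c ∈ hs y, CostLE st'.cost (d c y) (κ (e y) + κ (f y)) := by
  refine forEach_advances (fun y hy st' φ' T' h' hlow => ?_) ?_ h
  · refine Advances.tick fun T'' => ?_
    obtain ⟨q, hq⟩ := (h.mem_keys y).1 (hl y hy)
    refine (forEach_advances (w := fun _ => a + 5 * (annoNonterminals G Γ).card + 5)
      (post := fun c st' => y ∈ D → CostLE st'.cost (d c y) (κ (e y) + κ (f y)))
      (fun c hc st'' φ'' T'' h'' hlow' => ?_) ?_ h').mono le_rfl
      fun st' h hyD c hc => h c hc hyD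
    -- The list was fixed when the scan began, and earlier iterations may have lowered the cost of
    -- `y`; for `y ∈ D` it is still `κ y`. Since `q'` is positive and `x` has cost `p₀`, the
    -- proposed cost exceeds `p₀`.
    · obtain ⟨q', -, hq'⟩ := hlow.trans hlow' y q hq
      have hxc := (h''.cost_done x hx).1
      have hpos := (h''.cost_lt y q' hq').1
      have hyc : y ∈ D → q' = κ y := by
        intro hyD
        have := (h''.cost_done y hyD).1
        rw [hq', Option.some_inj] at this
        exact this
      have hrule := hr y hy c hc
      rcases hef y with ⟨he, hf⟩ | ⟨he, hf⟩
      · rw [he, hf] at hrule ⊢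
        refine (produce_advances hpq h'' hrule hxc hq' (by omega)).mono le_rfl fun st h hyD => ?_
        rwa [hyc hyD] at h
      · rw [he, hf] at hrule ⊢
        refine (produce_advances hpq h'' hrule hq' hxc (by omega)).mono le_rfl fun st h hyD => ?_
        rwa [hyc hyD] at h
    · intro c st' st'' h1 h2 hyD
      exact (h1 hyD).mono h2
  · intro y st' st'' h1 h2 hyD c hc
    exact (h1 hyD c hc).mono h2

end MinimizingRules

/-! ### Charging the loops to the annotated rules -/

namespace Rule

variable {V : Type u} {S : Type v}

/-- The first nonterminal on the right-hand side. -/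
def fst : Rule V S → Option V
  | bin _ b _ => some b
  | term _ _ => none

/-- The second nonterminal on the right-hand side. -/
def snd : Rule V S → Option V
  | bin _ _ c => some c
  | term _ _ => none

end Rule

/-- Double counting: each element of `s` lies in the fibre of at most one `y`. -/
theorem sum_card_filter_eq_some_le {α β : Type*} [DecidableEq β] (s : Finset α) (t : Finset β)
    (f : α → Option β) : ∑ y ∈ t, (s.filter fun x => f x = some y).card ≤ s.card := by
  simp only [Finset.card_filter]
  rw [Finset.sum_comm, Finset.card_eq_sum_ones]
  refine Finset.sum_le_sum fun x _ => ?_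
  rcases f x with _ | y
  · simp
  · simp only [Option.some_inj, Finset.sum_ite_eq]
    split <;> simp

/-- The iterations of a nested loop are mapped injectively to rules, so their number is bounded by
the number of rules. -/
theorem sum_length_le_card {α β γ : Type*} {l : List α} {hs : α → List β} {g : α → β → γ}
    {s : Finset γ} (hl : l.Nodup) (hhs : ∀ y, (hs y).Nodup)
    (hg : ∀ y ∈ l, ∀ c ∈ hs y, g y c ∈ s)
    (hinj : ∀ y c y' c', g y c = g y' c' → y = y' ∧ c = c') :
    (l.map fun y => (hs y).length).sum ≤ s.card := by
  classical
  have h1 : (l.flatMap fun y => (hs y).map (g y)).Nodup := by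
    refine List.nodup_flatMap.2 ⟨fun y _ => ?_, ?_⟩
    · exact (hhs y).map fun c c' h => (hinj _ _ _ _ h).2
    · refine hl.imp fun {y y'} hne => ?_
      intro z hz hz'
      obtain ⟨c, -, rfl⟩ := List.mem_map.1 hz
      obtain ⟨c', -, hc⟩ := List.mem_map.1 hz'
      exact hne (hinj _ _ _ _ hc).1.symm
  have h2 : (l.map fun y => (hs y).length).sum = (l.flatMap fun y => (hs y).map (g y)).length := by
    simp [List.length_flatMap]
  rw [h2, ← List.toFinset_card_of_nodup h1]
  refine Finset.card_le_card fun z hz => ?_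
  simp only [List.mem_toFinset, List.mem_flatMap, List.mem_map] at hz
  obtain ⟨y, hy, c, hc, rfl⟩ := hz
  exact hg y hy c hc

namespace MinimizingRules

open Timed

variable {V : Type u} {S : Type v} {Q : Type w} [DecidableEq V] [DecidableEq Q]
  {pq : PriorityQueue (Anno V Q)} {G : Grammar V S} {Γ : LabeledGraph Q S}
  {R : pq.Heap → (Anno V Q → Option ℕ) → ℕ → Prop} {D : Finset (Anno V Q)}
  {κ : Anno V Q → ℕ} {p₀ φ a b T : ℕ} {st : Vars S pq} {timed : Prop}

/-- The number of occurrences of an annotated nonterminal in the right-hand sides of rules. -/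
noncomputable def occurrences (G : Grammar V S) (Γ : LabeledGraph Q S) (x : Anno V Q) : ℕ :=
  ((annoRules G Γ).filter fun r => r.fst = some x).card +
    ((annoRules G Γ).filter fun r => r.snd = some x).card

theorem sum_occurrences_le : ∑ x ∈ annoNonterminals G Γ, occurrences G Γ x ≤
    2 * (annoRules G Γ).card := by
  unfold occurrences
  rw [Finset.sum_add_distrib, two_mul]
  exact add_le_add (sum_card_filter_eq_some_le _ _ _) (sum_card_filter_eq_some_le _ _ _)

theorem sum_scan_le {l : List (Anno V Q)} {hs : Anno V Q → List V}
    {g : Anno V Q → V → Rule (Anno V Q) S} {s : Finset (Rule (Anno V Q) S)} (k : ℕ)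
    (hl : l.Nodup) (hlN : ∀ y ∈ l, y ∈ annoNonterminals G Γ)
    (hhs : ∀ y, (hs y).Nodup)
    (hg : ∀ y ∈ l, ∀ c ∈ hs y, g y c ∈ s)
    (hinj : ∀ y c y' c', g y c = g y' c' → y = y' ∧ c = c') :
    (l.map fun y => 1 + ((hs y).map fun _ => k).sum).sum ≤
      (annoNonterminals G Γ).card + k * s.card := by
  have h1 := sum_length_le_card hl hhs hg hinj
  have h2 : l.length ≤ (annoNonterminals G Γ).card := by
    rw [← List.toFinset_card_of_nodup hl]
    exact Finset.card_le_card fun x hx => hlN x (List.mem_toFinset.1 hx)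
  have h3 : (l.map fun y => 1 + ((hs y).map fun _ => k).sum).sum =
      l.length + k * (l.map fun y => (hs y).length).sum := by
    clear hl hlN hg h1 h2
    induction l with
    | nil => simp
    | cons y l ih =>
      rw [List.map_cons, List.sum_cons, ih, List.map_cons, List.sum_cons, List.length_cons,
        List.map_const', List.sum_replicate, smul_eq_mul]
      ring
  rw [h3]
  exact add_le_add h2 (Nat.mul_le_mul_left k h1)

/-- Different calls of `produce` within one scan concern different rules, with `x` first on the
right-hand side in one scan and second in the other; hence the factor `occurrences G Γ x`. Only
partners in `D` matter for the result: the rule for a partner extracted later is treated when that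
partner is processed. As `x ∈ D`, rules with `x` twice are included. -/
theorem process_advances (tb : LookupTables G Γ)
    (hpq : pq.Amortized (annoNonterminals G Γ) (annoNonterminals G Γ).card a b timed R)
    (h : Inv G Γ R D κ p₀ st φ) {x : Anno V Q} (hx : x ∈ D) (hκ : κ x = p₀) :
    Advances (Inv G Γ R D κ p₀) timed (process tb x st) st φ T
      (1 + 2 * (annoNonterminals G Γ).card +
        (a + 5 * (annoNonterminals G Γ).card + 5) * occurrences G Γ x)
      fun st' => ∀ y ∈ D, ∀ d,
        (Rule.bin d x y ∈ annoRules G Γ → CostLE st'.cost d (κ x + κ y)) ∧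
        (Rule.bin d y x ∈ annoRules G Γ → CostLE st'.cost d (κ y + κ x)) := by
  have hkey : ∀ {st' φ'}, Inv G Γ R D κ p₀ st' φ' → ∀ y ∈ D, y ∈ st'.keys :=
    fun h' y hy => (h'.mem_keys y).2 ⟨_, (h'.cost_done y hy).1⟩
  have hxN := h.keys_mem x (hkey h x hx)
  unfold process
  rw [add_assoc]
  refine Advances.tick fun T' => ?_
  have hr1 : ∀ y ∈ st.starting x.2.2, ∀ c ∈ tb.binHeads x.1 y.1,
      Rule.bin (c, x.2.1, y.2.2) x y ∈ annoRules G Γ := by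
    intro y hy c hc
    obtain ⟨h1, h2⟩ := (h.mem_starting _ _).1 hy
    exact bin_mem_annoRules_of_mem hxN (h.keys_mem y h1) h2.symm ((tb.mem_binHeads _ _ _).1 hc)
  have hsum1 := sum_scan_le (G := G) (Γ := Γ)
    (s := (annoRules G Γ).filter fun r => r.fst = some x)
    (a + 5 * (annoNonterminals G Γ).card + 5) (h.nodup_starting x.2.2)
    (fun y hy => h.keys_mem y ((h.mem_starting _ _).1 hy).1)
    (fun y => tb.binHeads_nodup x.1 y.1)
    (fun y hy c hc => Finset.mem_filter.2 ⟨hr1 y hy c hc, rfl⟩) (by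
      intro y c y' c' he
      simp only [Rule.bin.injEq, Prod.mk.injEq] at he
      exact ⟨he.2.2, he.1.1⟩)
  have h1 := scan_advances (T := T') (e := fun _ => x) (f := id) hpq h hx hκ
    (fun y hy => ((h.mem_starting _ _).1 hy).1) (fun y => .inl ⟨rfl, rfl⟩) hr1
  unfold Advances
  rw [runs_bind]
  refine Runs.mono h1 ?_
  rintro st' T'' ⟨φ', h', hlow, hpost, hT⟩
  have hr2 : ∀ y ∈ st'.ending x.2.1, ∀ c ∈ tb.binHeads y.1 x.1,
      Rule.bin (c, y.2.1, x.2.2) y x ∈ annoRules G Γ := by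
    intro y hy c hc
    obtain ⟨h1, h2⟩ := (h'.mem_ending _ _).1 hy
    exact bin_mem_annoRules_of_mem (h'.keys_mem y h1) hxN h2 ((tb.mem_binHeads _ _ _).1 hc)
  have hsum2 := sum_scan_le (G := G) (Γ := Γ)
    (s := (annoRules G Γ).filter fun r => r.snd = some x)
    (a + 5 * (annoNonterminals G Γ).card + 5) (h'.nodup_ending x.2.1)
    (fun y hy => h'.keys_mem y ((h'.mem_ending _ _).1 hy).1)
    (fun y => tb.binHeads_nodup y.1 x.1)
    (fun y hy c hc => Finset.mem_filter.2 ⟨hr2 y hy c hc, rfl⟩) (by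
      intro y c y' c' he
      simp only [Rule.bin.injEq, Prod.mk.injEq] at he
      exact ⟨he.2.1, he.1.1⟩)
  have h2 := scan_advances (T := T'') (e := id) (f := fun _ => x) hpq h' hx hκ
    (fun y hy => ((h'.mem_ending _ _).1 hy).1) (fun y => .inr ⟨rfl, rfl⟩) hr2
  refine Runs.mono h2 ?_
  rintro st'' T₃ ⟨φ'', h'', hlow', hpost', hT'⟩
  refine ⟨φ'', h'', hlow.trans hlow', fun y hy d => ⟨fun hd => ?_, fun hd => ?_⟩, fun ht => ?_⟩
  · obtain ⟨-, -, -, e1, e2, e3, hd⟩ := bin_mem_annoRules.1 hd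
    have := hpost y ((h.mem_starting _ _).2 ⟨hkey h y hy, e2.symm⟩) hy d.1
      ((tb.mem_binHeads _ _ _).2 hd)
    rw [← e1, e3] at this
    exact this.mono hlow'
  · obtain ⟨-, -, -, e1, e2, e3, hd⟩ := bin_mem_annoRules.1 hd
    have := hpost' y ((h'.mem_ending _ _).2 ⟨hkey h' y hy, e2⟩) hy d.1
      ((tb.mem_binHeads _ _ _).2 hd)
    rw [← e1, e3] at this
    exact this
  · have e1 := hT ht
    have e2 := hT' ht
    rw [occurrences, mul_add]
    omega

theorem initialization_advances (tb : LookupTables G Γ)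
    (hpq : pq.Amortized (annoNonterminals G Γ) (annoNonterminals G Γ).card a b timed R) :
    Advances (Inv G Γ R ∅ κ 0) timed (initialization (pq := pq) tb) (Vars.init S pq) 0 T
      ((annoRules G Γ).card * (a + (annoNonterminals G Γ).card + 4))
      fun st' => ∀ d s, Rule.term d s ∈ annoRules G Γ → CostLE st'.cost d 1 := by
  set k := a + (annoNonterminals G Γ).card + 2 with hk
  have h0 : Inv G Γ R ∅ κ 0 (Vars.init S pq) 0 := by
    constructor <;> simp [Vars.init, hpq.empty]
  -- The invariant is strengthened: during the initialization all costs are `1`, so an item skipped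
  -- because it already has a cost also meets the bound.
  have step1 : ∀ (st : Vars S pq) (φ T : ℕ) (c : V) (s : S) (e : Q × Q),
      Inv G Γ R ∅ κ 0 st φ ∧ (∀ x p, st.cost x = some p → p = 1) →
      Rule.term (c, e.1, e.2) s ∈ annoRules G Γ →
      Advances (fun st φ => Inv G Γ R ∅ κ 0 st φ ∧ ∀ x p, st.cost x = some p → p = 1) timed
        (do
          tick 1
          match st.cost (c, e.1, e.2) with
          | none => addNew (Rule.term (c, e.1, e.2) s) 1 st
          | some _ => pure st) st φ T k fun st' => CostLE st'.cost (c, e.1, e.2) 1 := by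
    intro st φ T c s e ⟨h, hone⟩ hr
    refine (Advances.tick (w := k - 1) fun T' => ?_).mono (by omega) fun _ h => h
    rcases hc : st.cost (c, e.1, e.2) with _ | p
    · have h1 := addNew_advances (T := T') hpq h hr hc (p := 1) rfl (by omega) (by omega)
        (Nat.one_lt_two_pow (by omega))
      refine Runs.mono h1 ?_
      rintro st' T'' ⟨φ', h2, h3, h4, h5⟩
      refine ⟨φ', ⟨h2, fun x p hx => ?_⟩, h3, ⟨1, le_rfl, ?_⟩, fun ht => ?_⟩
      · rw [h4] at hx
        by_cases hxc : x = (Rule.term (c, e.1, e.2) s : Rule (Anno V Q) S).head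
        · rw [hxc, Function.update_self, Option.some_inj] at hx
          exact hx.symm
        · rw [Function.update_of_ne hxc] at hx
          exact hone x p hx
      · rw [h4]
        exact Function.update_self _ _ _
      · have := h5 ht
        omega
    · exact runs_pure.2 ⟨φ, ⟨h, hone⟩, Lowers.refl _, ⟨p, (hone _ _ hc).le, hc⟩, fun _ => by omega⟩
  have hterm : ∀ s, ∀ c ∈ tb.termHeads s, ∀ e ∈ tb.edgesOf s,
      Rule.term (c, e.1, e.2) s ∈ annoRules G Γ := fun s c hc e he =>
    term_mem_annoRules.2 ⟨(tb.mem_termHeads _ _).1 hc, (tb.mem_edgesOf _ _ _).1 he⟩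
  have main : Advances (fun st φ => Inv G Γ R ∅ κ 0 st φ ∧ ∀ x p, st.cost x = some p → p = 1) timed
      (initialization (pq := pq) tb) (Vars.init S pq) 0 T
      (tb.symbols.map fun s => 1 + ((tb.termHeads s).map fun _ => 1 +
        ((tb.edgesOf s).map fun _ => k).sum).sum).sum
      fun st' => ∀ s ∈ tb.symbols, ∀ c ∈ tb.termHeads s, ∀ e ∈ tb.edgesOf s,
        CostLE st'.cost (c, e.1, e.2) 1 := by
    unfold initialization
    refine forEach_advances (fun s hs st φ T h _ => Advances.tick fun T' => ?_) ?_
      ⟨h0, by simp [Vars.init]⟩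
    · refine forEach_advances (fun c hc st φ T h _ => Advances.tick fun T' => ?_) ?_ h
      · refine forEach_advances (fun e he st φ T h _ => ?_) ?_ h
        · exact step1 st φ T c s e h (hterm s c hc e he)
        · exact fun e _ _ h1 h2 => h1.mono h2
      · exact fun c _ _ h1 h2 e he => (h1 e he).mono h2
    · exact fun s _ _ h1 h2 c hc e he => (h1 c hc e he).mono h2
  have hcount := sum_length_le_card (s := annoRules G Γ) (l := tb.symbols)
    (hs := fun s => tb.termHeads s ×ˢ tb.edgesOf s)
    (g := fun s p => Rule.term (p.1, p.2.1, p.2.2) s) tb.symbols_nodup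
    (fun s => (tb.termHeads_nodup s).product (tb.edgesOf_nodup s)) (by
      rintro s - ⟨c, e⟩ hp
      obtain ⟨hc, he⟩ := List.mem_product.1 hp
      exact hterm s c hc e he) (by
      rintro s ⟨c, m, n⟩ s' ⟨c', m', n'⟩ he
      simp only [Rule.term.injEq, Prod.mk.injEq] at he
      simp [he])
  -- The table lists only symbols that occur in a rule and on an edge. So the overhead of the two
  -- outer loops is at most two steps per pair of a head and an edge, and is absorbed in `k + 2`.
  have hsum : (tb.symbols.map fun s => 1 + ((tb.termHeads s).map fun _ => 1 +
      ((tb.edgesOf s).map fun _ => k).sum).sum).sum ≤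
      (tb.symbols.map fun s => (tb.termHeads s ×ˢ tb.edgesOf s).length * (k + 2)).sum := by
    refine List.sum_le_sum fun s hs => ?_
    obtain ⟨⟨c, hc⟩, m, n, he⟩ := (tb.mem_symbols s).1 hs
    have h1 := List.length_pos_of_mem ((tb.mem_termHeads s c).2 hc)
    have h2 := List.length_pos_of_mem ((tb.mem_edgesOf s m n).2 he)
    simp only [List.map_const', List.sum_replicate, smul_eq_mul, List.length_product]
    have h3 := Nat.mul_le_mul h1 h2
    have h4 := Nat.mul_le_mul_left (tb.termHeads s).length h2
    calc 1 + (tb.termHeads s).length * (1 + (tb.edgesOf s).length * k)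
        = 1 + (tb.termHeads s).length * 1 +
          (tb.termHeads s).length * (tb.edgesOf s).length * k := by ring
      _ ≤ (tb.termHeads s).length * (tb.edgesOf s).length +
          (tb.termHeads s).length * (tb.edgesOf s).length +
          (tb.termHeads s).length * (tb.edgesOf s).length * k := by omega
      _ = _ := by ring
  rw [List.sum_map_mul_right] at hsum
  have hw := hsum.trans (Nat.mul_le_mul_right (k + 2) hcount)
  refine Runs.mono main ?_
  rintro st T' ⟨φ, h1, h2, h3, h4⟩
  refine ⟨φ, h1.1, h2, fun d s hd => ?_, fun ht => (h4 ht).trans ?_⟩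
  · obtain ⟨h5, h6⟩ := term_mem_annoRules.1 hd
    exact h3 s ((tb.mem_symbols s).2 ⟨⟨_, h5⟩, _, _, h6⟩) d.1 ((tb.mem_termHeads _ _).2 h5) d.2
      ((tb.mem_edgesOf _ _ _).2 h6)
  · exact Nat.add_le_add_left hw _

end MinimizingRules

/-! ### The main loop and the returned rules -/

namespace MinimizingRules

open Timed

variable {V : Type u} {S : Type v} {Q : Type w} [DecidableEq V] [DecidableEq Q]
  {pq : PriorityQueue (Anno V Q)} {G : Grammar V S} {Γ : LabeledGraph Q S}
  {R : pq.Heap → (Anno V Q → Option ℕ) → ℕ → Prop} {D : Finset (Anno V Q)}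
  {κ : Anno V Q → ℕ} {p₀ φ a b T : ℕ} {st : Vars S pq} {timed : Prop}

/-- An item `x` of least priority is taken from the queue. -/
theorem Inv.extract (h : Inv G Γ R D κ p₀ st φ) {x : Anno V Q} {p φ' : ℕ} {g : pq.Heap}
    (hxD : x ∉ D) (hx : st.cost x = some p) (hmin : ∀ y ∉ D, ∀ q, st.cost y = some q → p ≤ q)
    (hR : R g (Function.update (fun y => if y ∈ D then none else st.cost y) x none) φ') :
    Inv G Γ R (insert x D) (Function.update κ x p) p { st with new := g } φ' := by
  refine ⟨?_, h.mem_keys, h.nodup_keys, h.keys_mem, h.nodup_starting, h.mem_starting,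
    h.nodup_ending, h.mem_ending, h.cost_lt, ?_, ?_, h.rule⟩
  · convert hR using 1
    funext y
    rcases eq_or_ne y x with rfl | hyx
    · simp
    · simp [hyx]
  · intro y hy
    rcases eq_or_ne y x with rfl | hyx
    · rw [Function.update_self]
      exact ⟨hx, le_rfl⟩
    · rw [Function.update_of_ne hyx]
      obtain ⟨h1, h2⟩ := h.cost_done y (Finset.mem_of_mem_insert_of_ne hy hyx)
      exact ⟨h1, h2.trans (h.le_cost x hxD p hx)⟩
  · intro y hy q hq
    exact hmin y (fun hc => hy (Finset.mem_insert_of_mem hc)) q hq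

/-- The rules with items of `D` on the right-hand side have been taken into account. -/
structure Closed (G : Grammar V S) (Γ : LabeledGraph Q S) (D : Finset (Anno V Q))
    (κ : Anno V Q → ℕ) (st : Vars S pq) : Prop where
  term : ∀ d s, Rule.term d s ∈ annoRules G Γ → CostLE st.cost d 1
  bin : ∀ d, ∀ e ∈ D, ∀ f ∈ D, Rule.bin d e f ∈ annoRules G Γ → CostLE st.cost d (κ e + κ f)

/-- Each iteration moves a new annotated nonterminal into `D`, and none ever returns to the queue.
Hence `D` measures termination, and the cost of each extraction is counted once in the sum over the
annotated nonterminals. -/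
theorem mainLoop_runs (tb : LookupTables G Γ)
    (hpq : pq.Amortized (annoNonterminals G Γ) (annoNonterminals G Γ).card a b timed R)
    (h : Inv G Γ R ∅ κ 0 st φ)
    (hterm : ∀ d s, Rule.term d s ∈ annoRules G Γ → CostLE st.cost d 1) :
    Runs (mainLoop tb st) T fun st' T' => ∃ D κ p₀ φ', Inv G Γ R D κ p₀ st' φ' ∧
      Closed G Γ D κ st' ∧ (∀ x ∈ st'.keys, x ∈ D) ∧
      (timed → T' ≤ T + φ + 1 + b + ∑ x ∈ annoNonterminals G Γ,
        (2 + b + 2 * (annoNonterminals G Γ).card +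
          (a + 5 * (annoNonterminals G Γ).card + 5) * occurrences G Γ x)) := by
  unfold mainLoop
  refine runs_loop (I := fun n st' T' => ∃ D κ p₀ φ', Inv G Γ R D κ p₀ st' φ' ∧
    Closed G Γ D κ st' ∧ D ⊆ annoNonterminals G Γ ∧ n = (annoNonterminals G Γ).card - D.card ∧
    (timed → T' + φ' ≤ T + φ + ∑ x ∈ D, (2 + b + 2 * (annoNonterminals G Γ).card +
      (a + 5 * (annoNonterminals G Γ).card + 5) * occurrences G Γ x)))
    ?_ _ st T ⟨∅, κ, 0, φ, h, ⟨hterm, by simp⟩, by simp, rfl, by simp⟩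
  rintro n st T' ⟨D, κ, p₀, φ', h, hc, hDN, rfl, hT⟩
  rw [runs_bind, runs_tick, runs_bind, runs_andThen]
  by_cases hempty : ∀ x, (if x ∈ D then none else st.cost x) = none
  · refine (hpq.extractMin_none _ _ _ _ h.heap hempty).mono ?_
    rintro _ T'' ⟨rfl, hT''⟩
    rw [runs_ret]
    simp only [runs_pure, Sum.elim_inr]
    refine ⟨D, κ, p₀, φ', h, hc, fun x hx => ?_, fun ht => ?_⟩
    · obtain ⟨p, hp⟩ := (h.mem_keys x).1 hx
      by_contra hxD
      have := hempty x
      rw [if_neg hxD, hp] at this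
      cases this
    · have h1 := hT ht
      have h2 := hT'' ht
      have h3 := Finset.sum_le_sum_of_subset (f := fun x =>
        2 + b + 2 * (annoNonterminals G Γ).card +
          (a + 5 * (annoNonterminals G Γ).card + 5) * occurrences G Γ x) hDN
      omega
  · rw [not_forall] at hempty
    refine (hpq.extractMin_some _ _ _ _ h.heap hempty).mono ?_
    rintro _ T'' ⟨x, p, g, φ'', rfl, hx, hmin, hR, hT''⟩
    have hxD : x ∉ D := fun hc => by simp [hc] at hx
    rw [if_neg hxD] at hx
    have h' := h.extract hxD hx (fun y hy q hq => hmin y q (by rw [if_neg hy, hq])) hR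
    have hxN := h.keys_mem x ((h.mem_keys x).2 ⟨p, hx⟩)
    have hDN' : insert x D ⊆ annoNonterminals G Γ := Finset.insert_subset hxN hDN
    rw [runs_ret]
    simp only [runs_bind]
    refine Runs.mono (process_advances tb hpq h' (Finset.mem_insert_self x D)
      (Function.update_self _ _ _)) ?_
    rintro st' T₃ ⟨φ₃, h₃, hlow, hpost, hT₃⟩
    simp only [runs_pure, Sum.elim_inl]
    refine ⟨_, ?_, insert x D, Function.update κ x p, p, φ₃, h₃,
      ⟨fun d s hd => (hc.term d s hd).mono hlow, ?_⟩, hDN', rfl, fun ht => ?_⟩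
    · have h1 := Finset.card_le_card hDN'
      rw [Finset.card_insert_of_notMem hxD] at h1 ⊢
      omega
    -- A rule whose body contains `x` was offered just now; any other was covered before, and costs
    -- have only gone down since.
    · intro d e he f hf hd
      rcases eq_or_ne e x with rfl | hex
      · exact (hpost f hf d).1 hd
      · rcases eq_or_ne f x with rfl | hfx
        · exact (hpost e he d).2 hd
        · rw [Function.update_of_ne hex, Function.update_of_ne hfx]
          exact (hc.bin d e (Finset.mem_of_mem_insert_of_ne he hex) f
            (Finset.mem_of_mem_insert_of_ne hf hfx) hd).mono hlow
    · have h1 := hT ht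
      have h2 := hT'' ht
      have h3 := hT₃ ht
      rw [Finset.sum_insert hxD]
      omega

/-- At the end all costed items are extracted, so `κ` is the cost. `Closed` bounds the cost of a
head by the sum over the body for every rule, and `Justifies` gives the converse for the stored one.
-/
theorem isMinimizing_of_inv (h : Inv G Γ R D κ p₀ st φ) (hc : Closed G Γ D κ st)
    (hD : ∀ x ∈ st.keys, x ∈ D) :
    IsMinimizing (annotatedGrammar G Γ) {r | r ∈ st.keys.filterMap st.rule} := by
  have hmem : ∀ r, r ∈ st.keys.filterMap st.rule ↔
      r.head ∈ st.keys ∧ st.rule r.head = some r := by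
    intro r
    rw [List.mem_filterMap]
    constructor
    · rintro ⟨x, hx, hr⟩
      obtain ⟨p, hp⟩ := (h.mem_keys x).1 hx
      obtain ⟨r', -, h2, h3, -⟩ := h.rule x p hp
      rw [hr, Option.some_inj] at h2
      subst h2 h3
      exact ⟨hx, hr⟩
    · exact fun hr => ⟨_, hr⟩
  have hspec : ∀ r, r ∈ st.keys.filterMap st.rule → r ∈ annoRules G Γ ∧
      Justifies st.cost (κ r.head) r := by
    intro r hr
    obtain ⟨h1, h2⟩ := (hmem r).1 hr
    obtain ⟨r', h3, h4, -, h5⟩ := h.rule r.head _ (h.cost_done _ (hD _ h1)).1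
    rw [h2, Option.some_inj] at h4
    subst h4
    exact ⟨h3, h5⟩
  have hheads : ∀ x, x ∈ heads {r | r ∈ st.keys.filterMap st.rule} ↔ x ∈ st.keys := by
    intro x
    constructor
    · rintro ⟨r, hr, rfl⟩
      exact ((hmem r).1 hr).1
    · intro hx
      obtain ⟨p, hp⟩ := (h.mem_keys x).1 hx
      obtain ⟨r, -, h2, rfl, -⟩ := h.rule x p hp
      exact ⟨r, (hmem r).2 ⟨hx, h2⟩, rfl⟩
  have hle : ∀ x k, CostLE st.cost x k → x ∈ st.keys ∧ κ x ≤ k := by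
    rintro x k ⟨p, hp, hx⟩
    have h1 := (h.mem_keys x).2 ⟨p, hx⟩
    have h2 := (h.cost_done x (hD x h1)).1
    rw [hx, Option.some_inj] at h2
    exact ⟨h1, h2 ▸ hp⟩
  refine isMinimizing_of_cost κ (fun r hr => (hspec r hr).1) ?_ ?_ ?_ ?_ ?_ ?_
  · intro r hr r' hr' he
    have h1 := ((hmem r).1 hr).2
    have h2 := ((hmem r').1 hr').2
    rw [he, h2, Option.some_inj] at h1
    exact h1.symm
  · intro x s hr
    rw [hheads]
    exact hle x 1 (hc.term x s hr)
  · intro x y z hr hy hz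
    rw [hheads] at hy hz ⊢
    exact hle x _ (hc.bin x y (hD y hy) z (hD z hz) hr)
  · exact fun x s hr => (hspec _ hr).2
  · intro x y z hr
    obtain ⟨h1, p, q, hp, hq, hle'⟩ := hspec _ hr
    have hy := (h.mem_keys y).2 ⟨p, hp⟩
    have hz := (h.mem_keys z).2 ⟨q, hq⟩
    have h2 := (h.cost_done y (hD y hy)).1
    have h3 := (h.cost_done z (hD z hz)).1
    rw [hp, Option.some_inj] at h2
    rw [hq, Option.some_inj] at h3
    subst h2 h3
    exact ⟨(hheads y).2 hy, (hheads z).2 hz,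
      le_antisymm (hle x _ (hc.bin x y (hD y hy) z (hD z hz) h1)).2 hle'⟩
  · intro x hx
    exact (h.cost_lt x _ (h.cost_done x (hD x ((hheads x).1 hx))).1).1

theorem run_runs (tb : LookupTables G Γ)
    (hpq : pq.Amortized (annoNonterminals G Γ) (annoNonterminals G Γ).card a b timed R) :
    Runs (run pq tb) 0 fun out T => IsMinimizing (annotatedGrammar G Γ) {r | r ∈ out} ∧
      (timed → T ≤ (annoRules G Γ).card * (a + (annoNonterminals G Γ).card + 4) +
        (annoNonterminals G Γ).card * (2 + b + 2 * (annoNonterminals G Γ).card) +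
        (a + 5 * (annoNonterminals G Γ).card + 5) * (2 * (annoRules G Γ).card) +
        (annoNonterminals G Γ).card + b + 3) := by
  unfold run
  rw [runs_bind, runs_tick, runs_bind]
  refine Runs.mono (initialization_advances (κ := fun _ => 0) tb hpq) ?_
  rintro st T ⟨φ, h, -, hterm, hT⟩
  rw [runs_bind]
  refine (mainLoop_runs tb hpq h hterm).mono ?_
  rintro st' T' ⟨D, κ, p₀, φ', h', hc, hD, hT'⟩
  rw [runs_bind, runs_tick, runs_pure]
  refine ⟨isMinimizing_of_inv h' hc hD, fun ht => ?_⟩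
  have h1 := hT ht
  have h2 := hT' ht
  have h3 := h'.length_keys_le
  rw [Finset.sum_add_distrib, Finset.sum_const, smul_eq_mul, ← Finset.mul_sum] at h2
  have h4 := Nat.mul_le_mul_left (a + 5 * (annoNonterminals G Γ).card + 5)
    (sum_occurrences_le (G := G) (Γ := Γ))
  omega

end MinimizingRules

/-! ### Size of the annotated grammar and the explicit time bounds -/

section Sizes

variable {V : Type u} {S : Type v} {Q : Type w} {G : Grammar V S} {Γ : LabeledGraph Q S}

theorem card_annoNonterminals_le :
    (annoNonterminals G Γ).card ≤ G.nonterminals.card * Γ.nodes.card ^ 2 := by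
  classical
  rw [annoNonterminals]
  refine (Finset.card_filter_le _ _).trans ?_
  rw [Finset.card_product, Finset.card_product, sq]

theorem card_annoRules_le : (annoRules G Γ).card ≤ G.rules.card * Γ.nodes.card ^ 3 +
    min G.nonterminals.card G.rules.card * Γ.edges.card := by
  classical
  set B := (annoRules G Γ).filter fun r => ∃ x y z, r = Rule.bin x y z with hB
  set C := (annoRules G Γ).filter fun r => ¬∃ x y z, r = Rule.bin x y z with hC
  have hsplit : B.card + C.card = (annoRules G Γ).card := Finset.card_filter_add_card_filter_not _
  have hBcard : B.card ≤ (G.rules ×ˢ Γ.nodes ×ˢ Γ.nodes ×ˢ Γ.nodes).card := by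
    -- A binary annotated rule is determined by the rule and three nodes. The value on terminal
    -- rules is arbitrary.
    refine (Finset.card_le_card (t := (G.rules ×ˢ Γ.nodes ×ˢ Γ.nodes ×ˢ Γ.nodes).image
      fun t => match t.1 with
        | .bin a b c => Rule.bin (a, t.2.1, t.2.2.2) (b, t.2.1, t.2.2.1) (c, t.2.2.1, t.2.2.2)
        | .term a s => Rule.term (a, t.2.1, t.2.1) s) ?_).trans Finset.card_image_le
    intro r hr
    obtain ⟨hr, ⟨a, m, n⟩, ⟨b, m', o⟩, ⟨c, o', n'⟩, rfl⟩ := Finset.mem_filter.1 hr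
    obtain ⟨h1, h2, -, h3, h4, h5, h6⟩ := bin_mem_annoRules.1 hr
    simp only at h3 h4 h5 h6
    subst h3 h4 h5
    obtain ⟨-, hm, hn, -⟩ := mem_annoNonterminals.1 h1
    obtain ⟨-, -, ho, -⟩ := mem_annoNonterminals.1 h2
    refine Finset.mem_image.2 ⟨(Rule.bin a b c, m, o, n'), ?_, rfl⟩
    simp only [Finset.mem_product]
    exact ⟨h6, hm, ho, hn⟩
  have hCmem : ∀ r ∈ C, ∃ a m n s, r = Rule.term (a, m, n) s ∧ Rule.term a s ∈ G.rules ∧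
      (m, s, n) ∈ Γ.edges := by
    intro r hr
    obtain ⟨hr, hne⟩ := Finset.mem_filter.1 hr
    cases r with
    | bin x y z => exact absurd ⟨x, y, z, rfl⟩ hne
    | term x s => exact ⟨x.1, x.2.1, x.2.2, s, rfl, term_mem_annoRules.1 hr⟩
  -- Terminal annotated rules are counted in two ways, by head and edge and by rule and edge;
  -- together these give the minimum.
  have hC1 : C.card ≤ (G.nonterminals ×ˢ Γ.edges).card := by
    refine (Finset.card_le_card (t := (G.nonterminals ×ˢ Γ.edges).image
      fun t => Rule.term (t.1, t.2.1, t.2.2.2) t.2.2.1) ?_).trans Finset.card_image_le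
    intro r hr
    obtain ⟨a, m, n, s, rfl, h1, h2⟩ := hCmem r hr
    exact Finset.mem_image.2 ⟨(a, m, s, n), Finset.mem_product.2 ⟨G.head_mem _ h1, h2⟩, rfl⟩
  have hC2 : C.card ≤ (G.rules ×ˢ Γ.edges).card := by
    refine (Finset.card_le_card (t := (G.rules ×ˢ Γ.edges).image
      fun t => Rule.term (t.1.head, t.2.1, t.2.2.2) t.2.2.1) ?_).trans Finset.card_image_le
    intro r hr
    obtain ⟨a, m, n, s, rfl, h1, h2⟩ := hCmem r hr
    exact Finset.mem_image.2 ⟨(Rule.term a s, m, s, n), Finset.mem_product.2 ⟨h1, h2⟩, rfl⟩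
  simp only [Finset.card_product] at hBcard hC1 hC2
  rw [← hsplit]
  refine add_le_add (hBcard.trans (le_of_eq (by ring))) ?_
  rcases min_choice G.nonterminals.card G.rules.card with h | h
  · rwa [h]
  · rwa [h]

theorem card_annoRules_eq_zero (h : (annoNonterminals G Γ).card = 0) :
    (annoRules G Γ).card = 0 := by
  rw [Finset.card_eq_zero] at h ⊢
  refine Finset.eq_empty_of_forall_notMem fun r hr => ?_
  have := (annotatedGrammar G Γ).head_mem r hr
  have : r.head ∈ annoNonterminals G Γ := this
  simp [h] at this

end Sizes

/-- All terms are absorbed into `90 * ((N + 1) ^ 2 * (L + 1) + (N + 1) * P)`. To replace `N + 1` by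
`N` and `L + 1` by a multiple of the logarithm, `N ≥ 2` is needed; `N = 0`, where `P = 0` enters,
and `N = 1` fall under the maximum with `1`. For `N ≥ 2` the factors `4` and `3` give `90 * 12 =
1080`. -/
theorem fibonacci_time_le {N P t : ℕ} (hP : N = 0 → P = 0)
    (ht : t ≤ P * (24 * (N + 1) + N + 4) +
      N * (2 + 40 * (N + 1) * (Nat.log 2 N + 1) + 2 * N) +
      (24 * (N + 1) + 5 * N + 5) * (2 * P) + N + 40 * (N + 1) * (Nat.log 2 N + 1) + 3) :
    (t : ℝ) ≤ 1080 * max 1 (N * (N * Real.log N + P)) := by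
  set L := Nat.log 2 N with hL
  have h1 : t ≤ 90 * ((N + 1) ^ 2 * (L + 1) + (N + 1) * P) := by
    refine ht.trans ?_
    have : (N + 1) ^ 2 ≤ (N + 1) ^ 2 * (L + 1) := Nat.le_mul_of_pos_right _ (by omega)
    nlinarith [Nat.zero_le (N * P), Nat.zero_le P, Nat.zero_le N]
  have h2 : (t : ℝ) ≤ 90 * ((N + 1) ^ 2 * (L + 1) + (N + 1) * P) := by exact_mod_cast h1
  refine h2.trans ?_
  have hmax1 := le_max_left (1 : ℝ) (N * (N * Real.log N + P))
  have hmax2 := le_max_right (1 : ℝ) (N * (N * Real.log N + P))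
  rcases N with _ | _ | N
  · simp [hP rfl, hL]
    norm_num
  · simp only [hL, zero_add, Nat.log_one_right, Nat.cast_zero, Nat.cast_one, Real.log_one,
      mul_zero, one_mul] at hmax1 hmax2 ⊢
    linarith
  · set M : ℝ := ((N + 1 + 1 : ℕ) : ℝ) with hM
    have hM2 : (2 : ℝ) ≤ M := by
      rw [hM]
      push_cast
      linarith [Nat.cast_nonneg (α := ℝ) N]
    -- With this bound both `L` and `1` are at most `3 / 2` times the logarithm of `M`.
    have hlog2 : (2 : ℝ) / 3 ≤ Real.log 2 := by linarith [Real.log_two_gt_d9]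
    have h3 : Real.log 2 ≤ Real.log M := Real.log_le_log (by norm_num) hM2
    have h4 : (L : ℝ) * Real.log 2 ≤ Real.log M := by
      have h5 : 2 ^ L ≤ N + 1 + 1 := Nat.pow_log_le_self 2 (by omega)
      have h6 : (2 : ℝ) ^ L ≤ M := by
        rw [hM]
        exact_mod_cast h5
      rw [← Real.log_pow]
      exact Real.log_le_log (by positivity) h6
    have h5 : (L : ℝ) + 1 ≤ 3 * Real.log M := by
      have : (L : ℝ) * (2 / 3) ≤ L * Real.log 2 :=
        mul_le_mul_of_nonneg_left hlog2 (Nat.cast_nonneg L)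
      linarith
    have hP0 : (0 : ℝ) ≤ P := Nat.cast_nonneg P
    have h6 : (M + 1) ^ 2 * ((L : ℝ) + 1) ≤ (4 * M ^ 2) * (3 * Real.log M) := by
      refine mul_le_mul ?_ h5 (by positivity) (by positivity)
      nlinarith
    have h7 : (M + 1) * (P : ℝ) ≤ 2 * M * P := mul_le_mul_of_nonneg_right (by linarith) hP0
    have h8 : 0 ≤ M * P := by positivity
    nlinarith

theorem mainTheorem10 :
    ∃ (C : ℝ) (B : MvPolynomial (Fin 4) ℕ),
      ∀ (V : Type u) (S : Type v) (Q : Type w) [DecidableEq V] [DecidableEq Q]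
        (G : Grammar V S) (Γ : LabeledGraph Q S) (T : LookupTables G Γ),
        (∀ pq : PriorityQueue (Anno V Q), pq.IsCorrect →
          ∃ out t, MinimizingRules.run pq T = some (out, t) ∧
            IsMinimizing (annotatedGrammar G Γ) {r | r ∈ out}) ∧
        (∃ out t, MinimizingRules.run (fibonacciHeap (Anno V Q)) T = some (out, t) ∧
          IsMinimizing (annotatedGrammar G Γ) {r | r ∈ out} ∧
          (∀ NG PG : ℝ, NG = ((annotatedGrammar G Γ).nonterminals.card : ℝ) →
            PG = ((annotatedGrammar G Γ).rules.card : ℝ) →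
            (t : ℝ) ≤ C * max 1 (NG * (NG * Real.log NG + PG))) ∧
          (∀ n q p d : ℕ, n = G.nonterminals.card → q = Γ.nodes.card → p = G.rules.card →
            d = Γ.edges.card →
            (t : ℝ) ≤ C * max 1 ((n : ℝ) * q ^ 2 *
              ((n * q ^ 2) * Real.log (n * q ^ 2) + p * q ^ 3 + min n p * d)) ∧
            t ≤ MvPolynomial.eval ![n, q, p, d] B)) := by
  -- The polynomial arises from the explicit bound by replacing the logarithm by its argument, the
  -- minimum by `n`, and the maximum with `1` by a sum.
  refine ⟨1080, 1080 * (1 + MvPolynomial.X 0 * MvPolynomial.X 1 ^ 2 *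
    ((MvPolynomial.X 0 * MvPolynomial.X 1 ^ 2) ^ 2 +
      MvPolynomial.X 2 * MvPolynomial.X 1 ^ 3 + MvPolynomial.X 0 * MvPolynomial.X 3)), ?_⟩
  intro V S Q _ _ G Γ T
  constructor
  · intro pq hpq
    obtain ⟨R, hR⟩ := hpq.amortized (annoNonterminals G Γ) (annoNonterminals G Γ).card 0 0
    obtain ⟨out, t, h1, h2, -⟩ := MinimizingRules.run_runs T hR
    exact ⟨out, t, h1, h2⟩
  · obtain ⟨R, hR⟩ := fibonacciHeap_amortized (annoNonterminals G Γ) (annoNonterminals G Γ).card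
    obtain ⟨out, t, h1, h2, h3⟩ := MinimizingRules.run_runs T hR
    have ht := h3 trivial
    rw [zero_add] at ht
    have htime := fibonacci_time_le card_annoRules_eq_zero ht
    refine ⟨out, t, h1, h2, ?_, ?_⟩
    · rintro _ _ rfl rfl
      exact htime
    · rintro n q p d rfl rfl rfl rfl
      have hN := card_annoNonterminals_le (G := G) (Γ := Γ)
      have hP := card_annoRules_le (G := G) (Γ := Γ)
      set N := (annoNonterminals G Γ).card
      set P := (annoRules G Γ).card
      set n := G.nonterminals.card
      set q := Γ.nodes.card
      set p := G.rules.card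
      set d := Γ.edges.card
      have hN' : (N : ℝ) ≤ n * q ^ 2 := by exact_mod_cast hN
      have hP' : (P : ℝ) ≤ p * q ^ 3 + min (n : ℝ) p * d := by exact_mod_cast hP
      -- For `N = 0` the default value `Real.log 0 = 0` is used; the right-hand side is nonnegative
      -- as the logarithm of a natural number.
      have hlog : Real.log N ≤ Real.log (n * q ^ 2) := by
        rcases Nat.eq_zero_or_pos N with h0 | h0
        · rw [h0, Nat.cast_zero, Real.log_zero]
          exact_mod_cast Real.log_natCast_nonneg (n * q ^ 2)
        · exact Real.log_le_log (by exact_mod_cast h0) hN'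
      have hlog0 : 0 ≤ Real.log N := Real.log_natCast_nonneg N
      have hmin0 : (0 : ℝ) ≤ min (n : ℝ) p := le_min (Nat.cast_nonneg _) (Nat.cast_nonneg _)
      have hX : (N : ℝ) * (N * Real.log N + P) ≤ (n : ℝ) * q ^ 2 *
          ((n * q ^ 2) * Real.log (n * q ^ 2) + p * q ^ 3 + min (n : ℝ) p * d) := by
        refine mul_le_mul hN' ?_ (by positivity) (by positivity)
        have := mul_le_mul hN' hlog hlog0 (by positivity)
        linarith
      have hbound : (t : ℝ) ≤ 1080 * max 1 ((n : ℝ) * q ^ 2 *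
          ((n * q ^ 2) * Real.log (n * q ^ 2) + p * q ^ 3 + min (n : ℝ) p * d)) :=
        htime.trans (mul_le_mul_of_nonneg_left (max_le_max le_rfl hX) (by norm_num))
      refine ⟨by exact_mod_cast hbound, ?_⟩
      have hlog' : Real.log (n * q ^ 2) ≤ n * q ^ 2 :=
        Real.log_le_self (by positivity)
      have hY : (n : ℝ) * q ^ 2 *
          ((n * q ^ 2) * Real.log (n * q ^ 2) + p * q ^ 3 + min (n : ℝ) p * d) ≤
          n * q ^ 2 * ((n * q ^ 2) ^ 2 + p * q ^ 3 + n * d) := by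
        refine mul_le_mul_of_nonneg_left ?_ (by positivity)
        rw [sq ((n : ℝ) * q ^ 2)]
        have e1 : ((n : ℝ) * q ^ 2) * Real.log (n * q ^ 2) ≤ (n * q ^ 2) * (n * q ^ 2) :=
          mul_le_mul_of_nonneg_left hlog' (by positivity)
        have e2 : min (n : ℝ) p * d ≤ n * d :=
          mul_le_mul_of_nonneg_right (min_le_left _ _) (Nat.cast_nonneg d)
        linarith
      have hZ : (t : ℝ) ≤ 1080 * (1 + n * q ^ 2 * ((n * q ^ 2) ^ 2 + p * q ^ 3 + n * d)) := by
        refine hbound.trans (mul_le_mul_of_nonneg_left (max_le ?_ ?_) (by norm_num))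
        · have : (0 : ℝ) ≤ n * q ^ 2 * ((n * q ^ 2) ^ 2 + p * q ^ 3 + n * d) := by positivity
          linarith
        · linarith
      have hW : t ≤ 1080 * (1 + n * q ^ 2 * ((n * q ^ 2) ^ 2 + p * q ^ 3 + n * d)) := by
        exact_mod_cast hZ
      refine hW.trans (le_of_eq ?_)
      simp [MvPolynomial.eval_X]
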